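/- An $O(N)^3$-invariant graph is a finite graph obtained as follows. Take finitely many tetrahedral bubbles, each being a copy of the complete graph on the vertices $0,1,2,3$ with edges properly coloured by $1,2,3$: colour $1$ on $\{0,1\},\{2,3\}$, colour $2$ on $\{0,2\},\{1,3\}$, colour $3$ on $\{0,3\},\{1,2\}$. Then join all the vertices of the bubbles in pairs by edges of colour $0$. Isomorphisms preserve all four colours. A face of colour $i\in\{1,2,3\}$ is a bicoloured cycle of colours $\{0,i\}$, and its length is its number of edges of colour $0$. The jacket $J_i$ is the $3$-coloured graph obtained by deleting the edges of colour $i$. It encodes a closed surface whose faces are its bicoloured cycles (one family for each pair of its colours); its genus $g_i\in\frac12\mathbb Z$ is given by $2-2g_i=V-E(J_i)+F(J_i)$, where $V$, $E(J_i)$, $F(J_i)$ are its numbers of vertices, edges and faces. The degree of a connected graph is $\omega=g_1+g_2+g_3$. A graph is 2PI if no removal of two edges of colour $0$ disconnects it, and dipole-free if no face of length $2$ passes through two distinct bubbles. **Theorem.** Up to isomorphism, there is a unique connected, 2PI, dipole-free $O(N)^3$-invariant graph of degree $3/2$. It has five bubbles, $b_*$ and $b_0,b_1,b_2,b_3$,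 and the following edges of colour $0$: for each $s\in\{0,1,2,3\}$, the vertex $s$ of $b_*$ is joined to the vertex $0$ of $b_s$; and for each $t\in\{1,2,3\}$ and each pair $\{s,s'\}$ of vertices joined by an edge of colour $t$ in the tetrahedral bubble, the vertex $t$ of $b_s$ is joined to the vertex $t$ of $b_{s'}$. Each of its three jackets has genus $1/2$ and the surface that it encodes is homeomorphic to the real projective plane. For each colour $i\in\{1,2,3\}$ it has exactly three faces of colour $i$, two of length $3$ and one of length $4$. -/

import Mathlib

/-- A (multi)graph on the vertex set `V`, properly edge-coloured by `C`, in which every vertex has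
exactly one incident edge of each colour. `nbr c v` is the other end of the edge of colour `c`
at `v`. Parallel edges of different colours are allowed. -/
structure ColoredGraph (C V : Type*) where
  nbr : C → V → V
  nbr_involutive : ∀ c, Function.Involutive (nbr c)
  nbr_ne : ∀ c v, nbr c v ≠ v

namespace ColoredGraph

variable {C V W : Type*}

/-- The edges of colour `c`, each given by its pair of ends. -/
def edges (G : ColoredGraph C V) (c : C) : Set (Sym2 V) :=
  Set.range fun v => s(v, G.nbr c v)

/-- The adjacency relation of `G` after the edges of colour `c` that belong to `E` are removed. -/
def remove (G : ColoredGraph C V) (c : C) (E : Set (Sym2 V)) : SimpleGraph V where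
  Adj v w := ∃ a, G.nbr a v = w ∧ ¬ (a = c ∧ s(v, w) ∈ E)
  symm := ⟨by
    rintro v w ⟨a, rfl, h⟩
    exact ⟨a, G.nbr_involutive a v, by rwa [Sym2.eq_swap]⟩⟩
  loopless := ⟨by
    rintro v ⟨a, h, -⟩
    exact G.nbr_ne a v h⟩

/-- The adjacency relation given by the edges with a colour in `S`. -/
def restrict (G : ColoredGraph C V) (S : Set C) : SimpleGraph V where
  Adj v w := ∃ a ∈ S, G.nbr a v = w
  symm := ⟨by
    rintro v w ⟨a, ha, rfl⟩
    exact ⟨a, ha, G.nbr_involutive a v⟩⟩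
  loopless := ⟨by
    rintro v ⟨a, -, h⟩
    exact G.nbr_ne a v h⟩

/-- `G` is connected (in particular, it has a vertex). -/
def IsConnected (G : ColoredGraph C V) : Prop :=
  (G.restrict Set.univ).Connected

/-- The bicoloured cycles of colours `a ≠ b`: the connected components of the graph formed by the
edges of these two colours. -/
abbrev BicoloredCycle (G : ColoredGraph C V) (a b : C) : Type _ :=
  (G.restrict {a, b}).ConnectedComponent

/-- Isomorphism of coloured graphs: a bijection of the vertices that maps the edges of each colour
to the edges of the same colour. -/
def IsIsomorphic (G : ColoredGraph C V) (H : ColoredGraph C W) : Prop :=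
  ∃ e : V ≃ W, ∀ c v, e (G.nbr c v) = H.nbr c (e v)

/-- Delete all edges of colour `i`. -/
def deleteColor (G : ColoredGraph C V) (i : C) : ColoredGraph {c : C // c ≠ i} V where
  nbr c := G.nbr c
  nbr_involutive c := G.nbr_involutive c
  nbr_ne c := G.nbr_ne c

/-- Euler characteristic of the surface encoded by a 3-coloured graph: the vertices and the edges
are those of the graph, the faces are the bicoloured cycles, one family for each pair of colours. -/
noncomputable def eulerChar [Fintype C] [LinearOrder C] (H : ColoredGraph C V) : ℤ :=
  (Nat.card V : ℤ) - ∑ c : C, ((H.edges c).ncard : ℤ)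
    + ∑ p : C × C with p.1 < p.2, (Nat.card (H.BicoloredCycle p.1 p.2) : ℤ)

/-- The (possibly half-integral) genus `g` of the surface, `χ = 2 - 2 g`. -/
noncomputable def genus [Fintype C] [LinearOrder C] (H : ColoredGraph C V) : ℚ :=
  (2 - (H.eulerChar : ℚ)) / 2

/-- The surface encoded by a 3-coloured graph, as a topological space. Take one triangle for each
vertex of the graph, with its three corners labelled by the colours, and for every edge of colour
`c` glue the sides opposite to the corners `c` of the two triangles, respecting the labels. The
corners of label `c` are then identified along the bicoloured cycles of the other two colours. -/
abbrev Surface [Fintype C] (H : ColoredGraph C V) : Type _ :=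
  Quot fun p q : (Σ _ : V, stdSimplex ℝ C) =>
    ∃ c, q.1 = H.nbr c p.1 ∧ q.2 = p.2 ∧ (p.2 : C → ℝ) c = 0

end ColoredGraph

/-- The real projective plane: the unit sphere of `ℝ³` with antipodal points identified. -/
abbrev RealProjectivePlane : Type :=
  Quot fun x y : Metric.sphere (0 : EuclideanSpace ℝ (Fin 3)) 1 => y = -x

/-- The tetrahedral bubble `ψ_abc ψ_ade ψ_fbe ψ_fdc`. Its vertices are the four tensors, numbered
`0, 1, 2, 3` from left to right, and an edge of colour `c ∈ {1, 2, 3}` joins two tensors whose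
`c`-th indices are contracted. `tetrahedron c s` is the `c`-neighbour of `s`
(row `0` is not used). -/
def tetrahedron : Fin 4 → Fin 4 → Fin 4 :=
  ![![0, 1, 2, 3], ![1, 0, 3, 2], ![2, 3, 0, 1], ![3, 2, 1, 0]]

theorem tetrahedron_tetrahedron : ∀ c s, tetrahedron c (tetrahedron c s) = s := by decide

theorem tetrahedron_ne : ∀ c s, c ≠ 0 → tetrahedron c s ≠ s := by decide

/-- An `O(N)³`-invariant (vacuum Feynman) graph with set of tetrahedral bubbles `B`. Its vertices
are the pairs `(b, s)` of a bubble and one of its four vertices; the propagators (edges of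
colour `0`) pair the vertices. -/
structure ONGraph (B : Type*) where
  propagator : B × Fin 4 → B × Fin 4
  propagator_involutive : Function.Involutive propagator
  propagator_ne : ∀ v, propagator v ≠ v

namespace ONGraph

variable {B : Type*}

/-- The underlying 4-coloured graph. -/
def graph (G : ONGraph B) : ColoredGraph (Fin 4) (B × Fin 4) where
  nbr c v := if c = 0 then G.propagator v else (v.1, tetrahedron c v.2)
  nbr_involutive c v := by
    by_cases hc : c = 0
    · simp only [hc, if_true]
      exact G.propagator_involutive v
    · simp only [hc, if_false]
      rw [tetrahedron_tetrahedron]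
  nbr_ne c v := by
    by_cases hc : c = 0
    · simp only [hc, if_true]
      exact G.propagator_ne v
    · simp only [hc, if_false]
      intro h
      exact tetrahedron_ne c v.2 hc (congrArg Prod.snd h)

/-- The faces of colour `i ∈ {1, 2, 3}`: the bicoloured cycles of colours `0` and `i`. -/
abbrev Face (G : ONGraph B) (i : Fin 4) : Type _ :=
  G.graph.BicoloredCycle 0 i

/-- The length of a face: its number of edges of colour `0`. -/
noncomputable def faceLength (G : ONGraph B) {i : Fin 4} (f : G.Face i) : ℕ :=
  ((fun v => s(v, G.graph.nbr 0 v)) '' f.supp).ncard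

/-- The jacket `J_i`, for `i ∈ {1, 2, 3}`. -/
def jacket (G : ONGraph B) (i : Fin 4) : ColoredGraph {c : Fin 4 // c ≠ i} (B × Fin 4) :=
  G.graph.deleteColor i

/-- The degree: the sum of the genera of the three jackets. -/
noncomputable def degree (G : ONGraph B) : ℚ :=
  (G.jacket 1).genus + (G.jacket 2).genus + (G.jacket 3).genus

/-- 2-particle-irreducible: there is no 2-edge-cut, i.e. the removal of two edges of colour `0`
never disconnects the graph. -/
def IsTwoPI (G : ONGraph B) : Prop :=
  ∀ e ∈ G.graph.edges 0, ∀ e' ∈ G.graph.edges 0, e ≠ e' →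
    (G.graph.remove 0 {e, e'}).Connected

/-- No dipole of any colour. A dipole of colour `i` consists of two distinct bubbles connected by
two edges of colour `0` that close a face of colour `i` and length two. -/
def IsDipoleFree (G : ONGraph B) : Prop :=
  ¬ ∃ i : Fin 4, i ≠ 0 ∧ ∃ f : G.Face i, G.faceLength f = 2 ∧
    ∃ v ∈ f.supp, ∃ w ∈ f.supp, v.1 ≠ w.1

/-- A connected, 2PI, dipole-free graph of degree `3/2`. -/
def IsTwoPIDipoleFreeOfDegreeThreeHalves (G : ONGraph B) : Prop :=
  G.graph.IsConnected ∧ G.IsTwoPI ∧ G.IsDipoleFree ∧ G.degree = 3 / 2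

end ONGraph

/-- The propagators of the explicit graph on five bubbles, a central one (`none`) and four outer
ones (`some s`, one for each vertex `s` of the central bubble). The vertex `s` of the central
bubble is joined to the vertex `0` of the outer bubble `s`, and for `t ∈ {1, 2, 3}` the vertex `t`
of the outer bubble `s` is joined to the vertex `t` of the outer bubble `tetrahedron t s`. -/
def fiveBubblePropagator : Option (Fin 4) × Fin 4 → Option (Fin 4) × Fin 4
  | (none, s) => (some s, 0)
  | (some s, t) => if t = 0 then (none, s) else (some (tetrahedron t s), t)

/-- The explicit graph of degree `3/2`. -/
def fiveBubbleGraph : ONGraph (Option (Fin 4)) where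
  propagator := fiveBubblePropagator
  propagator_involutive := by unfold Function.Involutive; decide
  propagator_ne := by decide

/-! Shrink every bubble to a point. A connected graph with `n` bubbles becomes a connected 4-regular
graph with `2n` edges, and the jacket `J_i` embeds it in a closed surface: the faces of the two
other colours `j`, `k` are the faces of the embedding and alternate around each vertex, while the
faces of colour `i` are the closed curves that go straight at every vertex. With `F_c` faces of
colour `c`, the Euler characteristic of `J_i` is `F_j + F_k - n` (`jacket_eulerChar`), degree `3/2`
means `2 (F_1 + F_2 + F_3) = 3n + 3`, and the lengths of the faces of one colour add up to `2n`.

Topology enters as linear algebra over the field with two elements. Cycles modulo sums of face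
boundaries have dimension at most 0 if the characteristic is 2 and at most 1 if it is 1. The form
`inter` descends to this quotient, and the self-intersection of a straight curve is its length
modulo two (`inter_self_faceVec`). Hence in a planar jacket closed curves cross evenly, and in a
projective one two straight curves cross an odd number of times exactly when both have odd length.

2PI excludes loops, so without dipoles all faces have length at least three. By 2PI there is also no
bounding cycle that turns at each of its bubbles with exactly one turn of the other colour
(`IsTwoPI.false_of_turning`): it would enclose a part held by two propagators. This excludes double
propagators and turns suitable triangles into faces (`IsTwoPI.triangle`).

A planar jacket `J_i` would have one straight curve of length six and otherwise only length four,
and parity of crossings closes the graph up too early (`not_planar`). So every characteristic is at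
most 1, and the degree forces all three to equal 1, with `2 F_i = n + 1`. Then `∑ (4 - length) = 2`
over the faces of colour `i`, so there are two faces `c`, `d` of length three; they cross once. If
two different faces cross `c` at its other two bubbles, there are exactly four odd faces, three of
them of length three, which is impossible (`false_of_four_odd`). Otherwise a single face `e` of
length four crosses there, and it meets `d` at its two remaining bubbles. These five bubbles are
pairwise joined, and all faces through the crossing of `c` and `d` are triangles
(`IsProjective.exists_center`). This determines the graph (`isIsomorphic_of_center`).

Conversely the explicit graph is checked by finite computation, and its jackets are mapped to the
projective plane by a triangulation of four octants of the sphere. -/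

namespace ColoredGraph

/-! ### Counting edges and propagating invariants in coloured graphs -/

variable {C V : Type*}

/-- A set of vertices closed under the edges of colour `c` has twice as many elements as it
carries edges of colour `c`. -/
theorem two_mul_ncard_image_edge [Finite V] (G : ColoredGraph C V) (c : C) (S : Set V)
    (hS : ∀ v ∈ S, G.nbr c v ∈ S) :
    2 * ((fun v => s(v, G.nbr c v)) '' S).ncard = S.ncard := by
  classical
  have := Fintype.ofFinite V
  have h1 : S.ncard = S.toFinset.card := Set.ncard_eq_toFinset_card' S
  have h2 : ((fun v => s(v, G.nbr c v)) '' S).ncard =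
      (S.toFinset.image (fun v => s(v, G.nbr c v))).card := by
    rw [← Set.ncard_coe_finset]; simp
  rw [h1, h2, Finset.card_eq_sum_card_image (fun v => s(v, G.nbr c v)) S.toFinset,
    Finset.sum_const_nat (m := 2), mul_comm]
  intro e he
  obtain ⟨v, hv, rfl⟩ := Finset.mem_image.1 he
  rw [Set.mem_toFinset] at hv
  rw [Finset.card_eq_two]
  refine ⟨v, G.nbr c v, (G.nbr_ne c v).symm, ?_⟩
  ext w
  simp only [Finset.mem_filter, Set.mem_toFinset, Sym2.eq_iff, Finset.mem_insert,
    Finset.mem_singleton]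
  constructor
  · rintro ⟨-, ⟨h, -⟩ | ⟨h, -⟩⟩
    · exact Or.inl h
    · exact Or.inr h
  · rintro (rfl | rfl)
    · exact ⟨hv, Or.inl ⟨rfl, rfl⟩⟩
    · exact ⟨hS _ hv, Or.inr ⟨rfl, G.nbr_involutive c v⟩⟩

theorem two_mul_ncard_edges [Finite V] (G : ColoredGraph C V) (c : C) :
    2 * (G.edges c).ncard = Nat.card V := by
  rw [edges, ← Set.image_univ, two_mul_ncard_image_edge G c Set.univ (fun _ _ => Set.mem_univ _),
    Set.ncard_univ]

/-- A function that is constant along the edges with a colour in `S` is constant along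
reachability. -/
theorem eq_of_reachable {α : Type*} (G : ColoredGraph C V) {S : Set C} {f : V → α}
    (hf : ∀ c ∈ S, ∀ v, f (G.nbr c v) = f v) {v w : V} (h : (G.restrict S).Reachable v w) :
    f v = f w := by
  obtain ⟨q⟩ := h
  induction q with
  | nil => rfl
  | cons hadj _ ih =>
    obtain ⟨a, ha, rfl⟩ := hadj
    rw [← ih, hf a ha]

end ColoredGraph

/-! ### The colours of a bubble and the Klein four-group -/

/-- `i, j, k` are the three colours of the bubbles, in some order. -/
def IsColorTriple (i j k : Fin 4) : Prop :=
  i ≠ 0 ∧ j ≠ 0 ∧ k ≠ 0 ∧ i ≠ j ∧ i ≠ k ∧ j ≠ k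

instance (i j k : Fin 4) : Decidable (IsColorTriple i j k) := by
  unfold IsColorTriple; infer_instance

namespace IsColorTriple

variable {i j k : Fin 4}

theorem ne₁ (h : IsColorTriple i j k) : i ≠ 0 := h.1
theorem ne₂ (h : IsColorTriple i j k) : j ≠ 0 := h.2.1
theorem ne₃ (h : IsColorTriple i j k) : k ≠ 0 := h.2.2.1
theorem swap (h : IsColorTriple i j k) : IsColorTriple i k j := by
  unfold IsColorTriple at *; tauto
theorem rotate (h : IsColorTriple i j k) : IsColorTriple j k i := by
  unfold IsColorTriple at *; tauto

/-- The vertices of a bubble form the Klein four-group with unit `0`, and `tetrahedron c` is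
translation by `c`. The product of two distinct nontrivial elements is the third one. -/
theorem tetrahedron_comp :
    ∀ {i j k : Fin 4}, IsColorTriple i j k → ∀ s,
      tetrahedron i (tetrahedron j s) = tetrahedron k s := by
  decide

theorem eq_cases : ∀ {i j k : Fin 4}, IsColorTriple i j k → ∀ s s',
    s' = s ∨ s' = tetrahedron i s ∨ s' = tetrahedron j s ∨ s' = tetrahedron k s := by
  decide

theorem color_cases : ∀ {i j k : Fin 4}, IsColorTriple i j k → ∀ c,
    c = 0 ∨ c = i ∨ c = j ∨ c = k := by
  decide

theorem sum_eq {M : Type*} [AddCommMonoid M] (h : IsColorTriple i j k) (f : Fin 4 → M)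
    (s : Fin 4) :
    ∑ x, f x = f s + f (tetrahedron i s) + f (tetrahedron j s) + f (tetrahedron k s) := by
  have hu : ∀ {i j k : Fin 4}, IsColorTriple i j k → ∀ s, (Finset.univ : Finset (Fin 4)) =
      {s, tetrahedron i s, tetrahedron j s, tetrahedron k s} ∧
      s ∉ ({tetrahedron i s, tetrahedron j s, tetrahedron k s} : Finset (Fin 4)) ∧
      tetrahedron i s ∉ ({tetrahedron j s, tetrahedron k s} : Finset (Fin 4)) ∧
      tetrahedron j s ∉ ({tetrahedron k s} : Finset (Fin 4)) := by decide
  obtain ⟨h1, h2, h3, h4⟩ := hu h s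
  rw [h1, Finset.sum_insert h2, Finset.sum_insert h3, Finset.sum_insert h4, Finset.sum_singleton]
  simp only [add_assoc]

end IsColorTriple

theorem tetrahedron_zero : ∀ c, tetrahedron c 0 = c := by decide

theorem exists_isColorTriple : ∀ i : Fin 4, i ≠ 0 → ∃ j k, IsColorTriple i j k := by decide

/-! ### Faces as orbits of a step map -/

namespace ONGraph

variable {B : Type*}

/-- The neighbour of `v` inside its bubble, along the edge of colour `c`. -/
def flip (c : Fin 4) (v : B × Fin 4) : B × Fin 4 := (v.1, tetrahedron c v.2)

@[simp] theorem flip_fst (c : Fin 4) (v : B × Fin 4) : (flip c v).1 = v.1 := rfl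

@[simp] theorem flip_flip (c : Fin 4) (v : B × Fin 4) : flip c (flip c v) = v := by
  simp [flip, tetrahedron_tetrahedron]

theorem flip_ne {c : Fin 4} (hc : c ≠ 0) (v : B × Fin 4) : flip c v ≠ v :=
  fun h => tetrahedron_ne c v.2 hc (congrArg Prod.snd h)

theorem flip_comp {i j k : Fin 4} (h : IsColorTriple i j k) (v : B × Fin 4) :
    flip i (flip j v) = flip k v := by
  simp [flip, h.tetrahedron_comp]

theorem flip_ne_flip {i j k : Fin 4} (h : IsColorTriple i j k) (v : B × Fin 4) :
    flip i v ≠ flip j v := by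
  intro he
  have := congrArg (flip j) he
  rw [flip_flip, flip_comp h.rotate.swap] at this
  exact flip_ne h.ne₃ v this

theorem eq_cases_of_fst_eq {i j k : Fin 4} (h : IsColorTriple i j k) {v w : B × Fin 4}
    (hvw : w.1 = v.1) : w = v ∨ w = flip i v ∨ w = flip j v ∨ w = flip k v := by
  obtain ⟨b, s⟩ := v
  obtain ⟨b', s'⟩ := w
  obtain rfl : b' = b := hvw
  simpa [flip] using h.eq_cases s s'

variable (G : ONGraph B)

@[simp] theorem propagator_propagator (v : B × Fin 4) : G.propagator (G.propagator v) = v :=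
  G.propagator_involutive v

theorem graph_nbr_zero (v : B × Fin 4) : G.graph.nbr 0 v = G.propagator v := by
  simp [graph]

theorem graph_nbr {c : Fin 4} (hc : c ≠ 0) (v : B × Fin 4) : G.graph.nbr c v = flip c v := by
  simp [graph, hc, flip]

/-- One step along a face of colour `i`. -/
def step (i : Fin 4) (v : B × Fin 4) : B × Fin 4 := flip i (G.propagator v)

@[simp] theorem step_fst (i : Fin 4) (v : B × Fin 4) :
    (G.step i v).1 = (G.propagator v).1 := rfl

theorem flip_step (i : Fin 4) (v : B × Fin 4) : flip i (G.step i v) = G.propagator v :=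
  flip_flip _ _

theorem propagator_flip_step (i : Fin 4) (v : B × Fin 4) :
    G.propagator (flip i (G.step i v)) = v := by simp [step]

theorem step_injective (i : Fin 4) : Function.Injective (G.step i) := by
  intro v w h
  have := congrArg (fun x => G.propagator (flip i x)) h
  simpa [step] using this

/-- The face of colour `i` through `v`. -/
def face (i : Fin 4) (v : B × Fin 4) : G.Face i :=
  (G.graph.restrict {0, i}).connectedComponentMk v

theorem face_surjective (i : Fin 4) (f : G.Face i) : ∃ v, G.face i v = f :=
  f.exists_rep

theorem mem_supp_iff {i : Fin 4} (f : G.Face i) (v : B × Fin 4) :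
    v ∈ f.supp ↔ G.face i v = f := by
  rw [SimpleGraph.ConnectedComponent.mem_supp_iff]; rfl

@[simp] theorem face_propagator (i : Fin 4) (v : B × Fin 4) :
    G.face i (G.propagator v) = G.face i v := by
  apply SimpleGraph.ConnectedComponent.sound
  apply SimpleGraph.Adj.reachable
  exact ⟨0, by simp, by rw [graph_nbr_zero]; simp⟩

@[simp] theorem face_flip {i : Fin 4} (hi : i ≠ 0) (v : B × Fin 4) :
    G.face i (flip i v) = G.face i v := by
  apply SimpleGraph.ConnectedComponent.sound
  apply SimpleGraph.Adj.reachable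
  exact ⟨i, by simp, by rw [graph_nbr _ hi]; simp⟩

@[simp] theorem face_step {i : Fin 4} (hi : i ≠ 0) (v : B × Fin 4) :
    G.face i (G.step i v) = G.face i v := by simp [step, hi]

@[simp] theorem face_iterate {i : Fin 4} (hi : i ≠ 0) (m : ℕ) (v : B × Fin 4) :
    G.face i ((G.step i)^[m] v) = G.face i v := by
  induction m with
  | zero => rfl
  | succ m ih => rw [Function.iterate_succ_apply', face_step _ hi, ih]

/-- Faces of colour `i` are the classes of the smallest equivalence relation that contains the
propagators and the edges of colour `i`. -/
theorem eq_of_face_eq {α : Type*} {i : Fin 4} (hi : i ≠ 0) {f : B × Fin 4 → α}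
    (h0 : ∀ v, f (G.propagator v) = f v) (h1 : ∀ v, f (flip i v) = f v) {v w : B × Fin 4}
    (h : G.face i v = G.face i w) : f v = f w := by
  refine G.graph.eq_of_reachable (S := {0, i}) (f := f) ?_
    (SimpleGraph.ConnectedComponent.exact h)
  rintro c (rfl | rfl) v
  · rw [graph_nbr_zero, h0]
  · rw [graph_nbr _ hi, h1]

/-- The orbits of `step i` on the two sides of a face are disjoint. -/
theorem iterate_step_ne {i : Fin 4} (hi : i ≠ 0) (m : ℕ) (v : B × Fin 4) :
    (G.step i)^[m] v ≠ G.propagator v := by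
  induction m using Nat.strong_induction_on generalizing v with
  | _ m ih =>
    match m with
    | 0 => exact (G.propagator_ne v).symm
    | 1 => exact flip_ne hi _
    | m + 2 =>
      intro h
      -- The two sides of a face are run through in opposite directions: if `m + 2` steps lead from
      -- `v` to the other end of its propagator, then `m` steps lead from `step i v` to the other
      -- end of its own.
      apply ih m (by omega) (G.step i v)
      apply G.step_injective i
      rw [← Function.iterate_succ_apply' (G.step i) m, ← Function.iterate_succ_apply, h]
      simp [step]

theorem iterate_injOn (i : Fin 4) (v : B × Fin 4) {l m : ℕ}
    (hl : l < Function.minimalPeriod (G.step i) v) (hm : m < Function.minimalPeriod (G.step i) v)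
    (h : (G.step i)^[l] v = (G.step i)^[m] v) : l = m :=
  Function.iterate_injOn_Iio_minimalPeriod hl hm h

theorem iterate_ne_propagator {i : Fin 4} (hi : i ≠ 0) (v : B × Fin 4) (l m : ℕ) :
    (G.step i)^[l] v ≠ G.propagator ((G.step i)^[m] v) := by
  intro h
  rcases le_total m l with hml | hml
  · obtain ⟨d, rfl⟩ := Nat.exists_eq_add_of_le' hml
    rw [Function.iterate_add_apply] at h
    exact G.iterate_step_ne hi _ _ h
  · obtain ⟨d, rfl⟩ := Nat.exists_eq_add_of_le' hml
    rw [Function.iterate_add_apply] at h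
    apply G.iterate_step_ne hi d ((G.step i)^[l] v)
    conv_rhs => rw [h]
    simp

variable [Finite B]

theorem minimalPeriod_pos (i : Fin 4) (v : B × Fin 4) :
    0 < Function.minimalPeriod (G.step i) v := by
  rw [Function.minimalPeriod_pos_iff_mem_periodicPts]
  exact Function.Injective.mem_periodicPts (G.step_injective i) v

/-- The orbit of `v`, together with the other ends of its propagators, is already closed under
propagators and edges of colour `i`. -/
theorem face_eq_iff {i : Fin 4} (hi : i ≠ 0) {v w : B × Fin 4} :
    G.face i v = G.face i w ↔
      ∃ m, (G.step i)^[m] v = w ∨ (G.step i)^[m] v = G.propagator w := by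
  constructor
  · intro h
    have hper := Function.iterate_minimalPeriod (f := G.step i) (x := v)
    have hpos := G.minimalPeriod_pos i v
    set ℓ := Function.minimalPeriod (G.step i) v
    let f : B × Fin 4 → Prop :=
      fun w => ∃ m, (G.step i)^[m] v = w ∨ (G.step i)^[m] v = G.propagator w
    have h0 : ∀ w, f w → f (G.propagator w) := by
      rintro w ⟨m, h | h⟩
      · exact ⟨m, Or.inr (by simpa using h)⟩
      · exact ⟨m, Or.inl h⟩
    have h1 : ∀ w, f w → f (flip i w) := by
      rintro w ⟨m, h | h⟩
      -- A step backwards is `ℓ - 1` steps forwards, `ℓ` being the period.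
      · refine ⟨m + (ℓ - 1), Or.inr ?_⟩
        apply G.step_injective i
        rw [← Function.iterate_succ_apply' (G.step i), show (m + (ℓ - 1)).succ = m + ℓ by omega,
          Function.iterate_add_apply, hper, h]
        simp [step]
      · refine ⟨m + 1, Or.inl ?_⟩
        rw [Function.iterate_succ_apply', h]
        simp [step]
    have := G.eq_of_face_eq hi (f := f)
      (fun w => propext ⟨fun h => by simpa using h0 _ h, h0 w⟩)
      (fun w => propext ⟨fun h => by simpa using h1 _ h, h1 w⟩) h
    exact this.mp ⟨0, Or.inl rfl⟩
  · rintro ⟨m, h | h⟩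
    · rw [← h, face_iterate _ hi]
    · rw [← face_propagator _ _ w, ← h, face_iterate _ hi]

/-- In this form the visited vertex lies in the bubble of `w` itself, so `m` is a position of that
bubble on the face. -/
theorem face_eq_iff' {i : Fin 4} (hi : i ≠ 0) {v w : B × Fin 4} :
    G.face i v = G.face i w ↔
      ∃ m < Function.minimalPeriod (G.step i) v,
        (G.step i)^[m] v = w ∨ (G.step i)^[m] v = flip i w := by
  constructor
  · intro h
    obtain ⟨m, hm⟩ := (G.face_eq_iff hi).1 h
    have key : ∃ m, (G.step i)^[m] v = w ∨ (G.step i)^[m] v = flip i w := by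
      rcases hm with h | h
      · exact ⟨m, Or.inl h⟩
      · refine ⟨m + 1, Or.inr ?_⟩
        rw [Function.iterate_succ_apply', h]
        simp [step]
    obtain ⟨m, hm⟩ := key
    refine ⟨m % Function.minimalPeriod (G.step i) v, Nat.mod_lt _ (G.minimalPeriod_pos i v), ?_⟩
    rwa [Function.iterate_mod_minimalPeriod_eq]
  · rintro ⟨m, -, h | h⟩
    · rw [← h, face_iterate _ hi]
    · rw [← face_flip _ hi w, ← h, face_iterate _ hi]

theorem iterate_ne_flip {i : Fin 4} (hi : i ≠ 0) (v : B × Fin 4) (l m : ℕ) :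
    (G.step i)^[l] v ≠ flip i ((G.step i)^[m] v) := by
  intro h
  apply G.iterate_ne_propagator hi v m l
  have hper := Function.iterate_minimalPeriod (f := G.step i) (x := v)
  have hpos := G.minimalPeriod_pos i v
  set ℓ := Function.minimalPeriod (G.step i) v
  exfalso
  apply G.iterate_ne_propagator hi v l (m + (ℓ - 1))
  rw [← flip_step (i := i), ← Function.iterate_succ_apply' (G.step i),
    show (m + (ℓ - 1)).succ = m + ℓ by omega, Function.iterate_add_apply, hper, h]

/-- Each step runs along one propagator, and none is used twice in a period because an orbit never
contains both ends of a propagator. -/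
theorem faceLength_face {i : Fin 4} (hi : i ≠ 0) (v : B × Fin 4) :
    G.faceLength (G.face i v) = Function.minimalPeriod (G.step i) v := by
  unfold faceLength
  set ℓ := Function.minimalPeriod (G.step i) v with hℓ
  have : ((fun v => s(v, G.graph.nbr 0 v)) '' (G.face i v).supp) =
      (fun l => s((G.step i)^[l] v, G.propagator ((G.step i)^[l] v))) '' Set.Iio ℓ := by
    ext e
    simp only [Set.mem_image, mem_supp_iff, graph_nbr_zero, Set.mem_Iio]
    constructor
    · rintro ⟨w, hw, rfl⟩
      obtain ⟨m, hm⟩ := (G.face_eq_iff hi).1 hw.symm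
      refine ⟨m % ℓ, Nat.mod_lt _ (G.minimalPeriod_pos i v), ?_⟩
      rw [hℓ, Function.iterate_mod_minimalPeriod_eq]
      rcases hm with h | h
      · rw [h]
      · rw [h, propagator_propagator, Sym2.eq_swap]
    · rintro ⟨l, -, rfl⟩
      exact ⟨_, G.face_iterate hi l v, rfl⟩
  rw [this, Set.InjOn.ncard_image, ← Nat.card_coe_set_eq]
  · simp
  · intro l hl m hm h
    rcases Sym2.eq_iff.1 h with ⟨h, -⟩ | ⟨h, -⟩
    · exact G.iterate_injOn i v hl hm h
    · exact absurd h (G.iterate_ne_propagator hi v l m)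

theorem iterate_faceLength {i : Fin 4} (hi : i ≠ 0) (v : B × Fin 4) :
    (G.step i)^[G.faceLength (G.face i v)] v = v := by
  rw [faceLength_face _ hi]
  exact Function.iterate_minimalPeriod

theorem faceLength_pos {i : Fin 4} (hi : i ≠ 0) (f : G.Face i) : 0 < G.faceLength f := by
  obtain ⟨v, rfl⟩ := G.face_surjective i f
  rw [faceLength_face _ hi]
  exact G.minimalPeriod_pos i v

theorem two_mul_faceLength {i : Fin 4} (f : G.Face i) :
    2 * G.faceLength f = {v | G.face i v = f}.ncard := by
  have h := G.graph.two_mul_ncard_image_edge 0 f.supp (by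
    intro v hv
    rw [mem_supp_iff] at *
    rw [graph_nbr_zero, face_propagator, hv])
  rw [faceLength, h]
  rfl

instance (i : Fin 4) : Finite (G.Face i) :=
  Finite.of_surjective (G.face i) (G.face_surjective i)

/-- Each of the `2n` propagators lies on exactly one face of colour `i`; the count is made on
vertices, two for each propagator. -/
theorem sum_faceLength {i : Fin 4} [Fintype (G.Face i)] :
    ∑ f : G.Face i, G.faceLength f = 2 * Nat.card B := by
  classical
  have := Fintype.ofFinite B
  have h : ∑ f : G.Face i, 2 * G.faceLength f = 4 * Nat.card B := by
    simp_rw [two_mul_faceLength]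
    have h1 := Finset.card_eq_sum_card_fiberwise (f := G.face i)
      (s := (Finset.univ : Finset (B × Fin 4))) (t := Finset.univ) (by simp)
    have h2 : (Finset.univ : Finset (B × Fin 4)).card = 4 * Nat.card B := by
      simp [mul_comm]
    rw [← h2, h1]
    refine Finset.sum_congr rfl fun f _ => ?_
    rw [← Set.ncard_coe_finset]
    simp
  rw [← Finset.mul_sum] at h
  omega

end ONGraph

/-! ### Euler characteristics of the jackets and the degree -/

namespace ColoredGraph

variable {C V : Type*}

theorem deleteColor_restrict (G : ColoredGraph C V) (i : C) (a b : {c : C // c ≠ i}) :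
    (G.deleteColor i).restrict {a, b} = G.restrict {a.1, b.1} := by
  ext v w
  simp [restrict, deleteColor]

end ColoredGraph

namespace ONGraph

variable {B : Type*} (G : ONGraph B)

/-- Inside the bubbles, the bicoloured cycles are the bubbles. -/
theorem card_bicoloredCycle_bubble {i j k : Fin 4} (h : IsColorTriple i j k) :
    Nat.card (G.graph.BicoloredCycle j k) = Nat.card B := by
  apply Nat.card_congr
  refine ⟨Quot.lift Prod.fst ?_, fun b => (G.graph.restrict {j, k}).connectedComponentMk (b, 0),
    ?_, fun b => rfl⟩
  · intro v w hvw
    refine G.graph.eq_of_reachable (S := {j, k}) (f := Prod.fst) ?_ hvw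
    rintro c (rfl | rfl) v
    · rw [graph_nbr _ h.ne₂]; rfl
    · rw [graph_nbr _ h.ne₃]; rfl
  · intro f
    obtain ⟨v, rfl⟩ := f.exists_rep
    change (G.graph.restrict {j, k}).connectedComponentMk (v.1, 0) =
      (G.graph.restrict {j, k}).connectedComponentMk v
    have hj : ∀ w : B × Fin 4, (G.graph.restrict {j, k}).Reachable w (flip j w) := fun w =>
      SimpleGraph.Adj.reachable ⟨j, by simp, graph_nbr _ h.ne₂ _⟩
    have hk : ∀ w : B × Fin 4, (G.graph.restrict {j, k}).Reachable w (flip k w) := fun w =>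
      SimpleGraph.Adj.reachable ⟨k, by simp, graph_nbr _ h.ne₃ _⟩
    apply SimpleGraph.ConnectedComponent.sound
    rcases eq_cases_of_fst_eq h (v := (v.1, 0)) (w := v) rfl with h' | h' | h' | h' <;> rw [h']
    · rw [← flip_comp h.rotate]
      exact (hk _).trans (hj _)
    · exact hj _
    · exact hk _

/-- There are `4n` vertices and `2n` edges of each of three colours; besides the faces of colours
`j` and `k`, the bicoloured cycles of colours `j`, `k` are the `n` bubbles. -/
theorem jacket_eulerChar [Finite B] {i j k : Fin 4} (h : IsColorTriple i j k) :
    (G.jacket i).eulerChar =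
      (Nat.card (G.Face j) : ℤ) + Nat.card (G.Face k) - Nat.card B := by
  have hV : (Nat.card (B × Fin 4) : ℤ) = 4 * Nat.card B := by
    simp [mul_comm]
  have hE : ∀ c, (((G.jacket i).edges c).ncard : ℤ) = 2 * Nat.card B := by
    intro c
    have h1 := (G.jacket i).two_mul_ncard_edges c
    zify at h1
    linarith
  have hF : ∀ a b : {c : Fin 4 // c ≠ i}, (Nat.card ((G.jacket i).BicoloredCycle a b) : ℤ) =
      Nat.card (G.graph.BicoloredCycle a.1 b.1) := by
    intro a b
    rw [jacket, ColoredGraph.BicoloredCycle, ColoredGraph.deleteColor_restrict]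
  have hS : ∀ a b : Fin 4, G.graph.BicoloredCycle a b = G.graph.BicoloredCycle b a := by
    intro a b
    rw [ColoredGraph.BicoloredCycle, ColoredGraph.BicoloredCycle, Set.pair_comm]
  have hN := G.card_bicoloredCycle_bubble h
  have hcard : ∀ i : Fin 4, Fintype.card {c : Fin 4 // c ≠ i} = 3 := by decide
  rw [ColoredGraph.eulerChar, hV, Finset.sum_congr rfl fun c _ => hE c, Finset.sum_const,
    Finset.card_univ, hcard i, Finset.sum_congr rfl fun p _ => hF p.1 p.2]
  have key : ∀ f : Fin 4 → Fin 4 → ℤ, (∀ a b, f a b = f b a) →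
      (∑ p : {c : Fin 4 // c ≠ i} × {c : Fin 4 // c ≠ i} with p.1 < p.2, f p.1.1 p.2.1) =
        f 0 j + f 0 k + f j k := by
    intro f hf
    have hsum : ∀ i : Fin 4, (∑ p : {c : Fin 4 // c ≠ i} × {c : Fin 4 // c ≠ i} with p.1 < p.2,
        f p.1.1 p.2.1) = ∑ p : Fin 4 × Fin 4 with p.1 ≠ i ∧ p.2 ≠ i ∧ p.1 < p.2, f p.1 p.2 := by
      intro i
      refine Finset.sum_bij (fun p _ => (p.1.1, p.2.1)) ?_ ?_ ?_ ?_
      · rintro ⟨a, b⟩ hp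
        simp only [Finset.mem_filter, Finset.mem_univ, true_and] at hp ⊢
        exact ⟨a.2, b.2, hp⟩
      · rintro ⟨a, b⟩ _ ⟨a', b'⟩ _ hp
        simp only [Prod.mk.injEq] at hp
        exact Prod.ext (Subtype.ext hp.1) (Subtype.ext hp.2)
      · rintro ⟨a, b⟩ hp
        simp only [Finset.mem_filter, Finset.mem_univ, true_and] at hp
        exact ⟨(⟨a, hp.1⟩, ⟨b, hp.2.1⟩), by simpa using hp.2.2, rfl⟩
      · intros; rfl
    rw [hsum]
    have hset : ∀ {i j k : Fin 4}, IsColorTriple i j k →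
        (Finset.univ.filter fun p : Fin 4 × Fin 4 => p.1 ≠ i ∧ p.2 ≠ i ∧ p.1 < p.2) =
        {(0, j), (0, k), (min j k, max j k)} ∧ j ≠ k ∧ min j k ≠ 0 := by decide
    obtain ⟨h1, h2, h3⟩ := hset h
    rw [h1, Finset.sum_insert (by simp [h2, h3.symm]), Finset.sum_insert (by simp [h3.symm]),
      Finset.sum_singleton]
    rcases le_total j k with hjk | hjk
    · simp [hjk]; ring
    · simp [hjk, hf k j]; ring
  rw [key (fun a b => (Nat.card (G.graph.BicoloredCycle a b) : ℤ))
    (fun a b => by rw [hS]), hN]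
  simp only [Face]
  ring

theorem jacket_genus [Finite B] {i j k : Fin 4} (h : IsColorTriple i j k) :
    (G.jacket i).genus =
      (2 - ((Nat.card (G.Face j) : ℚ) + Nat.card (G.Face k) - Nat.card B)) / 2 := by
  rw [ColoredGraph.genus, jacket_eulerChar G h]
  push_cast
  ring

theorem degree_eq [Finite B] :
    G.degree = 3 + 3 * (Nat.card B : ℚ) / 2 -
      (Nat.card (G.Face 1) + Nat.card (G.Face 2) + Nat.card (G.Face 3)) := by
  rw [degree, jacket_genus G (i := 1) (j := 2) (k := 3) (by decide),
    jacket_genus G (i := 2) (j := 1) (k := 3) (by decide),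
    jacket_genus G (i := 3) (j := 1) (k := 2) (by decide)]
  ring

theorem degree_eq_three_halves_iff [Finite B] {i j k : Fin 4} (h : IsColorTriple i j k) :
    G.degree = 3 / 2 ↔ 2 * (Nat.card (G.Face i) + Nat.card (G.Face j) + Nat.card (G.Face k)) =
      3 * Nat.card B + 3 := by
  have hsum : ∀ (f : Fin 4 → ℕ) {i j k : Fin 4}, IsColorTriple i j k →
      f 1 + f 2 + f 3 = f i + f j + f k := by
    intro f i j k h
    have h1 := h.sum_eq f 0
    rw [Fin.sum_univ_four] at h1
    simp only [tetrahedron_zero] at h1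
    omega
  rw [degree_eq, ← hsum (fun i => Nat.card (G.Face i)) h]
  have : (Nat.card (G.Face 1) + Nat.card (G.Face 2) + Nat.card (G.Face 3) : ℚ) =
    ((Nat.card (G.Face 1) + Nat.card (G.Face 2) + Nat.card (G.Face 3) : ℕ) : ℚ) := by push_cast; ring
  rw [this]
  generalize Nat.card (G.Face 1) + Nat.card (G.Face 2) + Nat.card (G.Face 3) = F
  constructor
  · intro h
    have : (2 * F : ℚ) = 3 * Nat.card B + 3 := by linarith
    exact_mod_cast this
  · intro h
    have : (2 * F : ℚ) = 3 * Nat.card B + 3 := by exact_mod_cast h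
    linarith

/-! ### Cycle space and face spaces over the field with two elements -/

/-- Functions on the propagators, seen as functions on the vertices. -/
def edgeSpace : Submodule (ZMod 2) (B × Fin 4 → ZMod 2) where
  carrier := {z | ∀ v, z (G.propagator v) = z v}
  add_mem' hx hy v := by simp [hx v, hy v]
  zero_mem' v := rfl
  smul_mem' a x hx v := by simp [hx v]

/-- The boundary of a function on the propagators. -/
def boundary : (B × Fin 4 → ZMod 2) →ₗ[ZMod 2] (B → ZMod 2) where
  toFun z b := ∑ s, z (b, s)
  map_add' x y := by ext b; simp [Finset.sum_add_distrib]
  map_smul' a x := by ext b; simp [Finset.mul_sum]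

theorem boundary_apply (z : B × Fin 4 → ZMod 2) (b : B) : boundary z b = ∑ s, z (b, s) := rfl

/-- The cycle space of the 4-regular graph whose vertices are the bubbles. -/
def cycleSpace : Submodule (ZMod 2) (B × Fin 4 → ZMod 2) :=
  G.edgeSpace ⊓ LinearMap.ker (boundary (B := B))

/-- The span of the faces of colour `i`. -/
def faceSpace (i : Fin 4) : Submodule (ZMod 2) (B × Fin 4 → ZMod 2) where
  carrier := {z | (∀ v, z (G.propagator v) = z v) ∧ ∀ v, z (flip i v) = z v}
  add_mem' hx hy := ⟨fun v => by simp [hx.1 v, hy.1 v], fun v => by simp [hx.2 v, hy.2 v]⟩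
  zero_mem' := ⟨fun _ => rfl, fun _ => rfl⟩
  smul_mem' a x hx := ⟨fun v => by simp [hx.1 v], fun v => by simp [hx.2 v]⟩

theorem zmod_two_add_self (a : ZMod 2) : a + a = 0 := CharTwo.add_self_eq_zero a

theorem fun_add_self {V : Type*} (x : V → ZMod 2) : x + x = 0 :=
  funext fun v => zmod_two_add_self (x v)

theorem boundary_eq {i j k : Fin 4} (h : IsColorTriple i j k) (z : B × Fin 4 → ZMod 2)
    (v : B × Fin 4) :
    boundary z v.1 = z v + z (flip i v) + z (flip j v) + z (flip k v) :=
  h.sum_eq (fun s => z (v.1, s)) v.2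

theorem boundary_eq_zero_of_flip {i j k : Fin 4} (h : IsColorTriple i j k)
    {z : B × Fin 4 → ZMod 2} {b : B} (hz : ∀ s, z (flip i (b, s)) = z (b, s)) :
    boundary z b = 0 := by
  have h1 := boundary_eq h z (b, 0)
  have h2 := hz 0
  have h3 := hz j
  rw [show ((b, j) : B × Fin 4) = flip j (b, 0) by simp [flip, tetrahedron_zero],
    flip_comp h] at h3
  rw [h2, h3] at h1
  simp only at h1
  rw [h1, add_assoc, zmod_two_add_self, zmod_two_add_self, zero_add]

theorem faceSpace_le_cycleSpace {i : Fin 4} (hi : i ≠ 0) : G.faceSpace i ≤ G.cycleSpace := by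
  obtain ⟨j, k, h⟩ := exists_isColorTriple i hi
  rintro z ⟨h0, h1⟩
  refine ⟨h0, ?_⟩
  ext b
  exact boundary_eq_zero_of_flip h fun s => h1 _

/-- Functions on the faces of colour `i`. -/
def faceSpaceEquiv {i : Fin 4} (hi : i ≠ 0) :
    (G.Face i → ZMod 2) ≃ₗ[ZMod 2] G.faceSpace i where
  toFun x := ⟨fun v => x (G.face i v), fun v => by simp, fun v => by simp [hi]⟩
  map_add' x y := rfl
  map_smul' a x := rfl
  invFun z := Quot.lift z.1 fun v w h => G.eq_of_face_eq hi z.2.1 z.2.2 (Quot.sound h)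
  left_inv x := by
    ext f
    obtain ⟨v, rfl⟩ := G.face_surjective i f
    rfl
  right_inv z := rfl

theorem finrank_faceSpace [Finite B] {i : Fin 4} (hi : i ≠ 0) :
    Module.finrank (ZMod 2) (G.faceSpace i) = Nat.card (G.Face i) := by
  have := Fintype.ofFinite (G.Face i)
  rw [← (G.faceSpaceEquiv hi).finrank_eq, Module.finrank_pi, Nat.card_eq_fintype_card]

/-- A function that is constant along all edges of a connected graph is constant. -/
theorem eq_of_connected {α : Type*} (hG : G.graph.IsConnected) {f : B × Fin 4 → α}
    (h0 : ∀ v, f (G.propagator v) = f v) (h1 : ∀ c, c ≠ 0 → ∀ v, f (flip c v) = f v)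
    (v w : B × Fin 4) : f v = f w := by
  refine G.graph.eq_of_reachable (S := Set.univ) ?_ (hG.preconnected v w)
  rintro c - v
  by_cases hc : c = 0
  · subst hc; rw [graph_nbr_zero, h0]
  · rw [graph_nbr _ hc, h1 c hc]

/-- A function constant on the faces of both colours is invariant under all flips and propagators,
hence constant: the only possible relation between face boundaries equates the sum of all faces of
colour `j` with that of colour `k`. -/
theorem finrank_faceSpace_inf [Finite B] (hG : G.graph.IsConnected) {i j k : Fin 4}
    (h : IsColorTriple i j k) :
    Module.finrank (ZMod 2) (G.faceSpace j ⊓ G.faceSpace k : Submodule _ _) ≤ 1 := by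
  obtain ⟨v₀⟩ := hG.nonempty
  rw [finrank_le_one_iff]
  refine ⟨⟨fun _ => 1, ⟨fun _ => rfl, fun _ => rfl⟩, ⟨fun _ => rfl, fun _ => rfl⟩⟩, ?_⟩
  rintro ⟨z, ⟨h0, hj⟩, ⟨-, hk⟩⟩
  refine ⟨z v₀, Subtype.ext (funext fun v => ?_)⟩
  have : z v₀ = z v := by
    refine G.eq_of_connected hG h0 (fun c hc v => ?_) _ _
    rcases h.color_cases c with rfl | rfl | rfl | rfl
    · exact absurd rfl hc
    · rw [← flip_comp h.rotate, hj, hk]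
    · exact hj v
    · exact hk v
  simp [this]

theorem finrank_edgeSpace_le [Finite B] :
    Module.finrank (ZMod 2) G.edgeSpace ≤ 2 * Nat.card B := by
  classical
  have := Fintype.ofFinite B
  let E := G.graph.edges 0
  have hE : E.ncard = 2 * Nat.card B := by
    have := G.graph.two_mul_ncard_edges 0
    rw [Nat.card_prod, Nat.card_eq_fintype_card (α := Fin 4), Fintype.card_fin] at this
    simp only [E]
    omega
  let f : (E → ZMod 2) →ₗ[ZMod 2] (B × Fin 4 → ZMod 2) :=
    LinearMap.funLeft _ _ fun v => (⟨s(v, G.graph.nbr 0 v), v, rfl⟩ : E)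
  have hle : G.edgeSpace ≤ LinearMap.range f := by
    intro z hz
    refine ⟨fun e => z (Classical.choose e.2), ?_⟩
    ext v
    have := Classical.choose_spec (⟨v, rfl⟩ : s(v, G.graph.nbr 0 v) ∈ E)
    simp only [f, LinearMap.funLeft_apply]
    simp only [graph_nbr_zero] at this ⊢
    rcases Sym2.eq_iff.1 this with ⟨h, -⟩ | ⟨h, -⟩
    · rw [h]
    · rw [h, hz]
  have := Fintype.ofFinite E
  calc _ ≤ _ := Submodule.finrank_mono hle
    _ ≤ _ := LinearMap.finrank_range_le f
    _ = _ := by rw [Module.finrank_pi, ← hE, ← Nat.card_eq_fintype_card, Nat.card_coe_set_eq]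

/-- A property of bubbles that is preserved by the propagators holds everywhere in a connected
graph as soon as it holds somewhere. -/
theorem forall_of_connected (hG : G.graph.IsConnected) {Q : B → Prop}
    (hQ : ∀ v : B × Fin 4, Q v.1 → Q (G.propagator v).1) {b : B} (hb : Q b) (b' : B) : Q b' := by
  have := G.eq_of_connected hG (f := fun v => Q v.1)
    (fun v => propext ⟨fun h => by simpa using hQ _ h, hQ v⟩) (fun _ _ _ => rfl) (b, 0) (b', 0)
  exact this.mp hb

/-- There are `2n` propagators, and the boundary map of a connected graph has rank at least `n - 1`.
-/
theorem finrank_cycleSpace_le [Finite B] (hG : G.graph.IsConnected) :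
    Module.finrank (ZMod 2) G.cycleSpace ≤ Nat.card B + 1 := by
  classical
  have := Fintype.ofFinite B
  obtain ⟨v₀⟩ := hG.nonempty
  let bd : G.edgeSpace →ₗ[ZMod 2] (B → ZMod 2) := boundary.comp G.edgeSpace.subtype
  have hrank := LinearMap.finrank_range_add_finrank_ker bd
  have hker : Module.finrank (ZMod 2) (LinearMap.ker bd) =
      Module.finrank (ZMod 2) G.cycleSpace := by
    have : G.cycleSpace = (LinearMap.ker bd).map G.edgeSpace.subtype := by
      ext z
      simp [cycleSpace, bd, and_comm]
    rw [this]
    exact (LinearEquiv.finrank_eq (Submodule.equivMapOfInjective _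
      (Submodule.subtype_injective _) _))
  -- Modulo boundaries the indicator of a bubble does not change along a propagator, so by
  -- connectedness that of the bubble of `v₀` generates the quotient.
  have hspan : (⊤ : Submodule (ZMod 2) (B → ZMod 2)) ≤
      LinearMap.range bd ⊔ Submodule.span _ {Pi.single v₀.1 1} := by
    rw [← (Pi.basisFun (ZMod 2) B).span_eq, Submodule.span_le]
    rintro _ ⟨b, rfl⟩
    rw [Pi.basisFun_apply]
    refine G.forall_of_connected hG (Q := fun b => (Pi.single b 1 : B → ZMod 2) ∈
      LinearMap.range bd ⊔ Submodule.span _ {Pi.single v₀.1 1}) ?_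
      (Submodule.mem_sup_right (Submodule.mem_span_singleton_self _)) b
    intro v hv
    have hx : (Pi.single v 1 + Pi.single (G.propagator v) 1 : B × Fin 4 → ZMod 2) ∈
        G.edgeSpace := by
      intro w
      have e1 : G.propagator w = v ↔ w = G.propagator v :=
        ⟨fun h => by rw [← h]; simp, fun h => by rw [h]; simp⟩
      have e2 : G.propagator w = G.propagator v ↔ w = v :=
        G.propagator_involutive.injective.eq_iff
      simp only [Pi.add_apply, Pi.single_apply, e1, e2]
      exact add_comm _ _
    have hsingle : ∀ w : B × Fin 4, boundary (Pi.single w 1 : B × Fin 4 → ZMod 2) =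
        Pi.single w.1 1 := by
      intro w
      ext b
      simp only [boundary_apply, Pi.single_apply, Prod.ext_iff]
      by_cases hb : b = w.1 <;> simp [hb]
    have h1 : (Pi.single v.1 1 + Pi.single (G.propagator v).1 1 : B → ZMod 2) ∈
        LinearMap.range bd := ⟨⟨_, hx⟩, by simp [bd, hsingle]⟩
    have h2 := add_mem (Submodule.mem_sup_left h1) hv
    have h3 : (Pi.single v.1 1 + Pi.single (G.propagator v).1 1 + Pi.single v.1 1 : B → ZMod 2) =
        Pi.single (G.propagator v).1 1 := by
      rw [add_right_comm, fun_add_self, zero_add]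
    rwa [h3] at h2
  have h1 : Nat.card B ≤ Module.finrank (ZMod 2) (LinearMap.range bd) + 1 := by
    calc Nat.card B = Module.finrank (ZMod 2) (⊤ : Submodule (ZMod 2) (B → ZMod 2)) := by
          rw [finrank_top, Module.finrank_pi, Nat.card_eq_fintype_card]
      _ ≤ _ := Submodule.finrank_mono hspan
      _ ≤ _ := Submodule.finrank_add_le_finrank_add_finrank _ _
      _ ≤ _ := by gcongr; exact (finrank_span_le_card _).trans (by simp)
  have h2 := G.finrank_edgeSpace_le
  omega

theorem sup_faceSpace_le {i j k : Fin 4} (h : IsColorTriple i j k) :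
    G.faceSpace j ⊔ G.faceSpace k ≤ G.cycleSpace :=
  sup_le (G.faceSpace_le_cycleSpace h.ne₂) (G.faceSpace_le_cycleSpace h.ne₃)

theorem card_face_add_le_finrank [Finite B] (hG : G.graph.IsConnected) {i j k : Fin 4}
    (h : IsColorTriple i j k) :
    Nat.card (G.Face j) + Nat.card (G.Face k) ≤
      Module.finrank (ZMod 2) (G.faceSpace j ⊔ G.faceSpace k : Submodule _ _) + 1 := by
  have h1 := Submodule.finrank_sup_add_finrank_inf_eq (G.faceSpace j) (G.faceSpace k)
  have h2 := G.finrank_faceSpace_inf hG h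
  rw [finrank_faceSpace _ h.ne₂, finrank_faceSpace _ h.ne₃] at h1
  omega

/-- The Euler characteristic of a connected jacket is at most `2`. -/
theorem card_face_add_le [Finite B] (hG : G.graph.IsConnected) {i j k : Fin 4}
    (h : IsColorTriple i j k) :
    Nat.card (G.Face j) + Nat.card (G.Face k) ≤ Nat.card B + 2 := by
  have h1 := G.card_face_add_le_finrank hG h
  have h2 := G.finrank_cycleSpace_le hG
  have h3 := Submodule.finrank_mono (G.sup_faceSpace_le h)
  omega

/-- In a planar jacket every cycle bounds. -/
theorem cycleSpace_le_of_planar [Finite B] (hG : G.graph.IsConnected) {i j k : Fin 4}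
    (h : IsColorTriple i j k)
    (hF : Nat.card (G.Face j) + Nat.card (G.Face k) = Nat.card B + 2) :
    G.cycleSpace ≤ G.faceSpace j ⊔ G.faceSpace k := by
  have h1 := G.card_face_add_le_finrank hG h
  have h2 := G.finrank_cycleSpace_le hG
  rw [Submodule.eq_of_le_of_finrank_le (G.sup_faceSpace_le h) (by omega)]

/-- In a projective jacket, two cycles that do not bound are homologous. -/
theorem add_mem_of_projective [Finite B] (hG : G.graph.IsConnected) {i j k : Fin 4}
    (h : IsColorTriple i j k)
    (hF : Nat.card (G.Face j) + Nat.card (G.Face k) = Nat.card B + 1)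
    {x y : B × Fin 4 → ZMod 2} (hx : x ∈ G.cycleSpace) (hy : y ∈ G.cycleSpace)
    (hx' : x ∉ G.faceSpace j ⊔ G.faceSpace k) (hy' : y ∉ G.faceSpace j ⊔ G.faceSpace k) :
    x + y ∈ G.faceSpace j ⊔ G.faceSpace k := by
  have h1 := G.card_face_add_le_finrank hG h
  have h2 := G.finrank_cycleSpace_le hG
  set P := G.faceSpace j ⊔ G.faceSpace k
  have hle : P ⊔ Submodule.span _ {x} ≤ G.cycleSpace :=
    sup_le (G.sup_faceSpace_le h) (by simpa using hx)
  -- The bounding cycles have codimension at most one, so `x` and `P` together span all cycles.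
  have hlt : P < P ⊔ Submodule.span _ {x} := by
    refine lt_of_le_of_ne le_sup_left fun he => hx' ?_
    rw [he]
    exact Submodule.mem_sup_right (Submodule.mem_span_singleton_self _)
  have h3 := Submodule.finrank_lt_finrank_of_lt hlt
  have heq := Submodule.eq_of_le_of_finrank_le hle (by omega)
  rw [← heq] at hy
  obtain ⟨q, hq, r, hr, rfl⟩ := Submodule.mem_sup.1 hy
  obtain ⟨a, rfl⟩ := Submodule.mem_span_singleton.1 hr
  have ha : a = 0 ∨ a = 1 := by clear hr hy hy'; revert a; decide
  rcases ha with rfl | rfl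
  · exact absurd (by simpa using hq) hy'
  · rw [one_smul, add_left_comm, fun_add_self, add_zero]
    exact hq

end ONGraph

namespace ONGraph

variable {B : Type*} (G : ONGraph B)

/-! ### The intersection form of a jacket -/

/-- The contribution of the bubble `b` to the crossings with `y`. -/
def cross (k : Fin 4) (y : B × Fin 4 → ZMod 2) (b : B) : ZMod 2 := y (b, 0) + y (b, k)

/-- The intersection form modulo two of the jacket that contains the colours `0, j, k`: the first
cycle is pushed to the side of the faces of colour `j`. -/
def inter [Fintype B] (j k : Fin 4) (x y : B × Fin 4 → ZMod 2) : ZMod 2 :=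
  ∑ b, cross j x b * cross k y b

theorem cross_add (k : Fin 4) (x y : B × Fin 4 → ZMod 2) (b : B) :
    cross k (x + y) b = cross k x b + cross k y b := by
  simp only [cross, Pi.add_apply]; ring

theorem cross_zero (k : Fin 4) (b : B) : cross k (0 : B × Fin 4 → ZMod 2) b = 0 := by
  simp [cross]

section

variable [Fintype B]

theorem inter_add_left (j k : Fin 4) (x x' y : B × Fin 4 → ZMod 2) :
    inter j k (x + x') y = inter j k x y + inter j k x' y := by
  simp [inter, cross_add, add_mul, Finset.sum_add_distrib]

theorem inter_zero_left (j k : Fin 4) (y : B × Fin 4 → ZMod 2) : inter j k 0 y = 0 := by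
  simp [inter, cross_zero]

end

/-- The four values at a bubble sum to zero, so both edges of colour `k` give the same sum and any
vertex of the bubble may serve as base point. The value is `0` where the cycle turns around a face
of colour `k`, and `1` where it goes straight or turns around a face of colour `j`. -/
theorem cross_eq_of_boundary {i j k : Fin 4} (h : IsColorTriple i j k) {x : B × Fin 4 → ZMod 2}
    {v : B × Fin 4} (hx : boundary x v.1 = 0) : cross k x v.1 = x v + x (flip k v) := by
  have h1 := boundary_eq h x (v.1, 0)
  rw [hx] at h1
  have hk : ((v.1, k) : B × Fin 4) = flip k (v.1, 0) := by simp [flip, tetrahedron_zero]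
  rw [cross, hk]
  rcases eq_cases_of_fst_eq h (v := (v.1, 0)) (w := v) rfl with h' | h' | h' | h'
  · rw [h']
  · conv_rhs => rw [h']
    rw [flip_comp h.rotate.rotate]
    linear_combination -h1 - zmod_two_add_self (x (flip i (v.1, 0)) + x (flip j (v.1, 0)))
  · conv_rhs => rw [h']
    rw [flip_comp h.rotate.rotate.swap]
    linear_combination -h1 - zmod_two_add_self (x (flip i (v.1, 0)) + x (flip j (v.1, 0)))
  · conv_rhs => rw [h']
    rw [flip_flip, add_comm]

theorem cross_eq {i j k : Fin 4} (h : IsColorTriple i j k) {x : B × Fin 4 → ZMod 2}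
    (hx : x ∈ G.cycleSpace) (v : B × Fin 4) : cross k x v.1 = x v + x (flip k v) :=
  cross_eq_of_boundary h (congrFun hx.2 v.1)

theorem cross_eq_zero_of_flip {i j k : Fin 4} (h : IsColorTriple i j k)
    {x : B × Fin 4 → ZMod 2} {b : B} (hx : ∀ s, x (flip k (b, s)) = x (b, s)) :
    cross k x b = 0 := by
  rw [cross_eq_of_boundary h (v := (b, 0)) (boundary_eq_zero_of_flip h.rotate.rotate hx), hx,
    zmod_two_add_self]

section

variable [Fintype B]

theorem sum_mul_eq_zero {x y : B × Fin 4 → ZMod 2} (hx : x ∈ G.edgeSpace)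
    (hy : y ∈ G.edgeSpace) : ∑ v, x v * y v = 0 := by
  refine Finset.sum_involution (fun v _ => G.propagator v) ?_ ?_ ?_ ?_
  · intro v _
    rw [hx v, hy v, zmod_two_add_self]
  · intro v _ _
    exact G.propagator_ne v
  · simp
  · simp

/-- For cycles, the two orders differ at each bubble by the sum of `x v * y v` over its vertices,
and in the total every propagator is counted at both ends. -/
theorem inter_comm {i j k : Fin 4} (h : IsColorTriple i j k) {x y : B × Fin 4 → ZMod 2}
    (hx : x ∈ G.cycleSpace) (hy : y ∈ G.cycleSpace) : inter j k x y = inter j k y x := by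
  have h0 := G.sum_mul_eq_zero hx.1 hy.1
  rw [Fintype.sum_prod_type] at h0
  have key : inter j k x y + inter j k y x = 0 := by
    rw [← h0, inter, inter, ← Finset.sum_add_distrib]
    refine Finset.sum_congr rfl fun b _ => ?_
    have hx' := congrFun hx.2 b
    have hy' := congrFun hy.2 b
    rw [boundary_apply, h.sum_eq _ 0] at hx' hy'
    rw [h.sum_eq _ 0]
    simp only [tetrahedron_zero, cross, Pi.zero_apply] at *
    generalize x (b, 0) = x0 at *
    generalize x (b, i) = x1 at *
    generalize x (b, j) = x2 at *
    generalize x (b, k) = x3 at *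
    generalize y (b, 0) = y0 at *
    generalize y (b, i) = y1 at *
    generalize y (b, j) = y2 at *
    generalize y (b, k) = y3 at *
    clear h0 hx hy
    obtain rfl : x1 = x0 + x2 + x3 := by
      linear_combination hx' - zmod_two_add_self (x0 + x2 + x3)
    obtain rfl : y1 = y0 + y2 + y3 := by
      linear_combination hy' - zmod_two_add_self (y0 + y2 + y3)
    linear_combination zmod_two_add_self (-x2 * y2 - x3 * y3)
  rw [← add_zero (inter j k x y), ← zmod_two_add_self (inter j k y x), ← add_assoc, key, zero_add]

/-- Boundaries of colour `j` are killed by the left factor `cross j`, those of colour `k` by the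
right factor `cross k`; symmetry lets each stand on its own side. -/
theorem inter_eq_zero_of_mem {i j k : Fin 4} (h : IsColorTriple i j k)
    {x y : B × Fin 4 → ZMod 2} (hx : x ∈ G.faceSpace j ⊔ G.faceSpace k)
    (hy : y ∈ G.cycleSpace) : inter j k x y = 0 := by
  obtain ⟨u, hu, w, hw, rfl⟩ := Submodule.mem_sup.1 hx
  rw [inter_add_left, G.inter_comm h (G.faceSpace_le_cycleSpace h.ne₃ hw) hy]
  have h1 : inter j k u y = 0 := by
    refine Finset.sum_eq_zero fun b _ => ?_
    rw [cross_eq_zero_of_flip h.swap (fun s => hu.2 _), zero_mul]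
  have h2 : inter j k y w = 0 := by
    refine Finset.sum_eq_zero fun b _ => ?_
    rw [cross_eq_zero_of_flip h (fun s => hw.2 _), mul_zero]
  rw [h1, h2, add_zero]

/-- The intersection form vanishes on a planar jacket. -/
theorem inter_eq_zero_of_planar (hG : G.graph.IsConnected) {i j k : Fin 4}
    (h : IsColorTriple i j k)
    (hF : Nat.card (G.Face j) + Nat.card (G.Face k) = Nat.card B + 2)
    {x y : B × Fin 4 → ZMod 2} (hx : x ∈ G.cycleSpace) (hy : y ∈ G.cycleSpace) :
    inter j k x y = 0 :=
  G.inter_eq_zero_of_mem h (G.cycleSpace_le_of_planar hG h hF hx) hy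

/-- The intersection form has rank at most one on a projective jacket. -/
theorem inter_eq_mul_of_projective (hG : G.graph.IsConnected) {i j k : Fin 4}
    (h : IsColorTriple i j k)
    (hF : Nat.card (G.Face j) + Nat.card (G.Face k) = Nat.card B + 1)
    {x y : B × Fin 4 → ZMod 2} (hx : x ∈ G.cycleSpace) (hy : y ∈ G.cycleSpace) :
    inter j k x y = inter j k x x * inter j k y y := by
  by_cases hx' : x ∈ G.faceSpace j ⊔ G.faceSpace k
  · rw [G.inter_eq_zero_of_mem h hx' hy, G.inter_eq_zero_of_mem h hx' hx, zero_mul]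
  by_cases hy' : y ∈ G.faceSpace j ⊔ G.faceSpace k
  · rw [G.inter_comm h hx hy, G.inter_eq_zero_of_mem h hy' hx, G.inter_eq_zero_of_mem h hy' hy,
      mul_zero]
  have hxy := G.add_mem_of_projective hG h hF hx hy hx' hy'
  have h1 := G.inter_eq_zero_of_mem h hxy hx
  have h2 := G.inter_eq_zero_of_mem h hxy hy
  rw [inter_add_left] at h1 h2
  rw [G.inter_comm h hy hx] at h1
  -- All three numbers `a`, `b`, `c` are equal, and elements of the field with two elements are
  -- idempotent.
  generalize inter j k x x = a at *
  generalize inter j k x y = b at *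
  generalize inter j k y y = c at *
  revert a b c; decide

/-- On a projective jacket with a cycle of odd self-intersection, the cycles of even
self-intersection bound. -/
theorem mem_of_inter_self_eq_zero (hG : G.graph.IsConnected) {i j k : Fin 4}
    (h : IsColorTriple i j k)
    (hF : Nat.card (G.Face j) + Nat.card (G.Face k) = Nat.card B + 1)
    {x y : B × Fin 4 → ZMod 2} (hx : x ∈ G.cycleSpace) (hx1 : inter j k x x = 1)
    (hy : y ∈ G.cycleSpace) (hy0 : inter j k y y = 0) :
    y ∈ G.faceSpace j ⊔ G.faceSpace k := by
  by_contra hy'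
  have hx' : x ∉ G.faceSpace j ⊔ G.faceSpace k := by
    intro hx'
    rw [G.inter_eq_zero_of_mem h hx' hx] at hx1
    exact zero_ne_one hx1
  have hxy := G.add_mem_of_projective hG h hF hx hy hx' hy'
  have h1 := G.inter_eq_zero_of_mem h hxy hx
  have h2 := G.inter_eq_zero_of_mem h hxy hy
  rw [inter_add_left] at h1 h2
  rw [G.inter_comm h hy hx, hx1] at h1
  rw [hy0] at h2
  generalize inter j k x y = b at *
  revert b; decide

end

/-! ### Arcs along faces -/

open Classical in
/-- The indicator function of a propagator. -/
noncomputable def edgeVec (v w : B × Fin 4) : ZMod 2 :=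
  (if w = v then 1 else 0) + if w = G.propagator v then 1 else 0

/-- The sum of the first `m` propagators of the face of colour `i` that starts at `v`. -/
noncomputable def arc (i : Fin 4) (v : B × Fin 4) (m : ℕ) : B × Fin 4 → ZMod 2 :=
  ∑ l ∈ Finset.range m, G.edgeVec ((G.step i)^[l] v)

open Classical in
/-- The crossings with `y` at the end `v` of a propagator. -/
noncomputable def halfCross (j k : Fin 4) (y : B × Fin 4 → ZMod 2) (v : B × Fin 4) : ZMod 2 :=
  if v.2 = 0 ∨ v.2 = j then cross k y v.1 else 0

theorem edgeVec_mem (v : B × Fin 4) : G.edgeVec v ∈ G.edgeSpace := by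
  intro w
  have e1 : G.propagator w = v ↔ w = G.propagator v :=
    ⟨fun h => by rw [← h]; simp, fun h => by rw [h]; simp⟩
  have e2 : G.propagator w = G.propagator v ↔ w = v := G.propagator_involutive.injective.eq_iff
  classical
  rw [edgeVec, edgeVec, if_congr e1 rfl rfl, if_congr e2 rfl rfl, add_comm]

open Classical in
theorem boundary_edgeVec (v : B × Fin 4) (b : B) :
    boundary (G.edgeVec v) b =
      (if b = v.1 then 1 else 0) + if b = (G.propagator v).1 then 1 else 0 := by
  have hsingle : ∀ w : B × Fin 4, (∑ s, if (b, s) = w then (1 : ZMod 2) else 0) =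
      if b = w.1 then 1 else 0 := by
    intro w
    simp only [Prod.ext_iff]
    by_cases hb : b = w.1 <;> simp [hb]
  simp only [boundary_apply, edgeVec, Finset.sum_add_distrib, hsingle]

theorem arc_succ (i : Fin 4) (v : B × Fin 4) (m : ℕ) :
    G.arc i v (m + 1) = G.arc i v m + G.edgeVec ((G.step i)^[m] v) := by
  rw [arc, arc, Finset.sum_range_succ]

theorem arc_mem (i : Fin 4) (v : B × Fin 4) (m : ℕ) : G.arc i v m ∈ G.edgeSpace :=
  sum_mem fun _ _ => G.edgeVec_mem _

open Classical in
theorem boundary_arc (i : Fin 4) (v : B × Fin 4) (m : ℕ) (b : B) :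
    boundary (G.arc i v m) b =
      (if b = v.1 then 1 else 0) + if b = ((G.step i)^[m] v).1 then 1 else 0 := by
  induction m with
  | zero =>
    rw [arc, Finset.sum_range_zero, map_zero]
    exact (zmod_two_add_self _).symm
  | succ m ih =>
    rw [arc_succ, map_add, Pi.add_apply, ih, boundary_edgeVec, Function.iterate_succ_apply',
      step_fst, add_assoc, ← add_assoc (if b = ((G.step i)^[m] v).1 then (1 : ZMod 2) else 0),
      zmod_two_add_self, zero_add]

/-- Two arcs with the same ends form a cycle. -/
theorem arc_add_arc_mem {i : Fin 4} {a b : B × Fin 4} {m l : ℕ}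
    (hab : (a.1 = b.1 ∧ ((G.step i)^[m] a).1 = ((G.step i)^[l] b).1) ∨
      (a.1 = ((G.step i)^[l] b).1 ∧ b.1 = ((G.step i)^[m] a).1)) :
    G.arc i a m + G.arc i b l ∈ G.cycleSpace := by
  classical
  refine ⟨add_mem (G.arc_mem i a m) (G.arc_mem i b l), ?_⟩
  ext x
  rw [map_add, Pi.add_apply, boundary_arc, boundary_arc]
  rcases hab with ⟨h1, h2⟩ | ⟨h1, h2⟩
  · rw [h1, h2]; exact zmod_two_add_self _
  · rw [h1, h2, add_comm (if x = ((G.step i)^[m] a).1 then (1 : ZMod 2) else 0)]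
    exact zmod_two_add_self _

theorem halfCross_eq_zero {j k : Fin 4} {y : B × Fin 4 → ZMod 2} {v : B × Fin 4}
    (h : cross k y v.1 = 0) : halfCross j k y v = 0 := by
  rw [halfCross, h, ite_self]

/-- The corners at a bubble alternate between colours `j` and `k`. A curve pushed to the side of
colour `j` passes from one corner of colour `j` to the opposite one when it goes straight, and meets
`y` exactly `cross k y` times on the way, modulo two. -/
theorem halfCross_flip {i j k : Fin 4} (h : IsColorTriple i j k) (y : B × Fin 4 → ZMod 2)
    (v : B × Fin 4) : halfCross j k y (flip i v) = halfCross j k y v + cross k y v.1 := by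
  have hd : ∀ {i j k : Fin 4}, IsColorTriple i j k → ∀ s : Fin 4,
      (tetrahedron i s = 0 ∨ tetrahedron i s = j) ↔ ¬ (s = 0 ∨ s = j) := by decide
  simp only [halfCross, flip, hd h]
  by_cases hs : v.2 = 0 ∨ v.2 = j
  · rw [if_neg (not_not_intro hs), if_pos hs, zmod_two_add_self]
  · rw [if_pos hs, if_neg hs, zero_add]

section

variable [Fintype B]

open Classical in
theorem inter_single {j k : Fin 4} (hj : j ≠ 0) (y : B × Fin 4 → ZMod 2) (v : B × Fin 4) :
    inter j k (fun w => if w = v then 1 else 0) y = halfCross j k y v := by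
  obtain ⟨b, s⟩ := v
  rw [inter, Finset.sum_eq_single b]
  · by_cases h0 : s = 0
    · subst h0; simp [cross, halfCross, hj]
    · by_cases h1 : s = j
      · subst h1; simp [cross, halfCross, h0, Ne.symm h0]
      · simp [cross, halfCross, h0, h1, Ne.symm h0, Ne.symm h1]
  · intro b' _ hb
    simp [cross, hb]
  · simp

theorem inter_edgeVec {j k : Fin 4} (hj : j ≠ 0) (y : B × Fin 4 → ZMod 2) (v : B × Fin 4) :
    inter j k (G.edgeVec v) y = halfCross j k y v + halfCross j k y (G.propagator v) := by
  rw [← inter_single hj, ← inter_single hj, ← inter_add_left]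
  rfl

/-- Every propagator contributes its two half-crossings, and at an inner bubble the two
half-crossings of a straight passage add up to `cross k y`. The last bubble is included in the sum,
which is why the final half-crossing is taken after the passage through it. -/
theorem inter_arc {i j k : Fin 4} (h : IsColorTriple i j k) (y : B × Fin 4 → ZMod 2)
    (v : B × Fin 4) (m : ℕ) :
    inter j k (G.arc i v m) y = halfCross j k y v + halfCross j k y ((G.step i)^[m] v) +
      ∑ l ∈ Finset.range m, cross k y ((G.step i)^[l + 1] v).1 := by
  induction m with
  | zero =>
    rw [arc, Finset.sum_range_zero, Finset.sum_range_zero, inter_zero_left, add_zero]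
    exact (zmod_two_add_self _).symm
  | succ m ih =>
    rw [arc_succ, inter_add_left, ih, inter_edgeVec _ h.ne₂, Finset.sum_range_succ,
      Function.iterate_succ_apply']
    set w := (G.step i)^[m] v
    rw [← flip_step G i w, halfCross_flip h]
    linear_combination zmod_two_add_self (halfCross j k y w)

/-- If the cycles that do not cross `d` cross nothing, then a cycle made of two arcs of faces that
avoids `d` has an even number of crossings inside the arcs with every cycle that does not cross it
at the ends of the arcs. -/
theorem sum_cross_eq_zero {i j k : Fin 4} (h : IsColorTriple i j k) {d : B × Fin 4 → ZMod 2}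
    (H : ∀ x ∈ G.cycleSpace, inter j k x d = 0 → ∀ y ∈ G.cycleSpace, inter j k x y = 0)
    {a b : B × Fin 4} {m l : ℕ}
    (hab : (a.1 = b.1 ∧ ((G.step i)^[m] a).1 = ((G.step i)^[l] b).1) ∨
      (a.1 = ((G.step i)^[l] b).1 ∧ b.1 = ((G.step i)^[m] a).1))
    (hda : ∀ t ≤ m, cross k d ((G.step i)^[t] a).1 = 0)
    (hdb : ∀ t ≤ l, cross k d ((G.step i)^[t] b).1 = 0)
    {y : B × Fin 4 → ZMod 2} (hy : y ∈ G.cycleSpace)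
    (hya : cross k y a.1 = 0) (hya' : cross k y ((G.step i)^[m] a).1 = 0) :
    ∑ t ∈ Finset.range m, cross k y ((G.step i)^[t + 1] a).1 +
      ∑ t ∈ Finset.range l, cross k y ((G.step i)^[t + 1] b).1 = 0 := by
  have hbd : cross k y b.1 = 0 ∧ cross k y ((G.step i)^[l] b).1 = 0 := by
    rcases hab with ⟨h1, h2⟩ | ⟨h1, h2⟩
    · rw [← h1, ← h2]; exact ⟨hya, hya'⟩
    · rw [← h1, h2]; exact ⟨hya', hya⟩
  -- The two arcs close up to a cycle that meets `d` at no bubble, so `H` applies to it.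
  have h1 : inter j k (G.arc i a m + G.arc i b l) d = 0 := by
    rw [inter_add_left, inter_arc _ h, inter_arc _ h, halfCross_eq_zero (v := a) (hda 0 (by omega)),
      halfCross_eq_zero (hda m le_rfl), halfCross_eq_zero (v := b) (hdb 0 (by omega)),
      halfCross_eq_zero (hdb l le_rfl), Finset.sum_eq_zero, Finset.sum_eq_zero]
    · simp
    · intro t ht; exact hdb _ (Finset.mem_range.1 ht)
    · intro t ht; exact hda _ (Finset.mem_range.1 ht)
  have h2 := H _ (G.arc_add_arc_mem hab) h1 y hy
  rw [inter_add_left, inter_arc _ h, inter_arc _ h, halfCross_eq_zero hya,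
    halfCross_eq_zero hya', halfCross_eq_zero hbd.1, halfCross_eq_zero hbd.2] at h2
  simpa using h2

end

/-! ### Faces of colour `i` as cycles in the jacket without `i` -/

open Classical in
/-- The indicator function of a face. -/
noncomputable def faceVec {i : Fin 4} (f : G.Face i) (v : B × Fin 4) : ZMod 2 :=
  if G.face i v = f then 1 else 0

theorem faceVec_mem {i : Fin 4} (hi : i ≠ 0) (f : G.Face i) : G.faceVec f ∈ G.faceSpace i :=
  ⟨fun v => by rw [faceVec, faceVec, face_propagator],
    fun v => by rw [faceVec, faceVec, face_flip _ hi]⟩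

theorem faceVec_mem_cycleSpace {i : Fin 4} (hi : i ≠ 0) (f : G.Face i) :
    G.faceVec f ∈ G.cycleSpace :=
  G.faceSpace_le_cycleSpace hi (G.faceVec_mem hi f)

/-- Two straight strands of colour `i` pass through a bubble, one through `v` and one through `flip
j v`; the value is `1` when exactly one of them belongs to `f`. -/
theorem cross_faceVec {i j k : Fin 4} (h : IsColorTriple i j k) (f : G.Face i) (v : B × Fin 4) :
    cross k (G.faceVec f) v.1 = G.faceVec f v + G.faceVec f (flip j v) := by
  rw [G.cross_eq h (G.faceVec_mem_cycleSpace h.ne₁ f), ← flip_comp h,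
    (G.faceVec_mem h.ne₁ f).2]

theorem cross_faceVec_swap {i j k : Fin 4} (h : IsColorTriple i j k) (f : G.Face i) (b : B) :
    cross j (G.faceVec f) b = cross k (G.faceVec f) b := by
  rw [G.cross_faceVec h f (b, 0), G.cross_eq h.swap (G.faceVec_mem_cycleSpace h.ne₁ f) (b, 0)]

theorem cross_faceVec_eq_zero {i j k : Fin 4} (h : IsColorTriple i j k) {f : G.Face i}
    {v : B × Fin 4} (h1 : G.face i v ≠ f) (h2 : G.face i (flip j v) ≠ f) :
    cross k (G.faceVec f) v.1 = 0 := by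
  rw [G.cross_faceVec h]
  simp [faceVec, h1, h2]

theorem cross_faceVec_eq_one {i j k : Fin 4} (h : IsColorTriple i j k) {f : G.Face i}
    {v : B × Fin 4} (h1 : G.face i v ≠ f) (h2 : G.face i (flip j v) = f) :
    cross k (G.faceVec f) v.1 = 1 := by
  rw [G.cross_faceVec h]
  simp [faceVec, h1, h2]

section

variable [Fintype B]

theorem faceVec_face {i : Fin 4} (hi : i ≠ 0) (v : B × Fin 4) :
    G.faceVec (G.face i v) = G.arc i v (G.faceLength (G.face i v)) := by
  classical
  rw [faceLength_face _ hi]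
  ext w
  rw [arc, Finset.sum_apply]
  set ℓ := Function.minimalPeriod (G.step i) v with hℓ
  by_cases hw : G.face i w = G.face i v
  · obtain ⟨m, hm⟩ := (G.face_eq_iff hi).1 hw.symm
    have hm' : (G.step i)^[m % ℓ] v = w ∨ (G.step i)^[m % ℓ] v = G.propagator w := by
      rwa [hℓ, Function.iterate_mod_minimalPeriod_eq]
    have hlt : m % ℓ < ℓ := Nat.mod_lt _ (G.minimalPeriod_pos i v)
    generalize m % ℓ = r at hm' hlt
    rw [Finset.sum_eq_single r]
    · rw [faceVec, if_pos hw, edgeVec]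
      rcases hm' with rfl | h'
      · rw [if_pos rfl, if_neg (G.propagator_ne _).symm, add_zero]
      · rw [h', propagator_propagator, if_pos rfl, if_neg (G.propagator_ne _).symm, zero_add]
    · intro l hl hlr
      rw [Finset.mem_range] at hl
      rw [edgeVec]
      rcases hm' with rfl | h'
      · rw [if_neg, if_neg, add_zero]
        · exact G.iterate_ne_propagator hi v r l
        · exact fun h => hlr (G.iterate_injOn i v hl hlt h.symm)
      · have h'' : w = G.propagator ((G.step i)^[r] v) := by rw [h']; simp
        rw [h'', if_neg, if_neg, add_zero]
        · exact fun h => hlr (G.iterate_injOn i v hl hlt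
            (G.propagator_involutive.injective h.symm))
        · exact (G.iterate_ne_propagator hi v l r).symm
    · intro h; exact absurd (Finset.mem_range.2 hlt) h
  · rw [faceVec, if_neg hw, Finset.sum_eq_zero]
    intro l _
    rw [edgeVec, if_neg, if_neg, add_zero]
    · rintro rfl; exact hw (by simp [hi])
    · rintro rfl; exact hw (by simp [hi])

/-- On a closed arc the half-crossings at the two ends cancel, and the sum may be shifted by one
step. -/
theorem inter_faceVec_face {i j k : Fin 4} (h : IsColorTriple i j k) (v : B × Fin 4)
    (y : B × Fin 4 → ZMod 2) :
    inter j k (G.faceVec (G.face i v)) y =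
      ∑ l ∈ Finset.range (G.faceLength (G.face i v)), cross k y ((G.step i)^[l] v).1 := by
  have hℓ := G.iterate_faceLength h.ne₁ v
  rw [faceVec_face _ h.ne₁, inter_arc _ h]
  set ℓ := G.faceLength (G.face i v)
  rw [hℓ, zmod_two_add_self, zero_add]
  have h1 := Finset.sum_range_succ (fun l => cross k y ((G.step i)^[l] v).1) ℓ
  have h2 := Finset.sum_range_succ' (fun l => cross k y ((G.step i)^[l] v).1) ℓ
  rw [h1, hℓ] at h2
  simp only [Function.iterate_zero, id] at h2
  exact (add_right_cancel h2).symm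

/-- The self-intersection of a face of colour `i` in the jacket without `i` is its length. -/
theorem inter_self_faceVec {i j k : Fin 4} (h : IsColorTriple i j k) (f : G.Face i) :
    inter j k (G.faceVec f) (G.faceVec f) = G.faceLength f := by
  classical
  have hf := G.faceVec_mem h.ne₁ f
  -- For a straight curve the factors `cross j` and `cross k` agree, and squaring is the identity
  -- modulo two.
  have h1 : inter j k (G.faceVec f) (G.faceVec f) = ∑ b, cross k (G.faceVec f) b := by
    refine Finset.sum_congr rfl fun b _ => ?_
    rw [G.cross_faceVec_swap h]
    generalize cross k (G.faceVec f) b = a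
    revert a; decide
  -- The length is the number of straight passages of `f` through bubbles, each of which uses two
  -- vertices.
  have h2 : (2 * G.faceLength f : ℕ) =
      ∑ b : B, 2 * ((if G.face i (b, 0) = f then 1 else 0) +
        (if G.face i (b, k) = f then 1 else 0) : ℕ) := by
    rw [two_mul_faceLength, Set.ncard_eq_toFinset_card', Set.toFinset_ofPred, Finset.card_filter,
      Fintype.sum_prod_type]
    refine Finset.sum_congr rfl fun b _ => ?_
    rw [h.sum_eq _ 0]
    simp only [tetrahedron_zero]
    have e1 : G.face i (b, i) = G.face i (b, 0) := by
      rw [← G.face_flip h.ne₁ (b, 0)]; simp [flip, tetrahedron_zero]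
    have e2 : G.face i (b, k) = G.face i (b, j) := by
      rw [← G.face_flip h.ne₁ (b, j)]
      congr 1
      rw [show ((b, j) : B × Fin 4) = flip j (b, 0) by simp [flip, tetrahedron_zero], flip_comp h]
      simp [flip, tetrahedron_zero]
    rw [e1, e2]; ring
  rw [← Finset.mul_sum] at h2
  have h3 := mul_left_cancel₀ two_ne_zero h2
  rw [h1, h3]
  push_cast
  simp only [cross, faceVec]

theorem faceLength_odd_iff {i j k : Fin 4} (h : IsColorTriple i j k) (f : G.Face i) :
    Odd (G.faceLength f) ↔ inter j k (G.faceVec f) (G.faceVec f) = 1 := by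
  rw [inter_self_faceVec _ h, ZMod.natCast_eq_one_iff_odd]

theorem faceLength_even_iff {i j k : Fin 4} (h : IsColorTriple i j k) (f : G.Face i) :
    Even (G.faceLength f) ↔ inter j k (G.faceVec f) (G.faceVec f) = 0 := by
  rw [inter_self_faceVec _ h, ZMod.natCast_eq_zero_iff_even]

end

end ONGraph

/-! ### Consequences of 2PI: no loops, no double propagators, triangles -/

namespace ONGraph

variable {B : Type*} {G : ONGraph B}

/-- If the removal of two propagators does not disconnect the graph, then a property of bubbles
that is preserved by all the other propagators holds everywhere or nowhere. -/
theorem IsTwoPI.forall_of_cut (hG : G.IsTwoPI) {v₁ v₂ : B × Fin 4} (hne : v₁ ≠ v₂)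
    (hne' : v₁ ≠ G.propagator v₂) {Q : B → Prop}
    (hQ : ∀ v, v ≠ v₁ → v ≠ G.propagator v₁ → v ≠ v₂ → v ≠ G.propagator v₂ → Q v.1 →
      Q (G.propagator v).1) {b : B} (hb : Q b) (b' : B) : Q b' := by
  have hE : ∀ v, s(v, G.propagator v) ∈ G.graph.edges 0 := fun v => ⟨v, by simp [graph_nbr_zero]⟩
  have hconn := hG _ (hE v₁) _ (hE v₂) (by
    intro h
    rcases Sym2.eq_iff.1 h with ⟨h, -⟩ | ⟨h, -⟩
    · exact hne h
    · exact hne' h)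
  obtain ⟨q⟩ := hconn.preconnected (b, 0) (b', 0)
  have key : ∀ {v w : B × Fin 4}, (G.graph.remove 0 {s(v₁, G.propagator v₁),
      s(v₂, G.propagator v₂)}).Walk v w → Q v.1 → Q w.1 := by
    intro v w q
    induction q with
    | nil => exact id
    | @cons v w _ hadj _ ih =>
      intro hv
      apply ih
      obtain ⟨c, rfl, hc⟩ := hadj
      by_cases h0 : c = 0
      · subst h0
        simp only [graph_nbr_zero, true_and, Set.mem_insert_iff, Set.mem_singleton_iff,
          Sym2.eq_iff] at hc ⊢
        refine hQ v ?_ ?_ ?_ ?_ hv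
        all_goals rintro rfl; simp at hc
      · rw [graph_nbr _ h0]; exact hv
  exact key q hb

/-- A loop is only possible on a single bubble. -/
theorem IsTwoPI.subsingleton_of_loop (hG : G.IsTwoPI) (hc : G.graph.IsConnected)
    {v : B × Fin 4} (hv : (G.propagator v).1 = v.1) (b : B) : b = v.1 := by
  obtain ⟨a, ha, hav⟩ : ∃ a, a ≠ 0 ∧ G.propagator v = flip a v := by
    have h : IsColorTriple 1 2 3 := by decide
    rcases eq_cases_of_fst_eq h hv with h' | h' | h' | h'
    · exact absurd h' (G.propagator_ne v)
    · exact ⟨1, h.ne₁, h'⟩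
    · exact ⟨2, h.ne₂, h'⟩
    · exact ⟨3, h.ne₃, h'⟩
  obtain ⟨j, k, h⟩ := exists_isColorTriple a ha
  -- The loop uses two vertices of the bubble. The other two are either joined to each other, so
  -- that the bubble is a component, or carry two propagators whose removal isolates it.
  by_cases hjk : flip j v = G.propagator (flip k v)
  · refine G.forall_of_connected hc (Q := fun b => b = v.1) ?_ rfl b
    intro w hw
    rcases eq_cases_of_fst_eq h hw with h' | h' | h' | h'
    · rw [h', hav]; rfl
    · rw [h', ← hav]; simp
    · rw [h', hjk]; simp
    · rw [h', ← hjk]; rfl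
  · refine hG.forall_of_cut (flip_ne_flip h.rotate v) hjk (Q := fun b => b = v.1) ?_ rfl b
    intro w h1 _ h2 _ hw
    rcases eq_cases_of_fst_eq h hw with h' | h' | h' | h'
    · rw [h', hav]; rfl
    · rw [h', ← hav]; simp
    · exact absurd h' h1
    · exact absurd h' h2

theorem faceLength_le_of_iterate [Finite B] {i : Fin 4} (hi : i ≠ 0) {v : B × Fin 4} {m : ℕ}
    (hm : 0 < m) (h : (G.step i)^[m] v = v) : G.faceLength (G.face i v) ≤ m := by
  rw [faceLength_face _ hi]
  exact Function.IsPeriodicPt.minimalPeriod_le hm h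

theorem card_face_pos [Finite B] [Nonempty B] (i : Fin 4) : 0 < Nat.card (G.Face i) := by
  have : Nonempty (G.Face i) := ⟨G.face i (Classical.arbitrary B, 0)⟩
  exact Nat.card_pos

/-- A loop leaves a single bubble. The degree then allows one face of each colour, necessarily of
length two, but the loop closes a face of length one. -/
theorem IsTwoPIDipoleFreeOfDegreeThreeHalves.no_loop [Finite B]
    (hG : G.IsTwoPIDipoleFreeOfDegreeThreeHalves) (v : B × Fin 4) :
    (G.propagator v).1 ≠ v.1 := by
  intro hv
  obtain ⟨hc, h2, -, hd⟩ := hG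
  have hsub : Subsingleton B := ⟨fun b b' => by
    rw [h2.subsingleton_of_loop hc hv b, h2.subsingleton_of_loop hc hv b']⟩
  have hne : Nonempty B := ⟨v.1⟩
  have hn : Nat.card B = 1 := Nat.card_eq_one_iff_unique.2 ⟨hsub, hne⟩
  obtain ⟨a, j, k, h, hav⟩ : ∃ a j k, IsColorTriple a j k ∧ G.propagator v = flip a v := by
    rcases eq_cases_of_fst_eq (show IsColorTriple 1 2 3 by decide) hv with h' | h' | h' | h'
    · exact absurd h' (G.propagator_ne v)
    · exact ⟨1, 2, 3, by decide, h'⟩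
    · exact ⟨2, 1, 3, by decide, h'⟩
    · exact ⟨3, 1, 2, by decide, h'⟩
  rw [degree_eq_three_halves_iff _ h, hn] at hd
  have hj := card_face_pos (G := G) j
  have hk := card_face_pos (G := G) k
  have ha := card_face_pos (G := G) a
  have ha1 : Nat.card (G.Face a) = 1 := by omega
  have := Fintype.ofFinite (G.Face a)
  have hs := G.sum_faceLength (i := a)
  obtain ⟨h1, -⟩ := Nat.card_eq_one_iff_unique.1 ha1
  rw [Fintype.sum_subsingleton _ (G.face a v), hn] at hs
  have := faceLength_le_of_iterate (G := G) h.ne₁ (v := v) (m := 1) one_pos (by simp [step, hav])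
  omega

/-- A face of length one is a loop; a face of length two visits two bubbles, as there are no loops,
and is a dipole. -/
theorem IsTwoPIDipoleFreeOfDegreeThreeHalves.three_le_faceLength [Finite B]
    (hG : G.IsTwoPIDipoleFreeOfDegreeThreeHalves) {i : Fin 4} (hi : i ≠ 0) (f : G.Face i) :
    3 ≤ G.faceLength f := by
  have hpos := G.faceLength_pos hi f
  obtain ⟨v, rfl⟩ := G.face_surjective i f
  have hit := G.iterate_faceLength hi v
  have hloop := hG.no_loop v
  by_contra hlt
  obtain h1 | h2 : G.faceLength (G.face i v) = 1 ∨ G.faceLength (G.face i v) = 2 := by omega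
  · rw [h1] at hit
    have h3 : (G.step i v).1 = v.1 := congrArg Prod.fst hit
    exact hloop h3
  · refine hG.2.2.1 ⟨i, hi, _, h2, v, (G.mem_supp_iff _ _).2 rfl, G.propagator v,
      (G.mem_supp_iff _ _).2 (by simp), hloop.symm⟩

/-- No loops and no multiple propagators between two bubbles. -/
def IsSimple (G : ONGraph B) : Prop :=
  (∀ v, (G.propagator v).1 ≠ v.1) ∧
    ∀ v w, v.1 = w.1 → (G.propagator v).1 = (G.propagator w).1 → v = w

theorem IsSimple.step_fst_ne (hG : G.IsSimple) (i : Fin 4) (v : B × Fin 4) :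
    (G.step i v).1 ≠ v.1 := hG.1 v

theorem IsSimple.step_step_fst_ne (hG : G.IsSimple) {i : Fin 4} (hi : i ≠ 0) (v : B × Fin 4) :
    (G.step i (G.step i v)).1 ≠ v.1 := by
  intro h
  have := hG.2 (G.step i v) (flip i (G.step i v)) rfl (by
    rw [propagator_flip_step, ← h]; rfl)
  exact flip_ne hi _ this.symm

/-- In the jacket that contains the colours `0, j, k`, every cycle of even self-intersection
bounds. -/
def EvenCyclesBound [Fintype B] (G : ONGraph B) (j k : Fin 4) : Prop :=
  ∀ x ∈ G.cycleSpace, inter j k x x = 0 → x ∈ G.faceSpace j ⊔ G.faceSpace k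

theorem EvenCyclesBound.swap [Fintype B] {j k : Fin 4} (h : G.EvenCyclesBound j k) :
    G.EvenCyclesBound k j := by
  intro x hx h0
  rw [sup_comm]
  refine h x hx ?_
  rw [← h0]
  exact Finset.sum_congr rfl fun b _ => mul_comm _ _

open Classical in
/-- The indicator function of a set of vertices. -/
noncomputable def setVec (S : Set (B × Fin 4)) (v : B × Fin 4) : ZMod 2 := if v ∈ S then 1 else 0

theorem setVec_eq_one {S : Set (B × Fin 4)} {v : B × Fin 4} (h : v ∈ S) : setVec S v = 1 :=
  if_pos h

theorem setVec_eq_zero {S : Set (B × Fin 4)} {v : B × Fin 4} (h : v ∉ S) : setVec S v = 0 :=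
  if_neg h

theorem setVec_congr {S : Set (B × Fin 4)} {v w : B × Fin 4} (h : v ∈ S → w ∈ S)
    (h' : w ∈ S → v ∈ S) : setVec S w = setVec S v := by
  by_cases hv : v ∈ S
  · rw [setVec_eq_one hv, setVec_eq_one (h hv)]
  · rw [setVec_eq_zero hv, setVec_eq_zero fun hw => hv (h' hw)]

theorem setVec_mem {S : Set (B × Fin 4)} (hS : ∀ v ∈ S, G.propagator v ∈ S) :
    setVec S ∈ G.edgeSpace := fun v =>
  setVec_congr (hS v) fun h => by simpa using hS _ h

theorem setVec_flip {S : Set (B × Fin 4)} {c : Fin 4} {b : B}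
    (hS : ∀ v ∈ S, v.1 = b → flip c v ∈ S) (s : Fin 4) :
    setVec S (flip c (b, s)) = setVec S (b, s) :=
  setVec_congr (fun h => hS _ h rfl) fun h => by simpa using hS _ h rfl

/-- The four vertices of two parallel propagators. -/
theorem pair_closed {j k : Fin 4} {v : B × Fin 4} (hloop : ∀ v, (G.propagator v).1 ≠ v.1)
    (hv : G.propagator (flip j v) = flip k (G.propagator v)) :
    let S : Set (B × Fin 4) := {v, flip j v, G.propagator v, flip k (G.propagator v)}
    (∀ x ∈ S, G.propagator x ∈ S) ∧ (∀ x ∈ S, x.1 = v.1 → flip j x ∈ S) ∧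
      (∀ x ∈ S, x.1 ≠ v.1 → flip k x ∈ S) ∧ (∀ c, flip c v ≠ v → flip c v ≠ flip j v →
        flip c v ∉ S) := by
  have hv' : G.propagator (flip k (G.propagator v)) = flip j v := by rw [← hv]; simp
  have hl := hloop v
  refine ⟨?_, ?_, ?_, ?_⟩
  · rintro x (rfl | rfl | rfl | rfl) <;> simp [hv, hv']
  · rintro x (rfl | rfl | rfl | rfl) hx
    · simp
    · simp
    · exact absurd hx hl
    · exact absurd hx hl
  · rintro x (rfl | rfl | rfl | rfl) hx
    · exact absurd rfl hx
    · exact absurd rfl hx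
    · simp
    · simp
  · rintro c h1 h2 (h | h | h | h)
    · exact h1 h
    · exact h2 h
    · exact hl (by rw [← h]; rfl)
    · exact hl (by rw [← flip_fst k, ← h]; rfl)

section

variable [Fintype B]

/-- A bounding cycle that turns around a face of colour `j` at the bubble of `v₁` and around faces
of colour `k` at all its other bubbles is disconnected from the rest by its two propagators
at `v₁`. -/
theorem IsTwoPI.false_of_turning (hG : G.IsTwoPI) (hloop : ∀ v, (G.propagator v).1 ≠ v.1)
    {i j k : Fin 4} (h : IsColorTriple i j k) (hb : G.EvenCyclesBound j k)
    {S : Set (B × Fin 4)} {v₁ : B × Fin 4} (hS : ∀ v ∈ S, G.propagator v ∈ S)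
    (hj : ∀ v ∈ S, v.1 = v₁.1 → flip j v ∈ S) (hk : ∀ v ∈ S, v.1 ≠ v₁.1 → flip k v ∈ S)
    (h1 : v₁ ∈ S) (h2 : flip k v₁ ∉ S) : False := by
  classical
  have hjv : ∀ s, setVec S (flip j (v₁.1, s)) = setVec S (v₁.1, s) := setVec_flip hj
  have hkv : ∀ b ≠ v₁.1, ∀ s, setVec S (flip k (b, s)) = setVec S (b, s) := fun b hb =>
    setVec_flip fun v hv hvb => hk v hv (hvb ▸ hb)
  have hZ : setVec S ∈ G.cycleSpace := by
    refine ⟨setVec_mem hS, ?_⟩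
    ext b
    by_cases hbv : b = v₁.1
    · subst hbv; exact boundary_eq_zero_of_flip h.rotate hjv
    · exact boundary_eq_zero_of_flip h.rotate.rotate (hkv b hbv)
  have hI : inter j k (setVec S) (setVec S) = 0 := by
    refine Finset.sum_eq_zero fun b _ => ?_
    by_cases hbv : b = v₁.1
    · subst hbv; rw [cross_eq_zero_of_flip h.swap hjv, zero_mul]
    · rw [cross_eq_zero_of_flip h (hkv b hbv), mul_zero]
  -- `u` and `w` colour the faces of colours `j` and `k` by the two sides of the cycle: across a
  -- propagator the two colours differ exactly when it belongs to the cycle.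
  obtain ⟨u, hu, w, hw, huw⟩ := Submodule.mem_sup.1 (hb _ hZ hI)
  have huw' : ∀ v, setVec S v = u v + w v := fun v => by rw [← huw]; rfl
  have huS : ∀ v ∉ S, u v = w v := by
    intro v hv
    have := huw' v
    rw [setVec_eq_zero hv] at this
    generalize u v = a at *
    generalize w v = c at *
    clear huw huw'
    revert a c; decide
  have huS' : ∀ v ∈ S, u v ≠ w v := by
    intro v hv
    have := huw' v
    rw [setVec_eq_one hv] at this
    generalize u v = a at *
    generalize w v = c at *
    clear huw huw'
    revert a c; decide
  have hconst : ∀ (z : B × Fin 4 → ZMod 2) (b : B), (∀ s, z (flip j (b, s)) = z (b, s)) →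
      (∀ s, z (flip k (b, s)) = z (b, s)) → ∀ v, v.1 = b → z v = z (b, 0) := by
    intro z b hzj hzk v hv
    rcases eq_cases_of_fst_eq h (v := (b, 0)) (w := v) hv with h' | h' | h' | h' <;> rw [h']
    · rw [← flip_comp h.rotate, show flip k (b, (0 : Fin 4)) = (b, k) by
        simp [flip, tetrahedron_zero], hzj, ← hzk 0]
      simp [flip, tetrahedron_zero]
    · exact hzj 0
    · exact hzk 0
  -- Where the cycle turns around faces of colour `j`, the faces of colour `k` all lie on one side;
  -- at the other bubbles the same holds for the faces of colour `j`.
  have hwX : ∀ v, v.1 = v₁.1 → w v = w (v₁.1, 0) := by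
    apply hconst w
    · intro s
      have e1 := hjv s
      rw [huw', huw', hu.2] at e1
      exact add_left_cancel e1
    · intro s; exact hw.2 _
  have huX : ∀ b ≠ v₁.1, ∀ v, v.1 = b → u v = u (b, 0) := by
    intro b hb
    apply hconst u
    · intro s; exact hu.2 _
    · intro s
      have e1 := hkv b hb s
      rw [huw', huw', hw.2] at e1
      exact add_right_cancel e1
  -- The side of a bubble once it is pushed off the cycle: towards the faces of colour `k` at `v₁`,
  -- of colour `j` elsewhere. Only the two propagators of the cycle at `v₁` can change it.
  let q : B → ZMod 2 := fun b => if b = v₁.1 then w (b, 0) else u (b, 0)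
  have hqX : ∀ v, v.1 = v₁.1 → q v.1 = w v := by
    intro v hv; simp only [q, hv, if_true]; exact (hwX v hv).symm
  have hqu : ∀ v, v.1 ≠ v₁.1 → q v.1 = u v := by
    intro v hv; simp only [q, hv, if_false]; exact (huX v.1 hv v rfl).symm
  have hq0 : ∀ v ∉ S, q v.1 = u v := by
    intro v hv
    by_cases hvX : v.1 = v₁.1
    · rw [hqX v hvX, huS v hv]
    · exact hqu v hvX
  have hSX : ∀ v ∈ S, v.1 = v₁.1 → v = v₁ ∨ v = flip j v₁ := by
    intro v hv hvX
    rcases eq_cases_of_fst_eq h hvX with h' | h' | h' | h'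
    · exact Or.inl h'
    · exfalso; apply h2
      have := hj v hv hvX
      rwa [h', flip_comp h.rotate.swap] at this
    · exact Or.inr h'
    · exact absurd (h' ▸ hv) h2
  have hall := hG.forall_of_cut (v₁ := v₁) (v₂ := flip j v₁) (flip_ne h.ne₂ v₁).symm
    (fun he => hloop (flip j v₁) (by rw [← he]; rfl)) (Q := fun b => q b = q v₁.1) (by
      intro v hv1 hv2 hv3 hv4 hq
      rw [← hq]
      by_cases hv : v ∈ S
      · have hvX : v.1 ≠ v₁.1 := by
          intro hvX
          rcases hSX v hv hvX with h' | h'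
          · exact hv1 h'
          · exact hv3 h'
        have hvX' : (G.propagator v).1 ≠ v₁.1 := by
          intro hvX
          rcases hSX _ (hS v hv) hvX with h' | h'
          · exact hv2 (by rw [← h']; simp)
          · exact hv4 (by rw [← h']; simp)
        rw [hqu _ hvX', hqu _ hvX, hu.1]
      · rw [hq0 v hv, hq0 _ (fun h => hv (by simpa using hS _ h)), hu.1]) rfl
      (G.propagator v₁).1
  rw [hqu _ (hloop v₁), hu.1, hqX v₁ rfl] at hall
  exact huS' _ h1 hall

/-- A cycle that goes straight through the bubble of `v₁` and turns around faces of colour `k` at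
all its other bubbles has odd self-intersection. -/
theorem inter_self_of_straight {i j k : Fin 4} (h : IsColorTriple i j k)
    {S : Set (B × Fin 4)} {v₁ : B × Fin 4} (hS : ∀ v ∈ S, G.propagator v ∈ S)
    (hi : ∀ v ∈ S, v.1 = v₁.1 → flip i v ∈ S) (hk : ∀ v ∈ S, v.1 ≠ v₁.1 → flip k v ∈ S)
    (h1 : v₁ ∈ S) (h2 : flip j v₁ ∉ S) :
    setVec S ∈ G.cycleSpace ∧ inter j k (setVec S) (setVec S) = 1 := by
  classical
  have hkv : ∀ b ≠ v₁.1, ∀ s, setVec S (flip k (b, s)) = setVec S (b, s) := fun b hb =>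
    setVec_flip fun v hv hvb => hk v hv (hvb ▸ hb)
  have hZ : setVec S ∈ G.cycleSpace := by
    refine ⟨setVec_mem hS, ?_⟩
    ext b
    by_cases hbv : b = v₁.1
    · subst hbv; exact boundary_eq_zero_of_flip h (setVec_flip hi)
    · exact boundary_eq_zero_of_flip h.rotate.rotate (hkv b hbv)
  refine ⟨hZ, ?_⟩
  have h3 : flip k v₁ ∉ S := by
    intro h3
    have := hi _ h3 rfl
    rw [flip_comp h.swap] at this
    exact h2 this
  rw [inter, Finset.sum_eq_single v₁.1]
  · rw [G.cross_eq h hZ, G.cross_eq h.swap hZ, setVec_eq_one h1, setVec_eq_zero h2,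
      setVec_eq_zero h3]
    rfl
  · intro b _ hb
    rw [cross_eq_zero_of_flip h (hkv b hb), mul_zero]
  · simp

/-- Two bubbles are joined by at most one propagator, as soon as this is known for pairs of
propagators that do not turn around the same face. -/
theorem IsTwoPIDipoleFreeOfDegreeThreeHalves.isSimple_of
    (hG : G.IsTwoPIDipoleFreeOfDegreeThreeHalves)
    (H : ∀ i j k, IsColorTriple i j k → ∀ v, G.propagator (flip j v) = flip k (G.propagator v) →
      False) : G.IsSimple := by
  refine ⟨hG.no_loop, fun v w hvw hpvw => ?_⟩
  by_contra hne
  have hcol : ∀ x y : B × Fin 4, x.1 = y.1 → x ≠ y → ∃ a, a ≠ 0 ∧ y = flip a x := by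
    intro x y hxy hne
    have h : IsColorTriple 1 2 3 := by decide
    rcases eq_cases_of_fst_eq h hxy.symm with h' | h' | h' | h'
    · exact absurd h'.symm hne
    · exact ⟨1, h.ne₁, h'⟩
    · exact ⟨2, h.ne₂, h'⟩
    · exact ⟨3, h.ne₃, h'⟩
  obtain ⟨a, ha, rfl⟩ := hcol v w hvw hne
  obtain ⟨a', ha', hpa⟩ := hcol _ _ hpvw fun h => hne (G.propagator_involutive.injective h)
  -- With the same colour at both ends the two propagators close a face of length at most two.
  by_cases haa : a = a'
  · subst haa
    have h1 := faceLength_le_of_iterate ha (v := v) (m := 2) two_pos (by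
      simp only [Function.iterate_succ, Function.iterate_zero, Function.comp, id]
      rw [step, step, ← hpa]; simp)
    have h2 := hG.three_le_faceLength ha (G.face a v)
    omega
  · have hex : ∀ a a' : Fin 4, a ≠ 0 → a' ≠ 0 → a ≠ a' → ∃ i, IsColorTriple i a a' := by decide
    obtain ⟨i, h⟩ := hex a a' ha ha' haa
    exact H i a a' h v hpa

/-- The graph is simple if all jackets are such that even cycles bound. -/
theorem IsTwoPIDipoleFreeOfDegreeThreeHalves.isSimple_of_evenCyclesBound
    (hG : G.IsTwoPIDipoleFreeOfDegreeThreeHalves)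
    (hb : ∀ i j k, IsColorTriple i j k → G.EvenCyclesBound j k) : G.IsSimple := by
  refine hG.isSimple_of fun i j k h v hv => ?_
  obtain ⟨h1, h2, h3, h4⟩ := pair_closed hG.no_loop hv
  exact hG.2.1.false_of_turning hG.no_loop h (hb i j k h) h1 h2 h3 (by simp)
    (h4 k (flip_ne h.ne₃ v) (flip_ne_flip h.rotate v).symm)

/-- The graph is simple if one of its jackets is planar. -/
theorem IsTwoPIDipoleFreeOfDegreeThreeHalves.isSimple_of_planar
    (hG : G.IsTwoPIDipoleFreeOfDegreeThreeHalves) {i j k : Fin 4} (h : IsColorTriple i j k)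
    (hF : Nat.card (G.Face j) + Nat.card (G.Face k) = Nat.card B + 2) : G.IsSimple := by
  have hb : G.EvenCyclesBound j k := fun x hx _ => G.cycleSpace_le_of_planar hG.1 h hF hx
  have hturn : ∀ {j k : Fin 4}, IsColorTriple i j k → G.EvenCyclesBound j k → ∀ v,
      G.propagator (flip j v) = flip k (G.propagator v) → False := by
    intro j k h hb v hv
    obtain ⟨h1, h2, h3, h4⟩ := pair_closed hG.no_loop hv
    exact hG.2.1.false_of_turning hG.no_loop h hb h1 h2 h3 (by simp)
      (h4 k (flip_ne h.ne₃ v) (flip_ne_flip h.rotate v).symm)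
  -- A pair of propagators that is straight at one bubble and turns at the other is a cycle of odd
  -- self-intersection, which a planar jacket does not have.
  have hstraight : ∀ {j k : Fin 4}, IsColorTriple i j k →
      Nat.card (G.Face j) + Nat.card (G.Face k) = Nat.card B + 2 → ∀ v,
      G.propagator (flip i v) = flip k (G.propagator v) → False := by
    intro j k h hF v hv
    obtain ⟨h1, h2, h3, h4⟩ := pair_closed hG.no_loop hv
    obtain ⟨hZ, hI⟩ := inter_self_of_straight h h1 h2 h3 (by simp)
      (h4 j (flip_ne h.ne₂ v) (flip_ne_flip h v).symm)
    rw [G.inter_eq_zero_of_planar hG.1 h hF hZ hZ] at hI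
    exact zero_ne_one hI
  refine hG.isSimple_of fun a c c' ht v hv => ?_
  have hv' : G.propagator (flip c' (G.propagator v)) = flip c (G.propagator (G.propagator v)) := by
    rw [← hv]; simp
  have hF' : Nat.card (G.Face k) + Nat.card (G.Face j) = Nat.card B + 2 := by omega
  have hcases : ∀ {i j k : Fin 4}, IsColorTriple i j k → ∀ a c c', IsColorTriple a c c' →
      (c = j ∧ c' = k) ∨ (c = k ∧ c' = j) ∨ (c = i ∧ c' = k) ∨ (c = i ∧ c' = j) ∨
      (c = j ∧ c' = i) ∨ (c = k ∧ c' = i) := by decide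
  rcases hcases h a c c' ht with ⟨rfl, rfl⟩ | ⟨rfl, rfl⟩ | ⟨rfl, rfl⟩ | ⟨rfl, rfl⟩ | ⟨rfl, rfl⟩ |
    ⟨rfl, rfl⟩
  · exact hturn h hb v hv
  · exact hturn h.swap hb.swap v hv
  · exact hstraight h hF v hv
  · exact hstraight h.swap hF' v hv
  · exact hstraight h.swap hF' _ hv'
  · exact hstraight h hF _ hv'

/-- A triangle of propagators that turns around faces of colours `j` or `k` at its three bubbles,
`j` at the first one, is a face of colour `j`. -/
theorem IsTwoPI.triangle (hG : G.IsTwoPI) (hs : G.IsSimple) {i j k : Fin 4}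
    (h : IsColorTriple i j k) (hb : G.EvenCyclesBound j k) {a g : B × Fin 4}
    (hg : g.1 = (G.propagator a).1) (hpg : (G.propagator g).1 = (G.propagator (flip j a)).1)
    (h1 : g ≠ G.propagator a) (h2 : g ≠ flip i (G.propagator a))
    (h3 : G.propagator g ≠ G.propagator (flip j a))
    (h4 : G.propagator g ≠ flip i (G.propagator (flip j a))) :
    G.propagator (flip j (G.propagator a)) = flip j (G.propagator (flip j a)) := by
  have hd1 := hs.1 a
  have hd2 : (G.propagator (flip j a)).1 ≠ a.1 := hs.1 (flip j a)
  have hd3 : (G.propagator a).1 ≠ (G.propagator (flip j a)).1 := fun he =>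
    flip_ne h.ne₂ a (hs.2 a (flip j a) rfl he).symm
  have hd4 := hd3.symm
  have hd5 := hd1.symm
  have hd6 := hd2.symm
  let S : Set (B × Fin 4) :=
    {a, flip j a, G.propagator a, G.propagator (flip j a), g, G.propagator g}
  have hS : ∀ x ∈ S, G.propagator x ∈ S := by
    rintro x (rfl | rfl | rfl | rfl | rfl | rfl) <;> simp [S]
  have hmem : ∀ x ∈ S, (x.1 = a.1 ∧ (x = a ∨ x = flip j a)) ∨
      (x.1 = (G.propagator a).1 ∧ (x = G.propagator a ∨ x = g)) ∨
      (x.1 = (G.propagator (flip j a)).1 ∧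
        (x = G.propagator (flip j a) ∨ x = G.propagator g)) := by
    rintro x (rfl | rfl | rfl | rfl | rfl | rfl) <;> simp [hg, hpg]
  have hj1 : ∀ x ∈ S, x.1 = a.1 → flip j x ∈ S := by
    intro x hx hxa
    rcases hmem x hx with ⟨e, rfl | rfl⟩ | ⟨e, -⟩ | ⟨e, -⟩
    · simp [S]
    · simp [S]
    · exact absurd (e.symm.trans hxa) hd1
    · exact absurd (e.symm.trans hxa) hd2
  have h2' : ∀ c, (g = flip c (G.propagator a)) →
      ∀ x ∈ S, x.1 = (G.propagator a).1 → flip c x ∈ S := by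
    intro c hc x hx hxa
    rcases hmem x hx with ⟨e, -⟩ | ⟨e, rfl | rfl⟩ | ⟨e, -⟩
    · exact absurd (e.symm.trans hxa) hd5
    · rw [← hc]; simp [S]
    · rw [hc, flip_flip]; simp [S]
    · exact absurd (e.symm.trans hxa) hd4
  have h3' : ∀ c, (G.propagator g = flip c (G.propagator (flip j a))) →
      ∀ x ∈ S, x.1 = (G.propagator (flip j a)).1 → flip c x ∈ S := by
    intro c hc x hx hxa
    rcases hmem x hx with ⟨e, -⟩ | ⟨e, -⟩ | ⟨e, rfl | rfl⟩
    · exact absurd (e.symm.trans hxa) hd6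
    · exact absurd (e.symm.trans hxa) hd3
    · rw [← hc]; simp [S]
    · rw [hc, flip_flip]; simp [S]
  have hfst : ∀ x ∈ S, x.1 = a.1 ∨ x.1 = (G.propagator a).1 ∨
      x.1 = (G.propagator (flip j a)).1 := by
    intro x hx
    rcases hmem x hx with ⟨e, -⟩ | ⟨e, -⟩ | ⟨e, -⟩ <;> simp [e]
  have n1 : flip k a ∉ S := by
    intro hx
    rcases hmem _ hx with ⟨-, e | e⟩ | ⟨e, -⟩ | ⟨e, -⟩
    · exact flip_ne h.ne₃ a e
    · exact flip_ne_flip h.rotate a e.symm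
    · exact hd5 e
    · exact hd6 e
  -- Unless all three turns have colour `j`, exactly one of them differs from the other two;
  -- `false_of_turning` applies with that bubble as the exceptional one.
  rcases eq_cases_of_fst_eq h hg with e | e | hgj | hgk
  · exact absurd e h1
  · exact absurd e h2
  · rcases eq_cases_of_fst_eq h hpg with e | e | hpj | hpk
    · exact absurd e h3
    · exact absurd e h4
    · rw [← hgj, hpj]
    · exfalso
      refine hG.false_of_turning hs.1 h.swap hb.swap (v₁ := G.propagator (flip j a)) hS
        (h3' k hpk) ?_ (by simp [S]) ?_
      · intro x hx hne
        rcases hfst x hx with e | e | e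
        · exact hj1 x hx e
        · exact h2' j hgj x hx e
        · exact absurd e hne
      · intro hx
        rcases hmem _ hx with ⟨e, -⟩ | ⟨e, -⟩ | ⟨-, e | e⟩
        · exact hd2 e
        · exact hd4 e
        · exact flip_ne h.ne₂ _ e
        · rw [hpk] at e; exact flip_ne_flip h.rotate _ e
  · rcases eq_cases_of_fst_eq h hpg with e | e | hpj | hpk
    · exact absurd e h3
    · exact absurd e h4
    · exfalso
      refine hG.false_of_turning hs.1 h.swap hb.swap (v₁ := G.propagator a) hS
        (h2' k hgk) ?_ (by simp [S]) ?_
      · intro x hx hne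
        rcases hfst x hx with e | e | e
        · exact hj1 x hx e
        · exact absurd e hne
        · exact h3' j hpj x hx e
      · intro hx
        rcases hmem _ hx with ⟨e, -⟩ | ⟨-, e | e⟩ | ⟨e, -⟩
        · exact hd1 e
        · exact flip_ne h.ne₂ _ e
        · rw [hgk] at e; exact flip_ne_flip h.rotate _ e
        · exact hd3 e
    · exfalso
      refine hG.false_of_turning hs.1 h hb (v₁ := a) hS hj1 ?_ (by simp [S]) n1
      intro x hx hne
      rcases hfst x hx with e | e | e
      · exact absurd e hne
      · exact h2' k hgk x hx e
      · exact h3' k hpk x hx e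

end

end ONGraph

/-! ### No jacket is planar -/

namespace ONGraph

variable {B : Type*} {G : ONGraph B}

/-- Both faces of colour `i` at the bubble of `v` are known from `v` and its `j`-neighbour. -/
theorem forall_face_of {i j k : Fin 4} (h : IsColorTriple i j k) {Q : G.Face i → Prop}
    {v : B × Fin 4} (h1 : Q (G.face i v)) (h2 : Q (G.face i (flip j v))) {w : B × Fin 4}
    (hw : w.1 = v.1) : Q (G.face i w) := by
  rcases eq_cases_of_fst_eq h hw with h' | h' | h' | h' <;> rw [h']
  · exact h1
  · rwa [face_flip _ h.ne₁]
  · exact h2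
  · rwa [← flip_comp h, face_flip _ h.ne₁]

theorem face_flip_third {i j k : Fin 4} (h : IsColorTriple i j k) (v : B × Fin 4) :
    G.face i (flip k v) = G.face i (flip j v) := by
  rw [← flip_comp h, face_flip _ h.ne₁]

theorem exists_iterate_fst [Finite B] {i : Fin 4} (hi : i ≠ 0) {v w : B × Fin 4}
    (h : G.face i w = G.face i v) :
    ∃ m < G.faceLength (G.face i v), ((G.step i)^[m] v = w ∨ (G.step i)^[m] v = flip i w) ∧
      w.1 = ((G.step i)^[m] v).1 := by
  obtain ⟨m, hm, hm'⟩ := (G.face_eq_iff' hi).1 h.symm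
  rw [← faceLength_face _ hi] at hm
  exact ⟨m, hm, hm', by rcases hm' with h | h <;> rw [h]; rfl⟩

/-- If two consecutive bubbles `v`, `step i v` of a face of colour `i` are both crossed by a face
of length four, then they are opposite on the latter. -/
theorem IsSimple.opposite [Finite B] (hs : G.IsSimple) {i j k : Fin 4} (h : IsColorTriple i j k)
    {v : B × Fin 4} (h1 : G.face i (flip j (G.step i v)) = G.face i (flip j v))
    (h2 : G.faceLength (G.face i (flip j v)) = 4) (h3 : G.face i (flip j v) ≠ G.face i v) :
    ((G.step i)^[2] (flip j v)).1 = (G.step i v).1 := by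
  obtain ⟨m, hm, -, hm'⟩ := exists_iterate_fst h.ne₁ h1
  have hper := G.iterate_faceLength h.ne₁ (flip j v)
  rw [h2] at hm hper
  -- At positions 1 and 3 of the face of length four the bubble is next to the start, so simplicity
  -- makes two propagators coincide. At position 3 this identifies the two faces.
  interval_cases m
  · exact absurd hm' (hs.step_fst_ne i v)
  · exfalso
    refine flip_ne h.ne₂ v (hs.2 _ _ rfl ?_)
    exact hm'.symm
  · exact hm'.symm
  · exfalso
    have e : (G.step i)^[3] (flip j v) = flip i (G.step i v) := by
      refine hs.2 _ _ hm'.symm ?_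
      rw [propagator_flip_step]
      have e1 : (G.step i ((G.step i)^[3] (flip j v))).1 = (flip j v).1 := congrArg Prod.fst hper
      exact e1
    apply h3
    rw [← G.face_iterate h.ne₁ 3, e, face_flip _ h.ne₁, face_step _ h.ne₁]

section

variable [Fintype B]

theorem IsTwoPIDipoleFreeOfDegreeThreeHalves.three_mul_card_face_le
    (hG : G.IsTwoPIDipoleFreeOfDegreeThreeHalves) {i : Fin 4} (hi : i ≠ 0) :
    3 * Nat.card (G.Face i) ≤ 2 * Nat.card B := by
  have := Fintype.ofFinite (G.Face i)
  rw [← G.sum_faceLength (i := i), Nat.card_eq_fintype_card, mul_comm, ← smul_eq_mul]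
  exact Finset.card_nsmul_le_sum _ _ _ fun f _ => hG.three_le_faceLength hi f

/-- If the faces of colour `i` cross each other evenly and do not cross themselves, then the
number of bubbles is even. -/
theorem even_card_of_inter_eq_zero {i j k : Fin 4} (h : IsColorTriple i j k)
    (hI : ∀ f g : G.Face i, inter j k (G.faceVec f) (G.faceVec g) = 0)
    (hself : ∀ v, G.face i v ≠ G.face i (flip j v)) : Even (Nat.card B) := by
  classical
  have := Fintype.ofFinite (G.Face i)
  -- The bubbles are sorted by the unordered pair of faces that cross there. The size of each class
  -- is an intersection number modulo two, and classes of equal faces are empty.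
  rw [Nat.card_eq_fintype_card, ← Finset.card_univ,
    Finset.card_eq_sum_card_fiberwise
      (f := fun b : B => s(G.face i (b, 0), G.face i (flip j (b, 0))))
      (t := Finset.univ) (by simp)]
  refine Finset.even_sum _ fun e _ => ?_
  induction e with
  | _ f g =>
    by_cases hfg : f = g
    · subst hfg
      rw [Finset.filter_false_of_mem]
      · simp
      · intro b _ hb
        rcases Sym2.eq_iff.1 hb with ⟨h1, h2⟩ | ⟨h1, h2⟩ <;>
          exact hself (b, 0) (h1.trans h2.symm)
    rw [← ZMod.natCast_eq_zero_iff_even, ← hI f g, Finset.card_filter, Nat.cast_sum]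
    refine Finset.sum_congr rfl fun b _ => ?_
    rw [G.cross_faceVec_swap h, G.cross_faceVec h f (b, 0), G.cross_faceVec h g (b, 0)]
    have hb := hself (b, 0)
    simp only [faceVec, Sym2.eq_iff]
    generalize G.face i (b, 0) = p at *
    generalize G.face i (flip j (b, 0)) = q at *
    clear hI
    by_cases h1 : p = f <;> by_cases h2 : q = g <;> by_cases h3 : p = g <;> by_cases h4 : q = f
    all_goals subst_vars
    all_goals simp_all

/-- Here `2 F_i = n - 1` and all lengths are even, so one face `K` of colour `i` has length six and
the others have length four. As `n` is odd, some face crosses itself; only `K` can, at opposite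
positions, which pinches it into two closed curves. Even crossing numbers then produce a face `f` of
length four all of whose bubbles lie on `K`, and `K`, `f` exhaust the graph. Thus `F_i ≤ 2` and `n ≤
5`, whereas `n + 2 = F_j + F_k ≤ 4n / 3` requires `n ≥ 6`. -/
theorem IsTwoPIDipoleFreeOfDegreeThreeHalves.not_planar
    (hG : G.IsTwoPIDipoleFreeOfDegreeThreeHalves) {i j k : Fin 4} (h : IsColorTriple i j k)
    (hF : Nat.card (G.Face j) + Nat.card (G.Face k) = Nat.card B + 2) : False := by
  classical
  have hs := hG.isSimple_of_planar h hF
  have hdeg := (G.degree_eq_three_halves_iff h).1 hG.2.2.2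
  have hi := h.ne₁
  have hI : ∀ x ∈ G.cycleSpace, ∀ y ∈ G.cycleSpace, inter j k x y = 0 :=
    fun x hx y hy => G.inter_eq_zero_of_planar hG.1 h hF hx hy
  have hZ := fun f : G.Face i => G.faceVec_mem_cycleSpace hi f
  have hW : ∀ {a b : B × Fin 4} {m l : ℕ},
      ((a.1 = b.1 ∧ ((G.step i)^[m] a).1 = ((G.step i)^[l] b).1) ∨
      (a.1 = ((G.step i)^[l] b).1 ∧ b.1 = ((G.step i)^[m] a).1)) → ∀ f : G.Face i,
      cross k (G.faceVec f) a.1 = 0 → cross k (G.faceVec f) ((G.step i)^[m] a).1 = 0 →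
      ∑ t ∈ Finset.range m, cross k (G.faceVec f) ((G.step i)^[t + 1] a).1 +
      ∑ t ∈ Finset.range l, cross k (G.faceVec f) ((G.step i)^[t + 1] b).1 = 0 :=
    fun hab f h1 h2 => G.sum_cross_eq_zero h (d := 0) (fun x hx _ y hy => hI x hx y hy) hab
      (fun _ _ => cross_zero _ _) (fun _ _ => cross_zero _ _) (hZ f) h1 h2
  -- the lengths of the faces of colour `i`
  have := Fintype.ofFinite (G.Face i)
  have hev : ∀ f : G.Face i, Even (G.faceLength f) := fun f =>
    (G.faceLength_even_iff h f).2 (hI _ (hZ f) _ (hZ f))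
  have hge : ∀ f : G.Face i, 4 ≤ G.faceLength f := by
    intro f
    have h1 := hG.three_le_faceLength hi f
    obtain ⟨r, hr⟩ := hev f
    omega
  -- The lengths add up to `2n = 4 F_i + 2`.
  have hsum : ∑ f : G.Face i, (G.faceLength f - 4) = 2 := by
    have h1 := G.sum_faceLength (i := i)
    have h2 : ∑ f : G.Face i, G.faceLength f =
        ∑ f : G.Face i, (G.faceLength f - 4) + Nat.card (G.Face i) * 4 := by
      rw [Nat.card_eq_fintype_card, ← Finset.card_univ, ← smul_eq_mul, ← Finset.sum_const,
        ← Finset.sum_add_distrib]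
      exact Finset.sum_congr rfl fun f _ => by have := hge f; omega
    omega
  have hlen : ∀ f : G.Face i, G.faceLength f = 4 ∨ G.faceLength f = 6 := by
    intro f
    have h1 := Finset.single_le_sum (f := fun f : G.Face i => G.faceLength f - 4)
      (fun _ _ => Nat.zero_le _) (Finset.mem_univ f)
    have h2 := hge f
    obtain ⟨r, hr⟩ := hev f
    omega
  have huniq : ∀ f g : G.Face i, G.faceLength f = 6 → G.faceLength g = 6 → f = g := by
    intro f g hf hg
    by_contra hfg
    have h1 := Finset.sum_le_sum_of_subset (f := fun f : G.Face i => G.faceLength f - 4)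
      (Finset.subset_univ {f, g})
    rw [Finset.sum_pair hfg] at h1
    omega
  -- a face that crosses itself has length six
  have hself : ∀ v, G.face i (flip j v) = G.face i v →
      G.faceLength (G.face i v) = 6 ∧ ((G.step i)^[3] v).1 = v.1 := by
    intro v hv
    obtain ⟨m, hm, hm1, hm2⟩ := exists_iterate_fst hi hv
    have hper := G.iterate_faceLength hi v
    have hm0 : m ≠ 0 := by
      rintro rfl
      rcases hm1 with h' | h'
      · exact flip_ne h.ne₂ v h'.symm
      · rw [flip_comp h] at h'; exact flip_ne h.ne₃ v h'.symm
    have hm1 : m ≠ 1 := by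
      rintro rfl; exact hs.step_fst_ne i v hm2.symm
    have hm3 : m ≠ 2 := by
      rintro rfl; exact hs.step_step_fst_ne hi v hm2.symm
    have hback : ∀ r, G.faceLength (G.face i v) = r + m →
        ((G.step i)^[r] ((G.step i)^[m] v)).1 = ((G.step i)^[m] v).1 := by
      intro r hr
      rw [← Function.iterate_add_apply, ← hr, hper]
      exact hm2
    have hb1 : G.faceLength (G.face i v) ≠ 1 + m := fun hr =>
      hs.step_fst_ne i _ (hback 1 hr)
    have hb2 : G.faceLength (G.face i v) ≠ 2 + m := fun hr =>
      hs.step_step_fst_ne hi _ (hback 2 hr)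
    rcases hlen (G.face i v) with hl | hl
    · omega
    · refine ⟨hl, ?_⟩
      obtain rfl : m = 3 := by omega
      exact hm2.symm
  obtain ⟨v, hv⟩ : ∃ v, G.face i (flip j v) = G.face i v := by
    by_contra hne
    push Not at hne
    obtain ⟨r, hr⟩ := even_card_of_inter_eq_zero h (fun f g => hI _ (hZ f) _ (hZ g))
      fun v => (hne v).symm
    omega
  obtain ⟨hK, hv3⟩ := hself v hv
  have hper := G.iterate_faceLength hi v
  rw [hK] at hper
  have hface : ∀ m, G.face i ((G.step i)^[m] v) = G.face i v := fun m => G.face_iterate hi m v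
  have hinj : ∀ {l m : ℕ}, l < 6 → m < 6 → (G.step i)^[l] v = (G.step i)^[m] v → l = m := by
    intro l m hl hm
    rw [← hK, faceLength_face _ hi] at hl hm
    exact G.iterate_injOn i v hl hm
  -- A second self-crossing at positions 1 and 4, or 2 and 5, would double a propagator next to the
  -- self-crossing at positions 0 and 3.
  have hns1 : ((G.step i)^[4] v).1 ≠ ((G.step i)^[1] v).1 := fun he =>
    absurd (hinj (l := 3) (m := 0) (by omega) (by omega) (hs.2 _ _ hv3 he)) (by omega)
  have hns2 : ((G.step i)^[5] v).1 ≠ ((G.step i)^[2] v).1 := fun he =>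
    absurd (hinj (l := 5) (m := 2) (by omega) (by omega) (hs.2 _ _ he (by
      have e1 : (G.step i ((G.step i)^[5] v)).1 = v.1 := congrArg Prod.fst hper
      exact e1.trans hv3.symm))) (by omega)
  have hne1 : G.face i (flip j ((G.step i)^[1] v)) ≠ G.face i v := fun he =>
    hns1 (hself ((G.step i)^[1] v) (he.trans (hface 1).symm)).2
  have hne2 : G.face i (flip j ((G.step i)^[2] v)) ≠ G.face i v := fun he =>
    hns2 (hself ((G.step i)^[2] v) (he.trans (hface 2).symm)).2
  -- the face that crosses at the first bubble
  set v₁ := (G.step i)^[1] v with hv₁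
  set v₂ := (G.step i)^[2] v with hv₂
  have hv12 : G.step i v₁ = v₂ := rfl
  set y := flip j v₁ with hy
  set f := G.face i y with hf
  have hf4 : G.faceLength f = 4 := (hlen f).resolve_right fun h6 => hne1 (huniq _ _ h6 hK)
  have hc1 : cross k (G.faceVec f) v₁.1 = 1 :=
    G.cross_faceVec_eq_one h (by rw [hface 1]; exact hne1.symm) rfl
  have hc0 : cross k (G.faceVec f) v.1 = 0 :=
    G.cross_faceVec_eq_zero h hne1.symm (by rw [hv]; exact hne1.symm)
  -- The first three propagators of the long face form a closed curve; having crossed it at `v₁`,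
  -- `f` can cross it a second time only at `v₂`.
  have hf2 : G.face i (flip j v₂) = f := by
    by_contra hne
    have h1 := hW (a := v) (b := v) (m := 3) (l := 0) (Or.inl ⟨rfl, hv3⟩) f hc0
      (by rw [hv3]; exact hc0)
    have h2 : cross k (G.faceVec f) v₂.1 = 0 :=
      G.cross_faceVec_eq_zero h (by rw [hface 2]; exact hne1.symm) hne
    simp only [Finset.sum_range_succ, Finset.sum_range_zero, zero_add, add_zero] at h1
    rw [← hv₁, show (G.step i)^[1 + 1] v = v₂ from rfl,
      show (G.step i)^[2 + 1] v = (G.step i)^[3] v from rfl, hv3, hc0, hc1, h2] at h1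
    exact absurd h1 (by decide)
  have hopp : ((G.step i)^[2] y).1 = v₂.1 :=
    hs.opposite h (v := v₁) hf2 hf4 (by rw [hface 1]; exact hne1)
  have hyper := G.iterate_faceLength hi y
  rw [← hf, hf4] at hyper
  have hyface : ∀ m, G.face i ((G.step i)^[m] y) = f := fun m => G.face_iterate hi m y
  have hQ1 : ∀ {w : B × Fin 4}, w.1 = v₁.1 → G.face i w = G.face i v ∨ G.face i w = f := fun hw =>
    forall_face_of h (Q := fun g => g = G.face i v ∨ g = f) (Or.inl (hface 1)) (Or.inr rfl) hw
  have hQ2 : ∀ {w : B × Fin 4}, w.1 = v₂.1 → G.face i w = G.face i v ∨ G.face i w = f := fun hw =>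
    forall_face_of h (Q := fun g => g = G.face i v ∨ g = f) (Or.inl (hface 2)) (Or.inr hf2) hw
  have hQ0 : ∀ {w : B × Fin 4}, w.1 = v.1 → G.face i w = G.face i v := fun hw =>
    forall_face_of h (Q := fun g => g = G.face i v) rfl hv hw
  -- both remaining bubbles of that face lie on the face of length six
  have hfself : ∀ m, G.face i (flip j ((G.step i)^[m] y)) ≠ f := by
    intro m he
    have := (hself _ (he.trans (hyface m).symm)).1
    rw [hyface m] at this
    omega
  have hcz : ∀ {g : G.Face i} {w : B × Fin 4}, g ≠ G.face i v → g ≠ f →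
      (∀ {u : B × Fin 4}, u.1 = w.1 → G.face i u = G.face i v ∨ G.face i u = f) →
      cross k (G.faceVec g) w.1 = 0 := by
    intro g w h1 h2 hQ
    refine G.cross_faceVec_eq_zero h ?_ ?_
    · rcases hQ (u := w) rfl with e | e <;> rw [e]
      · exact h1.symm
      · exact h2.symm
    · rcases hQ (u := flip j w) rfl with e | e <;> rw [e]
      · exact h1.symm
      · exact h2.symm
  -- The propagator from `v₁` to `v₂` and half of `f` form a closed curve. A third face through the
  -- middle bubble of that half would cross it exactly once.
  have hy1 : G.face i (flip j ((G.step i)^[1] y)) = G.face i v := by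
    by_contra hne
    have c1 := hcz hne (hfself 1) hQ1
    have c2 := hcz hne (hfself 1) hQ2
    have h1 := hW (a := v₁) (b := y) (m := 1) (l := 2) (Or.inl ⟨rfl, hopp.symm⟩) _ c1 c2
    simp only [Finset.sum_range_succ, Finset.sum_range_zero, zero_add] at h1
    rw [show (G.step i)^[1] v₁ = v₂ from rfl, show (G.step i)^[1 + 1] y = (G.step i)^[2] y from rfl,
      hopp, c2, G.cross_faceVec_eq_one h (by rw [hyface 1]; exact (hfself 1).symm) rfl] at h1
    exact absurd h1 (by decide)
  have hy3 : G.face i (flip j ((G.step i)^[3] y)) = G.face i v := by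
    by_contra hne
    have c1 := hcz hne (hfself 3) hQ1
    have c2 := hcz hne (hfself 3) hQ2
    have e4 : (G.step i)^[2] ((G.step i)^[2] y) = y := hyper
    have h1 := hW (a := v₁) (b := (G.step i)^[2] y) (m := 1) (l := 2)
      (Or.inr ⟨by rw [e4]; rfl, hopp⟩) _ c1 c2
    simp only [Finset.sum_range_succ, Finset.sum_range_zero, zero_add] at h1
    rw [show (G.step i)^[1] v₁ = v₂ from rfl, e4, show y.1 = v₁.1 from rfl,
      show (G.step i)^[1] ((G.step i)^[2] y) = (G.step i)^[3] y from rfl,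
      c1, c2, G.cross_faceVec_eq_one h (by rw [hyface 3]; exact (hfself 3).symm) rfl] at h1
    exact absurd h1 (by decide)
  have hQy1 : ∀ {w : B × Fin 4}, w.1 = ((G.step i)^[1] y).1 →
      G.face i w = G.face i v ∨ G.face i w = f := fun hw =>
    forall_face_of h (Q := fun g => g = G.face i v ∨ g = f) (Or.inr (hyface 1)) (Or.inl hy1) hw
  have hQy3 : ∀ {w : B × Fin 4}, w.1 = ((G.step i)^[3] y).1 →
      G.face i w = G.face i v ∨ G.face i w = f := fun hw =>
    forall_face_of h (Q := fun g => g = G.face i v ∨ g = f) (Or.inr (hyface 3)) (Or.inl hy3) hw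
  -- Positions 0 and 3 of the long face are its self-crossing, where `f` does not pass, and 1 and 2
  -- are `v₁` and `v₂`; only 4 and 5 remain.
  have hpos : ∀ {w : B × Fin 4}, G.face i w = f → G.face i (flip j w) = G.face i v →
      w.1 ≠ v₁.1 → w.1 ≠ v₂.1 → w.1 = ((G.step i)^[4] v).1 ∨ w.1 = ((G.step i)^[5] v).1 := by
    intro w hw1 hw2 n1 n2
    obtain ⟨m, hm, -, hm'⟩ := exists_iterate_fst hi hw2
    rw [hK] at hm
    rw [flip_fst] at hm'
    interval_cases m
    · exact absurd (hw1.symm.trans (hQ0 hm')) hne1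
    · exact absurd hm' n1
    · exact absurd hm' n2
    · exact absurd (hw1.symm.trans (hQ0 (hm'.trans hv3))) hne1
    · exact Or.inl hm'
    · exact Or.inr hm'
  have p1 := hpos (hyface 1) hy1 (hs.step_fst_ne i y) (by
    rw [← hopp]; exact (hs.step_fst_ne i _).symm)
  have e34 : G.step i ((G.step i)^[3] y) = y := hyper
  have p3 := hpos (hyface 3) hy3 (by
      have := hs.step_fst_ne i ((G.step i)^[3] y)
      rw [e34] at this
      exact this.symm) (by rw [← hopp]; exact hs.step_fst_ne i ((G.step i)^[2] y))
  have p13 : ((G.step i)^[3] y).1 ≠ ((G.step i)^[1] y).1 :=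
    hs.step_step_fst_ne hi ((G.step i)^[1] y)
  have hQ45 : (∀ {w : B × Fin 4}, w.1 = ((G.step i)^[4] v).1 →
      G.face i w = G.face i v ∨ G.face i w = f) ∧ (∀ {w : B × Fin 4},
      w.1 = ((G.step i)^[5] v).1 → G.face i w = G.face i v ∨ G.face i w = f) := by
    rcases p1 with p1 | p1 <;> rcases p3 with p3 | p3
    · exact absurd (p3.trans p1.symm) p13
    · exact ⟨fun hw => hQy1 (hw.trans p1.symm), fun hw => hQy3 (hw.trans p3.symm)⟩
    · exact ⟨fun hw => hQy3 (hw.trans p3.symm), fun hw => hQy1 (hw.trans p1.symm)⟩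
    · exact absurd (p3.trans p1.symm) p13
  have hall := G.forall_of_connected hG.1
    (Q := fun b => ∀ s, G.face i (b, s) = G.face i v ∨ G.face i (b, s) = f) (by
      intro x hx s
      have hx' := hx x.2
      rw [Prod.mk.eta, ← face_propagator] at hx'
      rcases hx' with e | e
      · obtain ⟨m, hm, -, hm'⟩ := exists_iterate_fst hi e
        rw [hK] at hm
        interval_cases m
        · exact Or.inl (hQ0 hm')
        · exact hQ1 hm'
        · exact hQ2 hm'
        · exact Or.inl (hQ0 (hm'.trans hv3))
        · exact hQ45.1 hm'
        · exact hQ45.2 hm'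
      · obtain ⟨m, hm, -, hm'⟩ := exists_iterate_fst hi (v := y) e
        rw [← hf, hf4] at hm
        interval_cases m
        · exact hQ1 hm'
        · exact hQy1 hm'
        · exact hQ2 (hm'.trans hopp)
        · exact hQy3 hm') (b := v₁.1) (fun s => hQ1 rfl)
  have hcard : Nat.card (G.Face i) ≤ 2 := by
    rw [Nat.card_eq_fintype_card, ← Finset.card_univ]
    refine (Finset.card_le_card (t := {G.face i v, f}) fun g _ => ?_).trans Finset.card_le_two
    obtain ⟨w, rfl⟩ := G.face_surjective i g
    simpa using hall w.1 w.2
  have h1 := hG.three_mul_card_face_le h.ne₂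
  have h2 := hG.three_mul_card_face_le h.ne₃
  omega

end

end ONGraph

/-! ### Odd faces in a projective jacket -/

namespace ONGraph

variable {B : Type*} {G : ONGraph B}

/-- In a simple graph, a face of length at most five does not cross itself. -/
theorem IsSimple.face_flip_ne [Finite B] (hs : G.IsSimple) {i j k : Fin 4}
    (h : IsColorTriple i j k) {v : B × Fin 4} (hl : G.faceLength (G.face i v) ≤ 5) :
    G.face i (flip j v) ≠ G.face i v := by
  intro hv
  obtain ⟨m, hm, hm1, hm2⟩ := exists_iterate_fst h.ne₁ hv
  have hper := G.iterate_faceLength h.ne₁ v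
  have hm0 : m ≠ 0 := by
    rintro rfl
    rcases hm1 with h' | h'
    · exact flip_ne h.ne₂ v h'.symm
    · rw [flip_comp h] at h'; exact flip_ne h.ne₃ v h'.symm
  have hm1 : m ≠ 1 := by
    rintro rfl; exact hs.step_fst_ne i v hm2.symm
  have hm3 : m ≠ 2 := by
    rintro rfl; exact hs.step_step_fst_ne h.ne₁ v hm2.symm
  have hback : ∀ r, G.faceLength (G.face i v) = r + m →
      ((G.step i)^[r] ((G.step i)^[m] v)).1 = ((G.step i)^[m] v).1 := by
    intro r hr
    rw [← Function.iterate_add_apply, ← hr, hper]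
    exact hm2
  have hb1 : G.faceLength (G.face i v) ≠ 1 + m := fun hr =>
    hs.step_fst_ne i _ (hback 1 hr)
  have hb2 : G.faceLength (G.face i v) ≠ 2 + m := fun hr =>
    hs.step_step_fst_ne h.ne₁ _ (hback 2 hr)
  omega

/-- Two consecutive bubbles of a face are not both crossed by the same face of length three. -/
theorem IsSimple.flip_step_ne [Finite B] (hs : G.IsSimple) {i j k : Fin 4}
    (h : IsColorTriple i j k) {v : B × Fin 4} (h2 : G.faceLength (G.face i (flip j v)) = 3)
    (h3 : G.face i (flip j v) ≠ G.face i v) :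
    G.face i (flip j (G.step i v)) ≠ G.face i (flip j v) := by
  intro h1
  obtain ⟨m, hm, -, hm'⟩ := exists_iterate_fst h.ne₁ h1
  have hper := G.iterate_faceLength h.ne₁ (flip j v)
  rw [h2] at hm hper
  interval_cases m
  · exact absurd hm' (hs.step_fst_ne i v)
  · exact flip_ne h.ne₂ v (hs.2 _ _ rfl hm'.symm)
  · have e : (G.step i)^[2] (flip j v) = flip i (G.step i v) := by
      refine hs.2 _ _ hm'.symm ?_
      rw [propagator_flip_step]
      have e1 : (G.step i ((G.step i)^[2] (flip j v))).1 = (flip j v).1 := congrArg Prod.fst hper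
      exact e1
    apply h3
    rw [← G.face_iterate h.ne₁ 2, e, face_flip _ h.ne₁, face_step _ h.ne₁]

/-- The properties of a graph with a projective jacket that are used below. -/
structure IsProjective [Fintype B] (G : ONGraph B) (i j k : Fin 4) : Prop where
  triple : IsColorTriple i j k
  connected : G.graph.IsConnected
  twoPI : G.IsTwoPI
  simple : G.IsSimple
  inter_eq : ∀ x ∈ G.cycleSpace, ∀ y ∈ G.cycleSpace,
    inter j k x y = inter j k x x * inter j k y y
  bound : G.EvenCyclesBound j k
  three_le : ∀ f : G.Face i, 3 ≤ G.faceLength f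
  card_eq : 2 * Nat.card (G.Face i) = Nat.card B + 1

namespace IsProjective

variable [Fintype B] {i j k : Fin 4}

theorem sum_faceLength (h : G.IsProjective i j k) [Fintype (G.Face i)] :
    ∑ f : G.Face i, (4 - (G.faceLength f : ℤ)) = 2 := by
  have h1 := G.sum_faceLength (i := i)
  have h2 := h.card_eq
  rw [Finset.sum_sub_distrib, ← Nat.cast_sum, h1, Finset.sum_const, Finset.card_univ,
    ← Nat.card_eq_fintype_card, nsmul_eq_mul]
  push_cast
  zify at h2
  linarith

theorem four_le_of_even (h : G.IsProjective i j k) {f : G.Face i} (hf : ¬ Odd (G.faceLength f)) :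
    4 ≤ G.faceLength f := by
  rcases (h.three_le f).eq_or_lt with h3 | h3
  · rw [← h3] at hf; exact absurd (by decide) hf
  · exact h3

/-- Summing over a set that contains all faces of odd length. -/
theorem two_le_sum (h : G.IsProjective i j k) {O : Finset (G.Face i)}
    (hO : ∀ f, Odd (G.faceLength f) → f ∈ O) :
    2 ≤ ∑ f ∈ O, (4 - (G.faceLength f : ℤ)) ∧
    (∑ f ∈ O, (4 - (G.faceLength f : ℤ)) = 2 → ∀ f ∉ O, G.faceLength f = 4) := by
  classical
  have := Fintype.ofFinite (G.Face i)
  have h1 := h.sum_faceLength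
  rw [← Finset.sum_add_sum_compl O] at h1
  -- Faces of even length have length at least four, so they contribute nothing positive.
  have h2 : ∀ f ∈ Oᶜ, 4 - (G.faceLength f : ℤ) ≤ 0 := by
    intro f hf
    have := h.four_le_of_even fun ho => Finset.mem_compl.1 hf (hO f ho)
    omega
  have h3 := Finset.sum_nonpos h2
  refine ⟨by linarith, fun h4 f hf => ?_⟩
  have h5 := (Finset.sum_eq_zero_iff_of_nonpos h2).1 (by linarith) f (Finset.mem_compl.2 hf)
  omega

theorem inter_faceVec (h : G.IsProjective i j k) (f g : G.Face i) :
    inter j k (G.faceVec f) (G.faceVec g) = 1 ↔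
      Odd (G.faceLength f) ∧ Odd (G.faceLength g) := by
  rw [h.inter_eq _ (G.faceVec_mem_cycleSpace h.triple.ne₁ f) _
    (G.faceVec_mem_cycleSpace h.triple.ne₁ g), G.faceLength_odd_iff h.triple,
    G.faceLength_odd_iff h.triple]
  generalize inter j k (G.faceVec f) (G.faceVec f) = a
  generalize inter j k (G.faceVec g) (G.faceVec g) = b
  revert a b; decide

/-- The crossings with `f` along the face of `v`. -/
theorem sum_cross_iff (h : G.IsProjective i j k) (v : B × Fin 4) (f : G.Face i) :
    ∑ l ∈ Finset.range (G.faceLength (G.face i v)),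
      cross k (G.faceVec f) ((G.step i)^[l] v).1 = 1 ↔
      Odd (G.faceLength (G.face i v)) ∧ Odd (G.faceLength f) := by
  rw [← G.inter_faceVec_face h.triple, h.inter_faceVec]

/-- An odd face is not homologous to zero, so in rank one a cycle with no crossing with it is
orthogonal to all cycles. -/
theorem sum_cross_eq_zero (h : G.IsProjective i j k) {d : G.Face i} (hd : Odd (G.faceLength d))
    {a b : B × Fin 4} {m l : ℕ}
    (hab : (a.1 = b.1 ∧ ((G.step i)^[m] a).1 = ((G.step i)^[l] b).1) ∨
      (a.1 = ((G.step i)^[l] b).1 ∧ b.1 = ((G.step i)^[m] a).1))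
    (hda : ∀ t ≤ m, cross k (G.faceVec d) ((G.step i)^[t] a).1 = 0)
    (hdb : ∀ t ≤ l, cross k (G.faceVec d) ((G.step i)^[t] b).1 = 0)
    {f : G.Face i} (hfa : cross k (G.faceVec f) a.1 = 0)
    (hfa' : cross k (G.faceVec f) ((G.step i)^[m] a).1 = 0) :
    ∑ t ∈ Finset.range m, cross k (G.faceVec f) ((G.step i)^[t + 1] a).1 +
      ∑ t ∈ Finset.range l, cross k (G.faceVec f) ((G.step i)^[t + 1] b).1 = 0 := by
  have hZ := fun f : G.Face i => G.faceVec_mem_cycleSpace h.triple.ne₁ f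
  refine G.sum_cross_eq_zero h.triple (d := G.faceVec d) ?_ hab hda hdb (hZ f) hfa hfa'
  intro x hx hxd y hy
  rw [h.inter_eq x hx _ (hZ d), (G.faceLength_odd_iff h.triple d).1 hd, mul_one] at hxd
  rw [h.inter_eq x hx y hy, hxd, zero_mul]

/-- The crossings of a face of length three with another odd face. -/
theorem odd_cross_three (h : G.IsProjective i j k) {v : B × Fin 4}
    (hv : G.faceLength (G.face i v) = 3) {f : G.Face i} (hf : Odd (G.faceLength f)) :
    cross k (G.faceVec f) v.1 + cross k (G.faceVec f) (G.step i v).1 +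
      cross k (G.faceVec f) (G.step i (G.step i v)).1 = 1 := by
  have h1 := (h.sum_cross_iff v f).2 ⟨by rw [hv]; decide, hf⟩
  rw [hv] at h1
  simpa [Finset.sum_range_succ] using h1

/-- A face of length three crosses each of three other odd faces once and crosses nothing
else. -/
theorem face_flip_mem (h : G.IsProjective i j k) {v : B × Fin 4}
    (hv : G.faceLength (G.face i v) = 3) {f₁ f₂ f₃ : G.Face i}
    (h1 : Odd (G.faceLength f₁)) (h2 : Odd (G.faceLength f₂)) (h3 : Odd (G.faceLength f₃))
    (n1 : G.face i v ≠ f₁) (n2 : G.face i v ≠ f₂) (n3 : G.face i v ≠ f₃)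
    (n12 : f₁ ≠ f₂) (n13 : f₁ ≠ f₃) (n23 : f₂ ≠ f₃) :
    (G.face i (flip j v) = f₁ ∨ G.face i (flip j v) = f₂ ∨ G.face i (flip j v) = f₃) ∧
      G.face i (flip j (G.step i v)) ≠ G.face i (flip j v) ∧
      G.face i (flip j (G.step i (G.step i v))) ≠ G.face i (flip j v) := by
  have hi := h.triple.ne₁
  have key : ∀ {f : G.Face i}, Odd (G.faceLength f) → G.face i v ≠ f →
      (G.face i (flip j v) = f ∨ G.face i (flip j (G.step i v)) = f ∨
        G.face i (flip j (G.step i (G.step i v))) = f) := by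
    intro f hf hn
    have e := h.odd_cross_three hv hf
    by_contra hne
    push Not at hne
    rw [G.cross_faceVec_eq_zero h.triple hn hne.1,
      G.cross_faceVec_eq_zero h.triple (by simpa [hi] using hn) hne.2.1,
      G.cross_faceVec_eq_zero h.triple (by simpa [hi] using hn) hne.2.2] at e
    exact absurd e (by decide)
  have k1 := key h1 n1
  have k2 := key h2 n2
  have k3 := key h3 n3
  generalize G.face i (flip j v) = a at *
  generalize G.face i (flip j (G.step i v)) = b at *
  generalize G.face i (flip j (G.step i (G.step i v))) = c at *
  clear key
  -- Three distinct faces are distributed over three crossings, so each occurs exactly once.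
  grind

/-- There are no four odd faces of colour `i` of which three have length three. -/
theorem false_of_four_odd (h : G.IsProjective i j k) {c d e e' : G.Face i}
    (hcd : c ≠ d) (hce : c ≠ e) (hce' : c ≠ e') (hde : d ≠ e) (hde' : d ≠ e') (hee' : e ≠ e')
    (hc : G.faceLength c = 3) (hd : G.faceLength d = 3) (he : G.faceLength e = 3)
    (ho' : Odd (G.faceLength e'))
    (hodd : ∀ f, Odd (G.faceLength f) → f = c ∨ f = d ∨ f = e ∨ f = e') : False := by
  classical
  have hi := h.triple.ne₁
  have three_odd : ∀ {f : G.Face i}, G.faceLength f = 3 → Odd (G.faceLength f) := by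
    intro f hf; rw [hf]; decide
  let O : Finset (G.Face i) := {c, d, e, e'}
  have hO : ∀ f, Odd (G.faceLength f) → f ∈ O := by
    intro f hf; simpa [O] using hodd f hf
  have hsum : ∑ f ∈ O, (4 - (G.faceLength f : ℤ)) = 3 + (4 - (G.faceLength e' : ℤ)) := by
    rw [Finset.sum_insert (by simp [hcd, hce, hce']), Finset.sum_insert (by simp [hde, hde']),
      Finset.sum_insert (by simp [hee']), Finset.sum_singleton, hc, hd, he]
    ring
  -- The odd faces contribute `3 + (4 - length of e')`, which must be at least 2.
  have hle : G.faceLength e' ≤ 5 := by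
    have := (h.two_le_sum hO).1
    omega
  have h3O : ∀ {x : B × Fin 4}, (G.face i x = c ∨ G.face i x = d ∨ G.face i x = e) →
      G.face i (flip j x) ∈ O ∧
      G.face i (flip j (G.step i x)) ≠ G.face i (flip j x) ∧
      G.face i (flip j (G.step i (G.step i x))) ≠ G.face i (flip j x) := by
    rintro x (hx | hx | hx)
    · obtain ⟨h1, h2⟩ := h.face_flip_mem (by rw [hx, hc]) (three_odd hd) (three_odd he) ho'
        (by rwa [hx]) (by rwa [hx]) (by rwa [hx]) hde hde' hee'
      exact ⟨by simp only [O, Finset.mem_insert, Finset.mem_singleton]; tauto, h2⟩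
    · obtain ⟨h1, h2⟩ := h.face_flip_mem (by rw [hx, hd]) (three_odd hc) (three_odd he) ho'
        (by rw [hx]; exact hcd.symm) (by rwa [hx]) (by rwa [hx]) hce hce' hee'
      exact ⟨by simp only [O, Finset.mem_insert, Finset.mem_singleton]; tauto, h2⟩
    · obtain ⟨h1, h2⟩ := h.face_flip_mem (by rw [hx, he]) (three_odd hc) (three_odd hd) ho'
        (by rw [hx]; exact hce.symm) (by rw [hx]; exact hde.symm) (by rwa [hx]) hcd hce' hde'
      exact ⟨by simp only [O, Finset.mem_insert, Finset.mem_singleton]; tauto, h2⟩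
  have memO : ∀ {f : G.Face i}, f ∈ O ↔ (f = c ∨ f = d ∨ f = e) ∨ f = e' := by
    intro f; simp only [O, Finset.mem_insert, Finset.mem_singleton]; tauto
  obtain ⟨z, hz⟩ := G.face_surjective i e'
  obtain h3 | h5 : G.faceLength e' = 3 ∨ G.faceLength e' = 5 := by
    have := h.three_le e'
    obtain ⟨r, hr⟩ := ho'
    omega
  · -- all four faces have length three: there are no other faces
    have h4O : ∀ x, G.face i x ∈ O → G.face i (flip j x) ∈ O := by
      intro x hx
      rcases memO.1 hx with hx | hx
      · exact (h3O hx).1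
      · obtain ⟨h1, -⟩ := h.face_flip_mem (by rw [hx, h3]) (three_odd hc) (three_odd hd)
          (three_odd he) (by rw [hx]; exact hce'.symm) (by rw [hx]; exact hde'.symm)
          (by rw [hx]; exact hee'.symm) hcd hce hde
        simp only [O, Finset.mem_insert, Finset.mem_singleton]; tauto
    have hall := G.forall_of_connected h.connected
      (Q := fun b => ∀ w : B × Fin 4, w.1 = b → G.face i w ∈ O) (by
        intro x hx w hw
        have hx' : G.face i (G.propagator x) ∈ O := by
          rw [face_propagator]; exact hx x rfl
        exact forall_face_of h.triple (Q := fun f => f ∈ O) hx' (h4O _ hx') hw) (b := z.1) (by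
        intro w hw
        have hz' : G.face i z ∈ O := by rw [hz]; simp [O]
        exact forall_face_of h.triple (Q := fun f => f ∈ O) hz' (h4O _ hz') hw)
    have := Fintype.ofFinite (G.Face i)
    have hu : O = Finset.univ := by
      ext f
      obtain ⟨w, rfl⟩ := G.face_surjective i f
      simpa using hall w.1 w rfl
    have h1 := h.sum_faceLength
    rw [← hu, hsum, h3] at h1
    norm_num at h1
  · have hzl : G.faceLength (G.face i z) = 5 := by rw [hz, h5]
    have hper := G.iterate_faceLength hi z
    rw [hzl] at hper
    have hself : ∀ {x : B × Fin 4}, G.face i x = e' → G.face i (flip j x) ≠ e' := by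
      intro x hx
      have := h.simple.face_flip_ne h.triple (v := x) (by rw [hx, h5])
      rwa [hx] at this
    -- the bubbles of the long face are distinct
    have hinj : ∀ {l m : ℕ}, l < 5 → m < 5 →
        ((G.step i)^[l] z).1 = ((G.step i)^[m] z).1 → l = m := by
      intro l m hl hm hlm
      have hf : ∀ m, G.face i ((G.step i)^[m] z) = e' := fun m => by rw [G.face_iterate hi, hz]
      rcases eq_cases_of_fst_eq h.triple hlm with e1 | e1 | e1 | e1
      · rw [← hzl, faceLength_face _ hi] at hl hm
        exact G.iterate_injOn i z hl hm e1
      · exact absurd e1 (G.iterate_ne_flip hi z l m)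
      · exact absurd (hf l) (by rw [e1]; exact hself (hf m))
      · exact absurd (hf l) (by rw [e1, face_flip_third h.triple]; exact hself (hf m))
    have hfz : ∀ m, G.face i ((G.step i)^[m] z) = e' := fun m => by rw [G.face_iterate hi, hz]
    -- each of the other odd faces crosses it exactly once
    have hexu : ∀ {f : G.Face i}, (f = c ∨ f = d ∨ f = e) → f ≠ e' → ∃ m : Fin 5,
        ∀ l : Fin 5, G.face i (flip j ((G.step i)^[(l : ℕ)] z)) = f ↔ l = m := by
      intro f hf hfe
      have hfo : Odd (G.faceLength f) := by
        rcases hf with rfl | rfl | rfl <;> exact three_odd ‹_›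
      have h1 := (h.sum_cross_iff z f).2 ⟨by rw [hzl]; decide, hfo⟩
      have huniq : ∀ l m : Fin 5, G.face i (flip j ((G.step i)^[(l : ℕ)] z)) = f →
          G.face i (flip j ((G.step i)^[(m : ℕ)] z)) = f → l = m := by
        intro l m hl hm
        have hx : G.face i (flip j ((G.step i)^[(l : ℕ)] z)) = c ∨
            G.face i (flip j ((G.step i)^[(l : ℕ)] z)) = d ∨
            G.face i (flip j ((G.step i)^[(l : ℕ)] z)) = e := by rwa [hl]
        obtain ⟨-, g1, g2⟩ := h3O hx
        rw [flip_flip, hfz] at g1 g2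
        have hfl : G.faceLength f = 3 := by rcases hf with rfl | rfl | rfl <;> assumption
        obtain ⟨r, hr, -, hr'⟩ := exists_iterate_fst hi (hm.trans hl.symm)
        rw [hl, hfl] at hr
        have hQ : ∀ u : B × Fin 4, G.face i u = f → G.face i (flip j u) ≠ e' →
            ((G.step i)^[(m : ℕ)] z).1 ≠ u.1 := by
          intro u hu1 hu2 he1
          have := forall_face_of h.triple (Q := fun g => g ≠ e') (v := u)
            (by rw [hu1]; exact hfe) hu2 he1
          exact this (hfz m)
        interval_cases r
        · exact (Fin.ext (hinj m.2 l.2 hr')).symm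
        · exact absurd hr' (hQ _ (by
            rw [Function.iterate_one, face_step _ hi, hl]) g1)
        · exact absurd hr' (hQ _ (by
            rw [G.face_iterate hi, hl]) g2)
      have hex : ∃ m : Fin 5, G.face i (flip j ((G.step i)^[(m : ℕ)] z)) = f := by
        by_contra hne
        push Not at hne
        rw [Finset.sum_eq_zero] at h1
        · exact absurd h1 (by decide)
        · intro l hl
          rw [Finset.mem_range, hzl] at hl
          exact G.cross_faceVec_eq_zero h.triple (by rw [hfz]; exact hfe.symm) (hne ⟨l, hl⟩)
      obtain ⟨m, hm⟩ := hex
      exact ⟨m, fun l => ⟨fun hl => huniq l m hl hm, fun hl => by rw [hl, hm]⟩⟩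
    obtain ⟨mc, hmc⟩ := hexu (f := c) (by simp) hce'
    obtain ⟨md, hmd⟩ := hexu (f := d) (by simp) hde'
    obtain ⟨me, hme⟩ := hexu (f := e) (by simp) hee'
    let S : B × Fin 4 → Prop := fun x =>
      G.face i (flip j x) = c ∨ G.face i (flip j x) = d ∨ G.face i (flip j x) = e
    have hS : ∀ m t : Fin 5, S ((G.step i)^[(t : ℕ)] ((G.step i)^[(m : ℕ)] z)) ↔
        t + m = mc ∨ t + m = md ∨ t + m = me := by
      intro m t
      rw [← hmc, ← hmd, ← hme, ← Function.iterate_add_apply, Fin.val_add]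
      have : (G.step i)^[(t + m : ℕ) % 5] z = (G.step i)^[(t + m : ℕ)] z := by
        conv_rhs => rw [← Function.iterate_mod_minimalPeriod_eq]
        rw [← faceLength_face _ hi, hzl]
      rw [this]
    -- `c`, `d`, `e` occupy three of the five cyclic positions on `e'`. Up to rotation the two free
    -- positions are 0 and 2, or 0 and 1.
    have hpat : ∀ a b c : Fin 5, a ≠ b → a ≠ c → b ≠ c → ∃ m : Fin 5,
        (¬ (0 + m = a ∨ 0 + m = b ∨ 0 + m = c) ∧ (1 + m = a ∨ 1 + m = b ∨ 1 + m = c) ∧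
          ¬ (2 + m = a ∨ 2 + m = b ∨ 2 + m = c) ∧ (3 + m = a ∨ 3 + m = b ∨ 3 + m = c) ∧
          (4 + m = a ∨ 4 + m = b ∨ 4 + m = c)) ∨
        (¬ (0 + m = a ∨ 0 + m = b ∨ 0 + m = c) ∧ ¬ (1 + m = a ∨ 1 + m = b ∨ 1 + m = c) ∧
          (2 + m = a ∨ 2 + m = b ∨ 2 + m = c) ∧ (3 + m = a ∨ 3 + m = b ∨ 3 + m = c) ∧
          (4 + m = a ∨ 4 + m = b ∨ 4 + m = c)) := by decide
    obtain ⟨m, hm⟩ := hpat mc md me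
      (fun he => hcd (((hmc mc).2 rfl).symm.trans ((hmd mc).2 he)))
      (fun he => hce (((hmc mc).2 rfl).symm.trans ((hme mc).2 he)))
      (fun he => hde (((hmd md).2 rfl).symm.trans ((hme md).2 he)))
    simp only [← hS m] at hm
    have hx : G.face i ((G.step i)^[(m : ℕ)] z) = e' := hfz m
    generalize (G.step i)^[(m : ℕ)] z = x at hm hx
    change (¬ S x ∧ S ((G.step i)^[1] x) ∧ ¬ S ((G.step i)^[2] x) ∧ S ((G.step i)^[3] x) ∧
        S ((G.step i)^[4] x)) ∨ (¬ S x ∧ ¬ S ((G.step i)^[1] x) ∧ S ((G.step i)^[2] x) ∧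
        S ((G.step i)^[3] x) ∧ S ((G.step i)^[4] x)) at hm
    have hfx : ∀ m, G.face i ((G.step i)^[m] x) = e' := fun m => by rw [G.face_iterate hi, hx]
    have hxl : G.faceLength (G.face i x) = 5 := by rw [hx, h5]
    have hxper := G.iterate_faceLength hi x
    rw [hxl] at hxper
    have hNO : ∀ {x : B × Fin 4}, G.face i x = e' → ¬ S x → G.face i (flip j x) ∉ O := by
      intro x hx hS hO
      rcases memO.1 hO with h1 | h1
      · exact hS h1
      · exact hself hx h1
    rcases hm with ⟨N0, S1, N2, S3, S4⟩ | ⟨N0, N1, S2, S3, S4⟩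
    · -- two isolated crossings
      have hN0 := hNO hx N0
      have hN2 := hNO (hfx 2) N2
      set f := G.face i (flip j x) with hf
      have hfO : ∀ {g : G.Face i}, g ∈ O → f ≠ g := fun hg he => hN0 (he ▸ hg)
      -- `f` is even, so it crosses `e'` an even number of times, and only the two free positions
      -- are available to it.
      have hf' : G.face i (flip j ((G.step i)^[2] x)) = f := by
        by_contra hne
        have h1 := h.sum_cross_iff x f
        have h2 : ¬ Odd (G.faceLength f) := fun ho => hN0 (hO f ho)
        rw [hxl] at h1
        simp only [Finset.sum_range_succ, Finset.sum_range_zero, zero_add, h2, and_false,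
          iff_false] at h1
        have hz' : ∀ m, G.face i ((G.step i)^[m] x) ≠ f := fun m => by
          rw [hfx]; exact (hfO (by simp [O])).symm
        have hzS : ∀ m, S ((G.step i)^[m] x) →
            cross k (G.faceVec f) ((G.step i)^[m] x).1 = 0 := fun m hm =>
          G.cross_faceVec_eq_zero h.triple (hz' m)
            (fun he => hfO (memO.2 (Or.inl hm)) he.symm)
        rw [hzS 1 S1, hzS 3 S3, hzS 4 S4, G.cross_faceVec_eq_zero h.triple (hz' 2) hne,
          G.cross_faceVec_eq_one h.triple (hz' 0) rfl] at h1
        exact h1 (by decide)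
      obtain ⟨r, -, -, hr⟩ := exists_iterate_fst hi hf'
      -- The closed curve consists of `e'` from position 0 to position 2 and an arc of `f` between
      -- the same bubbles. It misses the odd face `o'` and so crosses every cycle evenly, but `o`
      -- crosses it only at position 1.
      obtain ⟨o', ho'3, ho'ne⟩ : ∃ o', (o' = c ∨ o' = d ∨ o' = e) ∧
          G.face i (flip j ((G.step i)^[1] x)) ≠ o' := by
        by_cases h1 : G.face i (flip j ((G.step i)^[1] x)) = c
        · exact ⟨d, by simp, by rwa [h1]⟩
        · exact ⟨c, by simp, h1⟩
      set o := G.face i (flip j ((G.step i)^[1] x)) with ho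
      have cz : ∀ {g : G.Face i}, (g = c ∨ g = d ∨ g = e) →
          cross k (G.faceVec g) x.1 = 0 ∧ cross k (G.faceVec g) ((G.step i)^[2] x).1 = 0 ∧
          ∀ t, cross k (G.faceVec g) ((G.step i)^[t] (flip j x)).1 = 0 := by
        intro g hg
        have hge : e' ≠ g := by
          rcases hg with rfl | rfl | rfl
          · exact hce'.symm
          · exact hde'.symm
          · exact hee'.symm
        have hgf : f ≠ g := hfO (memO.2 (Or.inl hg))
        refine ⟨G.cross_faceVec_eq_zero h.triple (by rwa [hx]) hgf,
          G.cross_faceVec_eq_zero h.triple (by rwa [hfx]) (by rwa [hf']), fun t => ?_⟩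
        have ht : G.face i ((G.step i)^[t] (flip j x)) = f := G.face_iterate hi t _
        refine G.cross_faceVec_eq_zero h.triple (by rwa [ht]) fun he => ?_
        have := (h3O (x := flip j ((G.step i)^[t] (flip j x))) (by rwa [he])).1
        rw [flip_flip, ht] at this
        exact hN0 this
      have ho'o : Odd (G.faceLength o') := by
        rcases ho'3 with rfl | rfl | rfl <;> exact three_odd ‹_›
      have hge' : ∀ {g : G.Face i}, (g = c ∨ g = d ∨ g = e) → e' ≠ g := by
        rintro g (rfl | rfl | rfl)
        · exact hce'.symm
        · exact hde'.symm
        · exact hee'.symm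
      have h1 := h.sum_cross_eq_zero ho'o (a := x) (b := flip j x) (m := 2) (l := r)
        (Or.inl ⟨rfl, hr⟩) (by
          intro t ht
          interval_cases t
          · exact (cz ho'3).1
          · exact G.cross_faceVec_eq_zero h.triple (by rw [hfx]; exact hge' ho'3) ho'ne
          · exact (cz ho'3).2.1) (fun t _ => (cz ho'3).2.2 t) (f := o) (cz S1).1 (cz S1).2.1
      rw [Finset.sum_eq_zero (fun t _ => (cz S1).2.2 (t + 1)), add_zero] at h1
      simp only [Finset.sum_range_succ, Finset.sum_range_zero, zero_add] at h1
      rw [show (1 + 1 : ℕ) = 2 from rfl, (cz S1).2.1, add_zero,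
        G.cross_faceVec_eq_one h.triple (by rw [hfx]; exact hge' S1) rfl] at h1
      exact one_ne_zero h1
    · -- a cut by two propagators
      have hQS : ∀ m, S ((G.step i)^[m] x) → ∀ w : B × Fin 4, w.1 = ((G.step i)^[m] x).1 →
          G.face i w ∈ O := fun m hm w hw =>
        forall_face_of h.triple (Q := fun f => f ∈ O) (by rw [hfx]; simp [O])
          (memO.2 (Or.inl hm)) hw
      -- The bubbles met by odd faces only include positions 2, 3, 4 of `e'` but not 0 and 1. Such
      -- bubbles can be left only through the propagators from 1 to 2 and from 4 to 0.
      have hall := h.twoPI.forall_of_cut (v₁ := (G.step i)^[1] x) (v₂ := (G.step i)^[4] x)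
        (Q := fun b => ∀ w : B × Fin 4, w.1 = b → G.face i w ∈ O)
        (by
          intro he
          have hp : 1 < Function.minimalPeriod (G.step i) x ∧
              4 < Function.minimalPeriod (G.step i) x := by
            rw [← faceLength_face _ hi, hxl]; omega
          exact absurd (G.iterate_injOn i x hp.1 hp.2 he) (by omega))
        (G.iterate_ne_propagator hi x 1 4) (by
          intro v v1 v2 v3 v4 hv w hw
          have hvO := hv v rfl
          rcases memO.1 hvO with hv' | hv'
          · rw [← face_propagator] at hv'
            exact forall_face_of h.triple (Q := fun f => f ∈ O) (memO.2 (Or.inl hv'))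
              (h3O hv').1 hw
          · obtain ⟨m, hm, hm1, hm2⟩ := exists_iterate_fst hi (hv'.trans hx.symm)
            rw [hxl] at hm
            have hprev : ∀ m, G.propagator (flip i ((G.step i)^[m + 1] x)) = (G.step i)^[m] x := by
              intro m
              rw [Function.iterate_succ_apply', propagator_flip_step]
            have hnext : ∀ m, (G.propagator ((G.step i)^[m] x)).1 = ((G.step i)^[m + 1] x).1 := by
              intro m
              rw [Function.iterate_succ_apply']; rfl
            have hm1' : v = (G.step i)^[m] x ∨ v = flip i ((G.step i)^[m] x) := by
              rcases hm1 with e1 | e1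
              · exact Or.inl e1.symm
              · exact Or.inr (by rw [e1, flip_flip])
            interval_cases m
            · exact absurd (hv (flip j x) hm2.symm) (hNO hx N0)
            · exact absurd (hv (flip j ((G.step i)^[1] x)) hm2.symm) (hNO (hfx 1) N1)
            · rcases hm1' with rfl | rfl
              · exact hQS 3 S3 w (hw.trans (hnext 2))
              · exact absurd (by rw [← hprev 1, propagator_propagator]) v2
            · rcases hm1' with rfl | rfl
              · exact hQS 4 S4 w (hw.trans (hnext 3))
              · exact hQS 2 S2 w (hw.trans (by rw [hprev 2]))
            · rcases hm1' with rfl | rfl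
              · exact absurd rfl v3
              · exact hQS 3 S3 w (hw.trans (by rw [hprev 3])))
        (b := ((G.step i)^[2] x).1) (hQS 2 S2) x.1
      exact hNO hx N0 (hall (flip j x) rfl)

end IsProjective

end ONGraph

/-! ### The central bubble and the reconstruction of the graph -/

namespace ONGraph

variable {B : Type*} {G : ONGraph B}

/-- The face of colour `c` through `v` closes after three propagators. -/
def ClosesAt (G : ONGraph B) (c : Fin 4) (v : B × Fin 4) : Prop :=
  G.propagator (flip c (G.propagator v)) = flip c (G.propagator (flip c v))

theorem ClosesAt.flip {c : Fin 4} {v : B × Fin 4} (h : G.ClosesAt c v) :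
    G.ClosesAt c (ONGraph.flip c v) := by
  unfold ClosesAt at *
  rw [flip_flip, ← h, propagator_propagator]

theorem closesAt_of_faceLength [Finite B] {i : Fin 4} (hi : i ≠ 0) {v : B × Fin 4}
    (h : G.faceLength (G.face i v) = 3) : G.ClosesAt i v := by
  have hper := G.iterate_faceLength hi v
  rw [h] at hper
  have h1 : G.step i (G.step i (G.step i v)) = v := hper
  have h2 : G.propagator (flip i v) = G.step i (G.step i v) := by
    conv_lhs => rw [← h1]
    exact G.propagator_flip_step i _
  unfold ClosesAt
  rw [h2, flip_step]; rfl

namespace IsProjective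

variable [Fintype B] {i j k : Fin 4}

/-- The terms `4 - length` add up to 2 and none exceeds 1. -/
theorem exists_two_faces (h : G.IsProjective i j k) : ∃ c d : G.Face i, c ≠ d ∧
    G.faceLength c = 3 ∧ G.faceLength d = 3 := by
  classical
  have := Fintype.ofFinite (G.Face i)
  by_contra hne
  push Not at hne
  have h1 := h.sum_faceLength
  by_cases hex : ∃ c : G.Face i, G.faceLength c = 3
  · obtain ⟨c, hc⟩ := hex
    have h2 : ∑ f : G.Face i, (4 - (G.faceLength f : ℤ)) ≤
        ∑ f : G.Face i, if f = c then 1 else 0 := by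
      refine Finset.sum_le_sum fun f _ => ?_
      have := h.three_le f
      split_ifs with hf
      · omega
      · have := hne c f (fun h => hf h.symm) hc
        omega
    rw [Finset.sum_ite_eq' _ c, if_pos (Finset.mem_univ c), h1] at h2
    omega
  · push Not at hex
    have h2 : ∑ f : G.Face i, (4 - (G.faceLength f : ℤ)) ≤ 0 :=
      Finset.sum_nonpos fun f _ => by
        have := h.three_le f
        have := hex f
        omega
    omega

/-- Two faces of length three cross exactly once. -/
theorem exists_crossing (h : G.IsProjective i j k) : ∃ v,
    G.faceLength (G.face i v) = 3 ∧ G.faceLength (G.face i (flip j v)) = 3 ∧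
    G.face i (flip j v) ≠ G.face i v ∧
    G.face i (flip j (G.step i v)) ≠ G.face i (flip j v) ∧
    G.face i (flip j (G.step i (G.step i v))) ≠ G.face i (flip j v) := by
  have hi := h.triple.ne₁
  obtain ⟨c, d, hcd, hc, hd⟩ := h.exists_two_faces
  have hdo : Odd (G.faceLength d) := by rw [hd]; decide
  obtain ⟨v, hv, hvd⟩ : ∃ v, G.face i v = c ∧ G.face i (flip j v) = d := by
    by_contra hne
    push Not at hne
    obtain ⟨v, hv⟩ := G.face_surjective i c
    have h1 := h.odd_cross_three (v := v) (by rw [hv, hc]) hdo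
    have hz : ∀ w, G.face i w = c → cross k (G.faceVec d) w.1 = 0 := fun w hw =>
      G.cross_faceVec_eq_zero h.triple (by rwa [hw]) (hne w hw)
    rw [hz v hv, hz _ (by simp [hi, hv]), hz _ (by simp [hi, hv])] at h1
    exact absurd h1 (by decide)
  subst hv hvd
  -- The number of crossings is odd, and two consecutive bubbles of one face cannot both be crossed
  -- by the other; so a second crossing would leave exactly two.
  have h1 := h.simple.flip_step_ne h.triple hd hcd.symm
  refine ⟨v, hc, hd, hcd.symm, h1, fun h2 => ?_⟩
  have h3 := h.odd_cross_three hc hdo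
  rw [G.cross_faceVec_eq_one h.triple hcd rfl,
    G.cross_faceVec_eq_zero h.triple (by simpa [hi] using hcd) h1,
    G.cross_faceVec_eq_one h.triple (by simpa [hi] using hcd) h2] at h3
  exact absurd h3 (by decide)

/-- There is a bubble all of whose faces have length three. -/
theorem exists_center (h : G.IsProjective i j k) :
    ∃ b : B, ∀ c, c ≠ 0 → ∀ v : B × Fin 4, v.1 = b → G.ClosesAt c v := by
  classical
  have ht := h.triple
  have hi := ht.ne₁
  have hs := h.simple
  obtain ⟨v, hc, hd, hdc, n1, n2⟩ := h.exists_crossing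
  set w := flip j v with hw
  set c := G.face i v with hcdef
  set d := G.face i w with hddef
  set v₁ := G.step i v with hv₁
  set v₂ := G.step i v₁ with hv₂
  have fv₁ : G.face i v₁ = c := by rw [hv₁, face_step _ hi]
  have fv₂ : G.face i v₂ = c := by rw [hv₂, face_step _ hi, fv₁]
  have hstep3 : G.step i v₂ = v := by
    have := G.iterate_faceLength hi v
    rw [← hcdef, hc] at this
    exact this
  have hwstep3 : G.step i (G.step i (G.step i w)) = w := by
    have := G.iterate_faceLength hi w
    rw [← hddef, hd] at this
    exact this
  have hcodd : Odd (G.faceLength c) := by rw [hc]; decide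
  have hdodd : Odd (G.faceLength d) := by rw [hd]; decide
  set e := G.face i (flip j v₁) with hedef
  set e' := G.face i (flip j v₂) with he'def
  have ec : e ≠ c := by
    have := hs.face_flip_ne ht (v := v₁) (by rw [fv₁, hc]; omega)
    rwa [fv₁] at this
  have e'c : e' ≠ c := by
    have := hs.face_flip_ne ht (v := v₂) (by rw [fv₂, hc]; omega)
    rwa [fv₂] at this
  have hsumc : ∀ {f : G.Face i}, Odd (G.faceLength f) → f ≠ c → f ≠ d →
      cross k (G.faceVec f) v₁.1 + cross k (G.faceVec f) v₂.1 = 1 := by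
    intro f hf hfc hfd
    have h1 := h.odd_cross_three hc hf
    rwa [G.cross_faceVec_eq_zero ht hfc.symm hfd.symm, zero_add] at h1
  have hQ0 : ∀ {x : B × Fin 4}, x.1 = v.1 → G.face i x = c ∨ G.face i x = d := fun hx =>
    forall_face_of ht (Q := fun f => f = c ∨ f = d) (Or.inl rfl) (Or.inr rfl) hx
  -- An odd face other than `c` and `d` crosses `c` at exactly one of `v₁`, `v₂`. If one face `e`
  -- crosses at both, then `c` and `d` are the only odd faces, and all others have length four
  -- because `c` and `d` already contribute 2. If `e ≠ e'`, then both are odd.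
  by_cases hee : e = e'
  · have hodd : ∀ f : G.Face i, Odd (G.faceLength f) → f ∈ ({c, d} : Finset (G.Face i)) := by
      intro f hf
      by_contra hne
      simp only [Finset.mem_insert, Finset.mem_singleton, not_or] at hne
      have h1 := hsumc hf hne.1 hne.2
      by_cases hfe : e = f
      · rw [G.cross_faceVec_eq_one ht (by rw [fv₁]; exact fun e => hne.1 e.symm) hfe,
          G.cross_faceVec_eq_one ht (by rw [fv₂]; exact fun e => hne.1 e.symm)
          (hee.symm.trans hfe)] at h1
        exact absurd h1 (by decide)
      · rw [G.cross_faceVec_eq_zero ht (by rw [fv₁]; exact fun e => hne.1 e.symm) hfe,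
          G.cross_faceVec_eq_zero ht (by rw [fv₂]; exact fun e => hne.1 e.symm)
          (fun h => hfe (hee.trans h))] at h1
        exact absurd h1 (by decide)
    have he4 : G.faceLength e = 4 := by
      refine (h.two_le_sum hodd).2 ?_ e (by simp [ec, n1])
      rw [Finset.sum_pair hdc.symm, hc, hd]; norm_num
    set y := flip j v₁ with hy
    have hopp : ((G.step i)^[2] y).1 = v₂.1 :=
      hs.opposite ht (v := v₁) hee.symm he4 (by rwa [fv₁])
    have hyper : (G.step i)^[4] y = y := by
      have := G.iterate_faceLength hi y
      rwa [← hedef, he4] at this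
    have hyface : ∀ m, G.face i ((G.step i)^[m] y) = e := fun m => G.face_iterate hi m y
    have hyself : ∀ m, G.face i (flip j ((G.step i)^[m] y)) ≠ e := by
      intro m
      have := hs.face_flip_ne ht (v := (G.step i)^[m] y) (by rw [hyface, he4]; omega)
      rwa [hyface] at this
    have hQ1 : ∀ {x : B × Fin 4}, x.1 = v₁.1 → G.face i x = c ∨ G.face i x = e := fun hx =>
      forall_face_of ht (Q := fun f => f = c ∨ f = e) (Or.inl fv₁) (Or.inr rfl) hx
    have hQ2 : ∀ {x : B × Fin 4}, x.1 = v₂.1 → G.face i x = c ∨ G.face i x = e := fun hx =>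
      forall_face_of ht (Q := fun f => f = c ∨ f = e) (Or.inl fv₂) (Or.inr hee.symm) hx
    have hcz : ∀ {g : G.Face i}, g ≠ c → g ≠ e →
        cross k (G.faceVec g) v₁.1 = 0 ∧ cross k (G.faceVec g) v₂.1 = 0 := by
      intro g h1 h2
      refine ⟨G.cross_faceVec_eq_zero ht (by rw [fv₁]; exact h1.symm) h2.symm,
        G.cross_faceVec_eq_zero ht (by rw [fv₂]; exact h1.symm) ?_⟩
      rw [← he'def, ← hee]; exact h2.symm
    have hyc : ∀ {x : B × Fin 4}, G.face i x = e → x.1 ≠ v₁.1 → x.1 ≠ v₂.1 →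
        G.face i (flip j x) ≠ c := by
      intro x hx m1 m2 hxc
      obtain ⟨m, hm, -, hm'⟩ := exists_iterate_fst hi hxc
      rw [← hcdef, hc] at hm
      rw [flip_fst] at hm'
      interval_cases m
      · rcases hQ0 hm' with e1 | e1
        · exact ec (hx.symm.trans e1)
        · exact n1 (hx.symm.trans e1)
      · exact m1 hm'
      · exact m2 hm'
    have e34 : G.step i ((G.step i)^[3] y) = y := hyper
    have hy1a : ((G.step i)^[1] y).1 ≠ v₁.1 := hs.step_fst_ne i y
    have hy1b : ((G.step i)^[1] y).1 ≠ v₂.1 := by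
      rw [← hopp]; exact (hs.step_fst_ne i _).symm
    have hy3a : ((G.step i)^[3] y).1 ≠ v₁.1 := by
      have := hs.step_fst_ne i ((G.step i)^[3] y)
      rw [e34] at this
      exact this.symm
    have hy3b : ((G.step i)^[3] y).1 ≠ v₂.1 := by
      rw [← hopp]; exact hs.step_fst_ne i ((G.step i)^[2] y)
    -- The closed curve made of the propagator from `v₁` to `v₂` and half of `e` would miss the odd
    -- face `d`, hence bound, and yet be crossed just once by `g`.
    have hy1 : G.face i (flip j ((G.step i)^[1] y)) = d := by
      by_contra hne
      set g := G.face i (flip j ((G.step i)^[1] y)) with hg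
      have c1 := hcz (hyc (hyface 1) hy1a hy1b) (hyself 1)
      have c2 := hcz hdc n1.symm
      have c3 : cross k (G.faceVec d) ((G.step i)^[1] y).1 = 0 :=
        G.cross_faceVec_eq_zero ht (by rw [hyface]; exact n1) hne
      have h1 := h.sum_cross_eq_zero hdodd (a := v₁) (b := y) (m := 1) (l := 2)
        (Or.inl ⟨rfl, hopp.symm⟩)
        (by
          intro t ht
          interval_cases t
          · exact c2.1
          · exact c2.2)
        (by
          intro t ht
          interval_cases t
          · exact c2.1
          · exact c3
          · rw [hopp]; exact c2.2) (f := g) c1.1 c1.2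
      simp only [Finset.sum_range_succ, Finset.sum_range_zero, zero_add] at h1
      rw [show (G.step i)^[1] v₁ = v₂ from rfl, show (1 + 1 : ℕ) = 2 from rfl, hopp, c1.2,
        G.cross_faceVec_eq_one ht (by rw [hyface]; exact (hyself 1).symm) rfl] at h1
      exact absurd h1 (by decide)
    have hy3 : G.face i (flip j ((G.step i)^[3] y)) = d := by
      by_contra hne
      set g := G.face i (flip j ((G.step i)^[3] y)) with hg
      have c1 := hcz (hyc (hyface 3) hy3a hy3b) (hyself 3)
      have c2 := hcz hdc n1.symm
      have c3 : cross k (G.faceVec d) ((G.step i)^[3] y).1 = 0 :=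
        G.cross_faceVec_eq_zero ht (by rw [hyface]; exact n1) hne
      have e4 : (G.step i)^[2] ((G.step i)^[2] y) = y := hyper
      have h1 := h.sum_cross_eq_zero hdodd (a := v₁) (b := (G.step i)^[2] y) (m := 1) (l := 2)
        (Or.inr ⟨by rw [e4]; rfl, hopp⟩)
        (by
          intro t ht
          interval_cases t
          · exact c2.1
          · exact c2.2)
        (by
          intro t ht
          interval_cases t
          · change cross k (G.faceVec d) ((G.step i)^[2] y).1 = 0
            rw [hopp]; exact c2.2
          · exact c3
          · rw [e4]; exact c2.1) (f := g) c1.1 c1.2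
      simp only [Finset.sum_range_succ, Finset.sum_range_zero, zero_add] at h1
      rw [show (G.step i)^[1] v₁ = v₂ from rfl, show (1 + 1 : ℕ) = 2 from rfl, e4,
        show y.1 = v₁.1 from rfl, c1.1, c1.2,
        show (G.step i)^[1] ((G.step i)^[2] y) = (G.step i)^[3] y from rfl,
        G.cross_faceVec_eq_one ht (by rw [hyface]; exact (hyself 3).symm) rfl] at h1
      exact absurd h1 (by decide)
    -- the two other bubbles of `e` are the two other bubbles of `d`
    have hpos : ∀ {x : B × Fin 4}, G.face i x = e → G.face i (flip j x) = d →
        x.1 = (G.step i w).1 ∨ x.1 = (G.step i (G.step i w)).1 := by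
      intro x hx hxd
      obtain ⟨m, hm, -, hm'⟩ := exists_iterate_fst hi hxd
      rw [← hddef, hd] at hm
      rw [flip_fst] at hm'
      interval_cases m
      · exfalso
        rcases hQ0 (x := x) hm' with e1 | e1
        · exact ec (hx.symm.trans e1)
        · exact n1 (hx.symm.trans e1)
      · exact Or.inl hm'
      · exact Or.inr hm'
    have p1 := hpos (hyface 1) hy1
    have p3 := hpos (hyface 3) hy3
    have p13 : ((G.step i)^[3] y).1 ≠ ((G.step i)^[1] y).1 :=
      hs.step_step_fst_ne hi ((G.step i)^[1] y)
    -- The four propagators of `e` join each of the two other bubbles of `c` to each of the two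
    -- other bubbles of `d`.
    have hadj : ∀ x : B × Fin 4, (x.1 = v₁.1 ∨ x.1 = v₂.1) → ∀ z : B × Fin 4,
        (z.1 = (G.step i w).1 ∨ z.1 = (G.step i (G.step i w)).1) →
        ∃ g, g.1 = x.1 ∧ (G.propagator g).1 = z.1 ∧ G.face i g = e := by
      have hA : ∀ x : B × Fin 4, (x.1 = v₁.1 ∨ x.1 = v₂.1) →
          (∃ g, g.1 = x.1 ∧ (G.propagator g).1 = ((G.step i)^[1] y).1 ∧ G.face i g = e) ∧
          (∃ g, g.1 = x.1 ∧ (G.propagator g).1 = ((G.step i)^[3] y).1 ∧ G.face i g = e) := by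
        rintro x (hx | hx)
        · refine ⟨⟨y, hx.symm, rfl, rfl⟩, flip i y, hx.symm, ?_, by rw [face_flip _ hi]⟩
          conv_lhs => rw [← e34]
          rw [propagator_flip_step]
        · refine ⟨⟨flip i ((G.step i)^[2] y), ?_, ?_, by rw [face_flip _ hi, hyface]⟩,
            (G.step i)^[2] y, hopp.trans hx.symm, rfl, hyface 2⟩
          · exact hopp.trans hx.symm
          · exact congrArg Prod.fst (G.propagator_flip_step i (G.step i y))
      intro x hx z hz
      obtain ⟨g1, g3⟩ := hA x hx
      rcases p1 with p1 | p1 <;> rcases p3 with p3 | p3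
      · exact absurd (p3.trans p1.symm) p13
      · rcases hz with hz | hz
        · rw [hz, ← p1]; exact g1
        · rw [hz, ← p3]; exact g3
      · rcases hz with hz | hz
        · rw [hz, ← p3]; exact g3
        · rw [hz, ← p1]; exact g1
      · exact absurd (p3.trans p1.symm) p13
    -- all triangles at the crossing of `c` and `d` are faces
    have htri : ∀ {l m : Fin 4}, IsColorTriple i l m → G.EvenCyclesBound l m →
        ∀ a : B × Fin 4, G.face i a = c → G.face i (flip l a) = d →
        ((G.propagator a).1 = v₁.1 ∨ (G.propagator a).1 = v₂.1) →
        ((G.propagator (flip l a)).1 = (G.step i w).1 ∨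
          (G.propagator (flip l a)).1 = (G.step i (G.step i w)).1) → G.ClosesAt l a := by
      intro l m hl hb a ha ha' h1 h2
      obtain ⟨g, hg1, hg2, hg3⟩ := hadj _ h1 _ h2
      refine h.twoPI.triangle hs hl hb hg1 hg2 ?_ ?_ ?_ ?_
      · rintro rfl
        rw [face_propagator, ha] at hg3
        exact ec hg3.symm
      · rintro rfl
        rw [face_flip _ hi, face_propagator, ha] at hg3
        exact ec hg3.symm
      · intro he
        rw [← face_propagator, he, face_propagator, ha'] at hg3
        exact n1 hg3.symm
      · intro he
        rw [← face_propagator, he, face_flip _ hi, face_propagator, ha'] at hg3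
        exact n1 hg3.symm
    have q1 : G.propagator (flip i v) = v₂ := by
      conv_lhs => rw [← hstep3]
      exact G.propagator_flip_step i _
    have q2 : G.propagator (flip i w) = G.step i (G.step i w) := by
      conv_lhs => rw [← hwstep3]
      exact G.propagator_flip_step i _
    have hkv : flip k v = flip i w := by rw [hw, flip_comp ht]
    have r1 : G.ClosesAt j v := htri ht h.bound v rfl rfl (Or.inl rfl) (Or.inl rfl)
    have r2 : G.ClosesAt j (flip i v) := by
      have hji : flip j (flip i v) = flip i w := by rw [← hkv, flip_comp ht.rotate.swap]
      refine htri ht h.bound _ (by rw [face_flip _ hi]) ?_ (Or.inr (by rw [q1])) (Or.inr ?_)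
      · rw [hji, face_flip _ hi]
      · rw [hji, q2]
    have r3 : G.ClosesAt k v := by
      refine htri ht.swap h.bound.swap v rfl ?_ (Or.inl rfl) (Or.inr ?_)
      · rw [hkv, face_flip _ hi]
      · rw [hkv, q2]
    have r4 : G.ClosesAt k (flip i v) := by
      have hki : flip k (flip i v) = w := by rw [hw, flip_comp ht.rotate.rotate]
      refine htri ht.swap h.bound.swap _ (by rw [face_flip _ hi]) ?_ (Or.inr (by rw [q1]))
        (Or.inl ?_)
      · rw [hki]
      · rw [hki]; rfl
    have r5 : G.ClosesAt i v := closesAt_of_faceLength hi hc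
    have r6 : G.ClosesAt i w := closesAt_of_faceLength hi hd
    refine ⟨v.1, fun a ha x hx => ?_⟩
    rcases ht.color_cases a with rfl | rfl | rfl | rfl
    · exact absurd rfl ha
    · rcases eq_cases_of_fst_eq ht hx with rfl | rfl | rfl | rfl
      · exact r5
      · exact r5.flip
      · exact r6
      · rw [hkv]; exact r6.flip
    · rcases eq_cases_of_fst_eq ht hx with rfl | rfl | rfl | rfl
      · exact r1
      · exact r2
      · exact r1.flip
      · have := r2.flip
        rwa [flip_comp ht.rotate.swap] at this
    · rcases eq_cases_of_fst_eq ht hx with rfl | rfl | rfl | rfl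
      · exact r3
      · exact r4
      · have := r4.flip
        rwa [flip_comp ht.rotate.rotate] at this
      · exact r3.flip
  · -- four odd faces
    exfalso
    have heo : Odd (G.faceLength e) := by
      refine ((h.sum_cross_iff v e).1 ?_).2
      rw [← hcdef, hc]
      simp only [Finset.sum_range_succ, Finset.sum_range_zero, zero_add]
      change cross k (G.faceVec e) v.1 + cross k (G.faceVec e) v₁.1 +
        cross k (G.faceVec e) v₂.1 = 1
      rw [G.cross_faceVec_eq_zero ht ec.symm n1.symm,
        G.cross_faceVec_eq_one ht (by rw [fv₁]; exact ec.symm) rfl,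
        G.cross_faceVec_eq_zero ht (by rw [fv₂]; exact ec.symm) (Ne.symm hee)]
      rfl
    have heo' : Odd (G.faceLength e') := by
      refine ((h.sum_cross_iff v e').1 ?_).2
      rw [← hcdef, hc]
      simp only [Finset.sum_range_succ, Finset.sum_range_zero, zero_add]
      change cross k (G.faceVec e') v.1 + cross k (G.faceVec e') v₁.1 +
        cross k (G.faceVec e') v₂.1 = 1
      rw [G.cross_faceVec_eq_zero ht e'c.symm n2.symm,
        G.cross_faceVec_eq_zero ht (by rw [fv₁]; exact e'c.symm) hee,
        G.cross_faceVec_eq_one ht (by rw [fv₂]; exact e'c.symm) rfl]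
      rfl
    have hodd : ∀ f : G.Face i, Odd (G.faceLength f) → f = c ∨ f = d ∨ f = e ∨ f = e' := by
      intro f hf
      by_contra hne
      push Not at hne
      have h1 := hsumc hf hne.1 hne.2.1
      rw [G.cross_faceVec_eq_zero ht (by rw [fv₁]; exact hne.1.symm) hne.2.2.1.symm,
        G.cross_faceVec_eq_zero ht (by rw [fv₂]; exact hne.1.symm) hne.2.2.2.symm] at h1
      exact absurd h1 (by decide)
    -- The sum `1 + 1 + (4 - length of e) + (4 - length of e')` is at least 2, so the two odd
    -- lengths add up to at most 8 and one of them is 3.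
    have hsum := (h.two_le_sum (O := {c, d, e, e'}) (by simpa using hodd)).1
    rw [Finset.sum_insert (by simp [hdc.symm, ec.symm, e'c.symm]),
      Finset.sum_insert (by simp [n1.symm, n2.symm]),
      Finset.sum_pair hee, hc, hd] at hsum
    have he3 := h.three_le e
    have he3' := h.three_le e'
    obtain ⟨a, ha⟩ := id heo
    obtain ⟨a', ha'⟩ := id heo'
    by_cases he : G.faceLength e = 3
    · exact h.false_of_four_odd hdc.symm ec.symm e'c.symm n1.symm n2.symm hee hc hd he heo' hodd
    · have he' : G.faceLength e' = 3 := by omega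
      refine h.false_of_four_odd hdc.symm e'c.symm ec.symm n2.symm n1.symm (Ne.symm hee) hc hd he'
        heo fun f hf => ?_
      have := hodd f hf
      tauto

end IsProjective

/-- With planar jackets excluded, `F_j + F_k ≤ n + 1` for each pair, and the degree forces equality
in all three bounds. The average length of a face is then below four, so each colour has a face of
length three; its odd self-intersection makes even cycles bound. -/
theorem IsTwoPIDipoleFreeOfDegreeThreeHalves.exists_center [Finite B]
    (hG : G.IsTwoPIDipoleFreeOfDegreeThreeHalves) :
    G.IsSimple ∧ ∃ b : B, ∀ c, c ≠ 0 → ∀ v : B × Fin 4, v.1 = b → G.ClosesAt c v := by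
  have := Fintype.ofFinite B
  have hle : ∀ {i j k}, IsColorTriple i j k →
      Nat.card (G.Face j) + Nat.card (G.Face k) ≤ Nat.card B + 1 := by
    intro i j k h
    rcases (G.card_face_add_le hG.1 h).eq_or_lt with h' | h'
    · exact (hG.not_planar h h').elim
    · omega
  have hF : ∀ {i j k}, IsColorTriple i j k →
      Nat.card (G.Face j) + Nat.card (G.Face k) = Nat.card B + 1 ∧
      2 * Nat.card (G.Face i) = Nat.card B + 1 := by
    intro i j k h
    have h0 := (G.degree_eq_three_halves_iff h).1 hG.2.2.2
    have h1 := hle h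
    have h2 := hle h.rotate
    have h3 := hle h.rotate.rotate
    omega
  have hodd : ∀ {i j k}, IsColorTriple i j k → ∃ f : G.Face i, G.faceLength f = 3 := by
    intro i j k h
    by_contra hne
    push Not at hne
    have := Fintype.ofFinite (G.Face i)
    have h1 := G.sum_faceLength (i := i)
    have h2 := Finset.card_nsmul_le_sum (Finset.univ : Finset (G.Face i)) G.faceLength 4 (by
      intro f _
      have := hG.three_le_faceLength h.ne₁ f
      have := hne f
      omega)
    rw [h1, Finset.card_univ, ← Nat.card_eq_fintype_card, smul_eq_mul] at h2
    have := (hF h).2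
    omega
  have hb : ∀ i j k, IsColorTriple i j k → G.EvenCyclesBound j k := by
    intro i j k h x hx hx0
    obtain ⟨f, hf⟩ := hodd h
    exact G.mem_of_inter_self_eq_zero hG.1 h (hF h).1 (G.faceVec_mem_cycleSpace h.ne₁ f)
      ((G.faceLength_odd_iff h f).1 (by rw [hf]; decide)) hx hx0
  have hs := hG.isSimple_of_evenCyclesBound hb
  have h : IsColorTriple 1 2 3 := by decide
  have hP : G.IsProjective 1 2 3 := ⟨h, hG.1, hG.2.1, hs,
    fun x hx y hy => G.inter_eq_mul_of_projective hG.1 h (hF h).1 hx hy, hb _ _ _ h,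
    fun f => hG.three_le_faceLength h.ne₁ f, (hF h).2⟩
  exact ⟨hs, hP.exists_center⟩

/-- A simple connected graph in which all faces through some bubble have length three is the
explicit graph on five bubbles. -/
theorem isIsomorphic_of_center (hc : G.graph.IsConnected) (hs : G.IsSimple) {b : B}
    (hb : ∀ c, c ≠ 0 → ∀ v : B × Fin 4, v.1 = b → G.ClosesAt c v) :
    G.graph.IsIsomorphic fiveBubbleGraph.graph := by
  -- The outer bubble `s` is based at the far end of the propagator of `(b, s)`, and its other
  -- vertices are named by the colour of the edge from there. `ClosesAt t (b, s)` is then the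
  -- propagator rule between outer bubbles.
  let φ : Option (Fin 4) × Fin 4 → B × Fin 4
    | (none, s) => (b, s)
    | (some s, t) => flip t (G.propagator (b, s))
  have hflip0 : ∀ v : B × Fin 4, flip 0 v = v := by
    rintro ⟨x, s⟩
    have : ∀ s, tetrahedron 0 s = s := by decide
    simp [flip, this]
  have hprop : ∀ v, φ (fiveBubbleGraph.propagator v) = G.propagator (φ v) := by
    rintro ⟨_ | s, t⟩
    · change flip 0 (G.propagator (b, t)) = G.propagator (b, t)
      rw [hflip0]
    · by_cases ht : t = 0
      · subst ht
        change (b, s) = G.propagator (flip 0 (G.propagator (b, s)))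
        rw [hflip0, propagator_propagator]
      · have e : fiveBubbleGraph.propagator (some s, t) = (some (tetrahedron t s), t) := by
          simp [fiveBubbleGraph, fiveBubblePropagator, ht]
        rw [e]
        exact (hb t ht (b, s) rfl).symm
  have hflip : ∀ c, c ≠ 0 → ∀ v, φ (flip c v) = flip c (φ v) := by
    have hcomm : ∀ c t s, tetrahedron (tetrahedron c t) s = tetrahedron c (tetrahedron t s) := by
      decide
    rintro c hc ⟨_ | s, t⟩
    · rfl
    · change flip (tetrahedron c t) _ = flip c (flip t _)
      simp [flip, hcomm]
  have hinj : Function.Injective φ := by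
    have hne : ∀ s, (G.propagator (b, s)).1 ≠ b := fun s => hs.1 (b, s)
    rintro ⟨_ | s, t⟩ ⟨_ | s', t'⟩ h
    · simpa [φ] using h
    · exact absurd (congrArg Prod.fst h).symm (hne s')
    · exact absurd (congrArg Prod.fst h) (hne s)
    · have h0 : (φ (some s, t)).1 = (φ (some s', t')).1 := congrArg Prod.fst h
      have h1 : (b, s) = (b, s') := hs.2 (b, s) (b, s') rfl h0
      obtain rfl : s = s' := congrArg Prod.snd h1
      have h2 : tetrahedron t (G.propagator (b, s)).2 = tetrahedron t' (G.propagator (b, s)).2 :=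
        congrArg Prod.snd h
      have hd : ∀ t t' s, tetrahedron t s = tetrahedron t' s → t = t' := by decide
      rw [hd _ _ _ h2]
  have hsurj : Function.Surjective φ := by
    intro v
    have := G.forall_of_connected hc (Q := fun b' => ∀ s, ∃ x, φ x = (b', s)) (by
      intro v hv s
      obtain ⟨x, hx⟩ := hv v.2
      have h1 : φ (fiveBubbleGraph.propagator x) = G.propagator v := by rw [hprop, hx]
      rcases eq_cases_of_fst_eq (show IsColorTriple 1 2 3 by decide) (v := G.propagator v)
        (w := ((G.propagator v).1, s)) rfl with e | e | e | e <;> rw [e]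
      · exact ⟨_, h1⟩
      · exact ⟨flip 1 _, by rw [hflip 1 (by decide), h1]⟩
      · exact ⟨flip 2 _, by rw [hflip 2 (by decide), h1]⟩
      · exact ⟨flip 3 _, by rw [hflip 3 (by decide), h1]⟩) (b := b)
      (fun s => ⟨(none, s), rfl⟩) v.1
    exact this v.2
  let ε := Equiv.ofBijective φ ⟨hinj, hsurj⟩
  refine ⟨ε.symm, fun c v => ?_⟩
  rw [Equiv.symm_apply_eq]
  have hv : v = φ (ε.symm v) := (ε.apply_symm_apply v).symm
  change G.graph.nbr c v = φ (fiveBubbleGraph.graph.nbr c (ε.symm v))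
  by_cases h0 : c = 0
  · subst h0
    rw [graph_nbr_zero, graph_nbr_zero, hprop, ← hv]
  · rw [graph_nbr _ h0, graph_nbr _ h0, hflip c h0, ← hv]

end ONGraph

namespace ONGraph

/-! ### The explicit graph -/

/-- The number of the face of colour `i` through a vertex of the explicit graph. -/
def fiveBubbleLabel (i : Fin 4) : Option (Fin 4) × Fin 4 → Fin 3
  | (none, s) => if s = 0 ∨ s = i then 0 else 1
  | (some s, t) => if t = 0 ∨ t = i then (if s = 0 ∨ s = i then 0 else 1) else 2

/-- A vertex on each face of colour `i` of the explicit graph. -/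
def fiveBubbleVertex (i : Fin 4) : Fin 3 → Option (Fin 4) × Fin 4 :=
  ![(none, 0), (none, if i = 1 then 2 else 1), (some 0, if i = 1 then 2 else 1)]

/-- The label is invariant along propagators and edges of colour `i`, and every vertex is linked to
the representative of its label in at most three steps; both are finite checks. -/
theorem fiveBubble_face_eq_iff {i : Fin 4} (hi : i ≠ 0) (v w : Option (Fin 4) × Fin 4) :
    fiveBubbleGraph.face i v = fiveBubbleGraph.face i w ↔
      fiveBubbleLabel i v = fiveBubbleLabel i w := by
  have h0 : ∀ i : Fin 4, i ≠ 0 → ∀ v,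
      fiveBubbleLabel i (fiveBubbleGraph.propagator v) = fiveBubbleLabel i v := by decide
  have h1 : ∀ i : Fin 4, i ≠ 0 → ∀ v, fiveBubbleLabel i (flip i v) = fiveBubbleLabel i v := by
    decide
  have h2 : ∀ i : Fin 4, i ≠ 0 → ∀ v, ∃ m : Fin 4,
      (fiveBubbleGraph.step i)^[m] (fiveBubbleVertex i (fiveBubbleLabel i v)) = v ∨
      (fiveBubbleGraph.step i)^[m] (fiveBubbleVertex i (fiveBubbleLabel i v)) =
        fiveBubbleGraph.propagator v := by decide
  have h3 : ∀ v, fiveBubbleGraph.face i (fiveBubbleVertex i (fiveBubbleLabel i v)) =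
      fiveBubbleGraph.face i v := by
    intro v
    obtain ⟨m, hm⟩ := h2 i hi v
    exact (face_eq_iff _ hi).2 ⟨m, hm⟩
  constructor
  · exact eq_of_face_eq _ hi (h0 i hi) (h1 i hi)
  · intro h
    rw [← h3 v, h, h3 w]

/-- The explicit graph has three faces of each colour. -/
noncomputable def fiveBubbleFaceEquiv {i : Fin 4} (hi : i ≠ 0) :
    fiveBubbleGraph.Face i ≃ Fin 3 := by
  refine Equiv.symm (Equiv.ofBijective
    (fun l => fiveBubbleGraph.face i (fiveBubbleVertex i l)) ⟨fun l l' h => ?_, fun f => ?_⟩)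
  · have hl : ∀ i : Fin 4, i ≠ 0 → ∀ l, fiveBubbleLabel i (fiveBubbleVertex i l) = l := by decide
    have := (fiveBubble_face_eq_iff hi _ _).1 h
    rwa [hl i hi, hl i hi] at this
  · have hl : ∀ i : Fin 4, i ≠ 0 → ∀ l, fiveBubbleLabel i (fiveBubbleVertex i l) = l := by decide
    obtain ⟨v, rfl⟩ := fiveBubbleGraph.face_surjective i f
    exact ⟨fiveBubbleLabel i v, (fiveBubble_face_eq_iff hi _ _).2 (hl i hi _)⟩

theorem fiveBubble_faceLength {i : Fin 4} (hi : i ≠ 0) (f : fiveBubbleGraph.Face i) :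
    fiveBubbleGraph.faceLength f = if fiveBubbleFaceEquiv hi f = 2 then 4 else 3 := by
  obtain ⟨l, rfl⟩ := (fiveBubbleFaceEquiv hi).symm.surjective f
  rw [Equiv.apply_symm_apply]
  have h1 := fiveBubbleGraph.two_mul_faceLength ((fiveBubbleFaceEquiv hi).symm l)
  have hl : ∀ i : Fin 4, i ≠ 0 → ∀ l, fiveBubbleLabel i (fiveBubbleVertex i l) = l := by decide
  have h2 : {v | fiveBubbleGraph.face i v = (fiveBubbleFaceEquiv hi).symm l} =
      ((Finset.univ.filter fun v => fiveBubbleLabel i v = l : Finset _) : Set _) := by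
    ext v
    have e : (fiveBubbleFaceEquiv hi).symm l = fiveBubbleGraph.face i (fiveBubbleVertex i l) := rfl
    simp [e, fiveBubble_face_eq_iff hi, hl i hi]
  have h3 : ∀ i : Fin 4, i ≠ 0 → ∀ l, (Finset.univ.filter fun v => fiveBubbleLabel i v = l).card =
      2 * if l = 2 then 4 else 3 := by decide
  rw [h2, Set.ncard_coe_finset, h3 i hi] at h1
  exact mul_left_cancel₀ two_ne_zero h1

theorem fiveBubble_card_face {i : Fin 4} (hi : i ≠ 0) :
    Nat.card (fiveBubbleGraph.Face i) = 3 := by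
  rw [Nat.card_congr (fiveBubbleFaceEquiv hi)]; simp

theorem fiveBubble_faces {i : Fin 4} (hi : i ≠ 0) :
    {f : fiveBubbleGraph.Face i | fiveBubbleGraph.faceLength f = 3}.ncard = 2 ∧
    {f : fiveBubbleGraph.Face i | fiveBubbleGraph.faceLength f = 4}.ncard = 1 ∧
    ∀ f : fiveBubbleGraph.Face i,
      fiveBubbleGraph.faceLength f = 3 ∨ fiveBubbleGraph.faceLength f = 4 := by
  have h : ∀ n, {f : fiveBubbleGraph.Face i | fiveBubbleGraph.faceLength f = n}.ncard =
      (Finset.univ.filter fun l : Fin 3 => (if l = 2 then 4 else 3) = n).card := by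
    intro n
    rw [← Set.ncard_coe_finset,
      ← Set.ncard_image_of_injective _ (fiveBubbleFaceEquiv hi).injective]
    congr 1
    ext l
    simp only [Set.mem_image, Set.mem_ofPred_eq, fiveBubble_faceLength hi, Finset.coe_filter,
      Finset.mem_univ, true_and]
    exact ⟨by rintro ⟨f, hf, rfl⟩; exact hf,
      fun hl => ⟨(fiveBubbleFaceEquiv hi).symm l, by simpa using hl, by simp⟩⟩
  refine ⟨by rw [h]; decide, by rw [h]; decide, fun f => ?_⟩
  rw [fiveBubble_faceLength hi]
  split_ifs <;> simp

theorem fiveBubble_isTwoPI : fiveBubbleGraph.IsTwoPI := by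
  rintro _ ⟨x, rfl⟩ _ ⟨x', rfl⟩ -
  simp only [graph_nbr_zero]
  set R := fiveBubbleGraph.graph.remove 0
    {s(x, fiveBubbleGraph.propagator x), s(x', fiveBubbleGraph.propagator x')}
  have hin : ∀ b s s', R.Reachable (b, s) (b, s') := by
    have h1 : ∀ c, c ≠ 0 → ∀ v, R.Reachable v (flip c v) := fun c hc v =>
      SimpleGraph.Adj.reachable ⟨c, graph_nbr _ hc v, fun h => hc h.1⟩
    intro b s s'
    rcases eq_cases_of_fst_eq (show IsColorTriple 1 2 3 by decide) (v := (b, s)) (w := (b, s'))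
      rfl with e | e | e | e <;> rw [e]
    · exact h1 1 (by decide) _
    · exact h1 2 (by decide) _
    · exact h1 3 (by decide) _
  have hprop : ∀ v, (v ≠ x ∧ v ≠ fiveBubbleGraph.propagator x) →
      (v ≠ x' ∧ v ≠ fiveBubbleGraph.propagator x') →
      R.Reachable v (fiveBubbleGraph.propagator v) := by
    intro v h h'
    refine SimpleGraph.Adj.reachable ⟨0, graph_nbr_zero _ v, ?_⟩
    rintro ⟨-, hv⟩
    simp only [Set.mem_insert_iff, Set.mem_singleton_iff, Sym2.eq_iff] at hv
    rcases hv with (⟨e, -⟩ | ⟨e, -⟩) | (⟨e, -⟩ | ⟨e, -⟩)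
    · exact h.1 e
    · exact h.2 e
    · exact h'.1 e
    · exact h'.2 e
  -- four paths without a common propagator join an outer bubble to the central one
  have hkill : ∀ x s, ∃ t₀ : Fin 4, ∀ t, t ≠ t₀ →
      (((none, tetrahedron t s) : Option (Fin 4) × Fin 4) ≠ x ∧
        (none, tetrahedron t s) ≠ fiveBubbleGraph.propagator x) ∧
      (t = 0 ∨ ((some s, t) ≠ x ∧ (some s, t) ≠ fiveBubbleGraph.propagator x)) := by decide
  have houter : ∀ s, R.Reachable (none, 0) (some s, 0) := by
    intro s
    obtain ⟨t₀, h₀⟩ := hkill x s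
    obtain ⟨t₁, h₁⟩ := hkill x' s
    have hex : ∀ t₀ t₁ : Fin 4, ∃ t, t ≠ t₀ ∧ t ≠ t₁ := by decide
    obtain ⟨t, ht0, ht1⟩ := hex t₀ t₁
    obtain ⟨a0, b0⟩ := h₀ t ht0
    obtain ⟨a1, b1⟩ := h₁ t ht1
    have r1 := (hin none 0 (tetrahedron t s)).trans (hprop _ a0 a1)
    have e1 : fiveBubbleGraph.propagator (none, tetrahedron t s) = (some (tetrahedron t s), 0) :=
      rfl
    rw [e1] at r1
    by_cases ht : t = 0
    · subst ht
      have : ∀ s, tetrahedron 0 s = s := by decide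
      rwa [this] at r1
    · have r2 := hprop (some s, t) (b0.resolve_left ht) (b1.resolve_left ht)
      have e2 : fiveBubbleGraph.propagator (some s, t) = (some (tetrahedron t s), t) := by
        simp [fiveBubbleGraph, fiveBubblePropagator, ht]
      rw [e2] at r2
      exact (r1.trans (hin _ _ _)).trans (r2.symm.trans (hin _ _ _))
  have hall : ∀ v, R.Reachable (none, 0) v := by
    rintro ⟨_ | s, t⟩
    · exact hin _ _ _
    · exact (houter s).trans (hin _ _ _)
  exact ⟨fun v w => (hall v).symm.trans (hall w)⟩

theorem fiveBubble_isConnected : fiveBubbleGraph.graph.IsConnected := by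
  have h := fiveBubble_isTwoPI s((none, 0), (some 0, 0)) ⟨(none, 0), rfl⟩
    s((none, 1), (some 1, 0)) ⟨(none, 1), rfl⟩ (by decide)
  refine h.mono ?_
  rintro v w ⟨a, ha, -⟩
  exact ⟨a, Set.mem_univ a, ha⟩

theorem fiveBubble_isDipoleFree : fiveBubbleGraph.IsDipoleFree := by
  rintro ⟨i, hi, f, hf, -⟩
  rcases (fiveBubble_faces hi).2.2 f with h | h <;> omega

theorem fiveBubble_genus {i : Fin 4} (hi : i ≠ 0) : (fiveBubbleGraph.jacket i).genus = 1 / 2 := by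
  obtain ⟨j, k, h⟩ := exists_isColorTriple i hi
  rw [jacket_genus _ h, fiveBubble_card_face h.ne₂, fiveBubble_card_face h.ne₃]
  simp
  norm_num

theorem fiveBubble_degree : fiveBubbleGraph.degree = 3 / 2 := by
  rw [degree, fiveBubble_genus (by decide), fiveBubble_genus (by decide),
    fiveBubble_genus (by decide)]
  norm_num

theorem fiveBubble_isTwoPIDipoleFreeOfDegreeThreeHalves :
    fiveBubbleGraph.IsTwoPIDipoleFreeOfDegreeThreeHalves :=
  ⟨fiveBubble_isConnected, fiveBubble_isTwoPI, fiveBubble_isDipoleFree, fiveBubble_degree⟩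

end ONGraph

/-! ### The real projective plane -/

/-- The products of coordinates are continuous, invariant under the antipodal map, and determine a
unit vector up to sign. -/
instance : T2Space RealProjectivePlane := by
  let f : RealProjectivePlane → (Fin 3 → Fin 3 → ℝ) :=
    Quot.lift (fun x a b => x.1 a * x.1 b) (by rintro x _ rfl; ext a b; simp)
  refine T2Space.of_injective_continuous (f := f) ?_ ?_
  · rintro ⟨x⟩ ⟨y⟩ h
    have h' : ∀ a b, x.1 a * x.1 b = y.1 a * y.1 b := fun a b => congrFun (congrFun h a) b
    obtain ⟨a, ha⟩ : ∃ a, x.1 a ≠ 0 := by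
      by_contra hne
      push Not at hne
      have h0 : x.1 = 0 := by ext a; simpa using hne a
      have h1 := mem_sphere_zero_iff_norm.1 x.2
      rw [h0, norm_zero] at h1
      exact zero_ne_one h1
    have hsq : x.1 a = y.1 a ∨ x.1 a = -y.1 a := mul_self_eq_mul_self_iff.1 (h' a a)
    rcases hsq with e | e
    · congr 1
      ext b
      have := h' a b
      rw [← e] at this
      exact mul_left_cancel₀ ha this
    · refine Quot.sound (Subtype.ext ?_)
      ext b
      have := h' a b
      have hy : y.1 a = -x.1 a := by linarith
      rw [hy] at this
      have h2 : x.1 b = -y.1 b := mul_left_cancel₀ ha (by linarith)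
      simp [h2]
  · refine continuous_quot_lift _ ?_
    fun_prop

/-- The class of a nonzero vector in the projective plane. -/
noncomputable def RealProjectivePlane.ofVec (u : EuclideanSpace ℝ (Fin 3)) (hu : u ≠ 0) :
    RealProjectivePlane :=
  Quot.mk _ ⟨‖u‖⁻¹ • u, by
    rw [mem_sphere_zero_iff_norm, norm_smul, norm_inv, norm_norm,
      inv_mul_cancel₀ (norm_ne_zero_iff.2 hu)]⟩

namespace RealProjectivePlane

theorem ofVec_neg {u v : EuclideanSpace ℝ (Fin 3)} (hu : u ≠ 0) (hv : v ≠ 0) (h : v = -u) :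
    ofVec u hu = ofVec v hv := by
  subst h
  exact Quot.sound (Subtype.ext (by simp))

theorem ofVec_eq {u v : EuclideanSpace ℝ (Fin 3)} {hu : u ≠ 0} {hv : v ≠ 0}
    (h : ofVec u hu = ofVec v hv) : ∃ r : ℝ, r ≠ 0 ∧ u = r • v := by
  -- The antipodal relation is neither reflexive nor transitive; the equivalence it generates is
  -- equality up to sign.
  have hrel : Equivalence (fun x y : Metric.sphere (0 : EuclideanSpace ℝ (Fin 3)) 1 =>
      y = x ∨ y = -x) :=
    ⟨fun x => Or.inl rfl, fun h => by rcases h with rfl | rfl <;> simp,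
      fun h h' => by rcases h with rfl | rfl <;> rcases h' with rfl | rfl <;> simp⟩
  have h1 := Quot.eqvGen_exact h
  have h2 : ∀ x y, Relation.EqvGen (fun x y : Metric.sphere (0 : EuclideanSpace ℝ (Fin 3)) 1 =>
      y = -x) x y → (y = x ∨ y = -x) := by
    intro x y hxy
    induction hxy with
    | rel x y h => exact Or.inr h
    | refl x => exact Or.inl rfl
    | symm x y _ ih => exact hrel.symm ih
    | trans x y z _ _ ih ih' => exact hrel.trans ih ih'
  have hu' := norm_ne_zero_iff.2 hu
  have hv' := norm_ne_zero_iff.2 hv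
  rcases h2 _ _ h1 with h3 | h3
  · have h4 : ‖v‖⁻¹ • v = ‖u‖⁻¹ • u := congrArg Subtype.val h3
    refine ⟨‖u‖ * ‖v‖⁻¹, mul_ne_zero hu' (inv_ne_zero hv'), ?_⟩
    rw [mul_smul, h4, smul_smul, mul_inv_cancel₀ hu', one_smul]
  · have h4 : ‖v‖⁻¹ • v = -(‖u‖⁻¹ • u) := congrArg Subtype.val h3
    refine ⟨-(‖u‖ * ‖v‖⁻¹), neg_ne_zero.2 (mul_ne_zero hu' (inv_ne_zero hv')), ?_⟩
    rw [neg_smul, mul_smul, h4, smul_neg, neg_neg, smul_smul, mul_inv_cancel₀ hu', one_smul]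

theorem exists_eq_ofVec (p : RealProjectivePlane) :
    ∃ (u : EuclideanSpace ℝ (Fin 3)) (hu : u ≠ 0), 0 ≤ u 2 ∧ p = ofVec u hu := by
  obtain ⟨x, rfl⟩ := Quot.exists_rep p
  have hx := mem_sphere_zero_iff_norm.1 x.2
  have hx0 : x.1 ≠ 0 := by
    intro h; rw [h, norm_zero] at hx; exact zero_ne_one hx
  have h1 : Quot.mk _ x = ofVec x.1 hx0 := by
    unfold ofVec
    congr 1
    ext1
    simp [hx]
  rcases le_total 0 (x.1 2) with h | h
  · exact ⟨x.1, hx0, h, h1⟩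
  · exact ⟨-x.1, neg_ne_zero.2 hx0, by simpa using h,
      h1.trans (ofVec_neg hx0 (neg_ne_zero.2 hx0) rfl)⟩

theorem ofVec_smul {u v : EuclideanSpace ℝ (Fin 3)} (hu : u ≠ 0) (hv : v ≠ 0) {r : ℝ}
    (hr : 0 < r) (h : v = r • u) : ofVec v hv = ofVec u hu := by
  subst h
  unfold ofVec
  congr 1
  ext1
  simp only [norm_smul, Real.norm_eq_abs, abs_of_pos hr, smul_smul]
  congr 1
  field_simp

theorem continuous_ofVec {X : Type*} [TopologicalSpace X] {f : X → EuclideanSpace ℝ (Fin 3)}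
    (hf : Continuous f) (h0 : ∀ x, f x ≠ 0) : Continuous fun x => ofVec (f x) (h0 x) := by
  refine continuous_quot_mk.comp (Continuous.subtype_mk ?_ _)
  exact (hf.norm.inv₀ fun x => norm_ne_zero_iff.2 (h0 x)).smul hf

end RealProjectivePlane

/-! ### The jackets of the five-bubble graph -/

/-- The five triangles into which the surface of a jacket of the five-bubble graph divides each of
the four octants `z ≥ 0` of `ℝ³`. -/
inductive OctantCell
  | center
  | inner
  | right
  | left
  | outer

namespace OctantCell

/-- The first octant coordinate of the point with barycentric coordinates `a, b, c`. -/
def x : OctantCell → ℝ → ℝ → ℝ → ℝ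
  | center, _, b, _ => b
  | inner, a, b, _ => a + b
  | right, a, b, c => a + b + c
  | left, a, _, _ => a
  | outer, a, _, c => a + c

/-- The second octant coordinate of the point with barycentric coordinates `a, b, c`. -/
def y : OctantCell → ℝ → ℝ → ℝ → ℝ
  | center, _, _, c => c
  | inner, a, _, c => a + c
  | right, a, _, _ => a
  | left, a, b, c => a + b + c
  | outer, a, b, _ => a + b

/-- The third octant coordinate of the point with barycentric coordinates `a, b, c`. -/
def z : OctantCell → ℝ → ℝ → ℝ → ℝ
  | center, a, b, c => a + b + c
  | inner, a, b, c => a + b + c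
  | right, a, b, _ => a + b
  | left, a, _, c => a + c
  | outer, a, _, _ => a

theorem coord_smul (t : OctantCell) (r a b c : ℝ) :
    t.x (r * a) (r * b) (r * c) = r * t.x a b c ∧ t.y (r * a) (r * b) (r * c) = r * t.y a b c ∧
      t.z (r * a) (r * b) (r * c) = r * t.z a b c := by
  cases t <;> simp only [x, y, z] <;> refine ⟨?_, ?_, ?_⟩ <;> first | trivial | ring

theorem coord_nonneg (t : OctantCell) {a b c : ℝ} (ha : 0 ≤ a) (hb : 0 ≤ b) (hc : 0 ≤ c) :
    0 ≤ t.x a b c ∧ 0 ≤ t.y a b c ∧ 0 ≤ t.z a b c := by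
  cases t <;> simp only [x, y, z] <;> refine ⟨?_, ?_, ?_⟩ <;> positivity

theorem le_coord_add (t : OctantCell) {a b c : ℝ} (ha : 0 ≤ a) (hb : 0 ≤ b) (hc : 0 ≤ c) :
    a + b + c ≤ t.x a b c + t.y a b c + t.z a b c := by
  cases t <;> simp only [x, y, z] <;> linarith

theorem continuous_x (t : OctantCell) {X : Type*} [TopologicalSpace X] {a b c : X → ℝ}
    (ha : Continuous a) (hb : Continuous b) (hc : Continuous c) :
    Continuous fun u => t.x (a u) (b u) (c u) := by
  cases t <;> simp only [x] <;> fun_prop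

theorem continuous_y (t : OctantCell) {X : Type*} [TopologicalSpace X] {a b c : X → ℝ}
    (ha : Continuous a) (hb : Continuous b) (hc : Continuous c) :
    Continuous fun u => t.y (a u) (b u) (c u) := by
  cases t <;> simp only [y] <;> fun_prop

theorem continuous_z (t : OctantCell) {X : Type*} [TopologicalSpace X] {a b c : X → ℝ}
    (ha : Continuous a) (hb : Continuous b) (hc : Continuous c) :
    Continuous fun u => t.z (a u) (b u) (c u) := by
  cases t <;> simp only [z] <;> fun_prop

/-- The cells are the cones over the triangles of a triangulation, and a corner common to two
triangles carries the same label in both. A shared point therefore has the same barycentric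
coordinates in either cell. -/
theorem coord_injective (t t' : OctantCell) {a b c a' b' c' : ℝ} (ha : 0 ≤ a) (hb : 0 ≤ b)
    (hc : 0 ≤ c) (ha' : 0 ≤ a') (hb' : 0 ≤ b') (hc' : 0 ≤ c') (hx : t.x a b c = t'.x a' b' c')
    (hy : t.y a b c = t'.y a' b' c') (hz : t.z a b c = t'.z a' b' c') :
    a = a' ∧ b = b' ∧ c = c' := by
  cases t <;> cases t' <;> simp only [x, y, z] at hx hy hz <;>
    refine ⟨?_, ?_, ?_⟩ <;> linarith

theorem exists_coord {u v w : ℝ} (hu : 0 ≤ u) (hv : 0 ≤ v) (hw : 0 ≤ w) :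
    ∃ (t : OctantCell) (a b c : ℝ), 0 ≤ a ∧ 0 ≤ b ∧ 0 ≤ c ∧
      t.x a b c = u ∧ t.y a b c = v ∧ t.z a b c = w := by
  rcases le_total u w with h1 | h1 <;> rcases le_total v w with h2 | h2
  · rcases le_total (u + v) w with h3 | h3
    · exact ⟨center, w - u - v, u, v, by linarith, hu, hv, rfl, rfl, by simp only [z]; ring⟩
    · exact ⟨inner, u + v - w, w - v, w - u, by linarith, by linarith, by linarith,
        by simp only [x]; ring, by simp only [y]; ring, by simp only [z]; ring⟩
  · exact ⟨left, u, v - w, w - u, hu, by linarith, by linarith, rfl, by simp only [y]; ring,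
      by simp only [z]; ring⟩
  · exact ⟨right, v, w - v, u - w, hv, by linarith, by linarith, by simp only [x]; ring, rfl,
      by simp only [z]; ring⟩
  · exact ⟨outer, w, v - w, u - w, hw, by linarith, by linarith, by simp only [x]; ring,
      by simp only [y]; ring, rfl⟩

/-- The vertex of the five-bubble graph dual to a cell of the octant `s`. -/
def vertex (i j k : Fin 4) : OctantCell → Fin 4 → Option (Fin 4) × Fin 4
  | center, s => (none, s)
  | inner, s => (some s, 0)
  | right, s => (some s, k)
  | left, s => (some s, j)
  | outer, s => (some s, i)

/-- The cell of a vertex of the five-bubble graph. -/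
def ofVertex (j k : Fin 4) : Option (Fin 4) × Fin 4 → OctantCell
  | (none, _) => center
  | (some _, t) => if t = 0 then inner else if t = k then right else if t = j then left else outer

/-- The octant of a vertex of the five-bubble graph. -/
def octant : Option (Fin 4) × Fin 4 → Fin 4
  | (none, s) => s
  | (some s, _) => s

theorem octant_vertex (i j k : Fin 4) (t : OctantCell) (s : Fin 4) :
    octant (t.vertex i j k s) = s := by
  cases t <;> rfl

end OctantCell

/-- The sign by which the octant `s` differs from the octant `0` in the coordinate fixed by the
colour `k`. -/
def octantSign (k s : Fin 4) : ℝ := if s = 0 ∨ s = k then 1 else -1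

theorem octantSign_eq_or (k s : Fin 4) : octantSign k s = 1 ∨ octantSign k s = -1 := by
  unfold octantSign; split_ifs <;> simp

theorem abs_octantSign (k s : Fin 4) : |octantSign k s| = 1 := by
  rcases octantSign_eq_or k s with h | h <;> simp [h]

theorem octantSign_tetrahedron_self (k s : Fin 4) :
    octantSign k (tetrahedron k s) = octantSign k s := by
  have h : ∀ k s : Fin 4, (tetrahedron k s = 0 ∨ tetrahedron k s = k) ↔ (s = 0 ∨ s = k) := by decide
  simp only [octantSign, h]

/-- `octantSign k` is the character of the Klein four-group with kernel `{0, k}`. -/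
theorem octantSign_tetrahedron {j k : Fin 4} (hj : j ≠ 0) (hk : k ≠ 0) (hjk : j ≠ k) (s : Fin 4) :
    octantSign k (tetrahedron j s) = -octantSign k s := by
  have h : ∀ j k : Fin 4, j ≠ 0 → k ≠ 0 → j ≠ k → ∀ s,
      (tetrahedron j s = 0 ∨ tetrahedron j s = k) ↔ ¬ (s = 0 ∨ s = k) := by decide
  simp only [octantSign, h j k hj hk hjk]
  split_ifs <;> simp_all

/-! ### Gluing the cells of a jacket surface -/

namespace IsColorTriple

variable {i j k : Fin 4}

theorem ofVertex_vertex (h : IsColorTriple i j k) (t : OctantCell) (s : Fin 4) :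
    OctantCell.ofVertex j k (t.vertex i j k s) = t := by
  obtain ⟨h1, h2, h3, h4, h5, h6⟩ := h
  cases t <;> simp [OctantCell.ofVertex, OctantCell.vertex, *]

theorem exists_vertex (h : IsColorTriple i j k) (v : Option (Fin 4) × Fin 4) :
    ∃ (t : OctantCell) (s : Fin 4), v = t.vertex i j k s := by
  obtain ⟨_ | s, r⟩ := v
  · exact ⟨.center, r, rfl⟩
  · rcases h.color_cases r with rfl | rfl | rfl | rfl
    · exact ⟨.inner, s, rfl⟩
    · exact ⟨.outer, s, rfl⟩
    · exact ⟨.left, s, rfl⟩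
    · exact ⟨.right, s, rfl⟩

theorem exists_octantSign (h : IsColorTriple i j k) (u v : ℝ) :
    ∃ s, octantSign k s * |u| = u ∧ octantSign j s * |v| = v := by
  obtain ⟨h1, h2, h3, h4, h5, h6⟩ := h
  rcases le_total 0 u with hu | hu <;> rcases le_total 0 v with hv | hv
  · exact ⟨0, by simp [octantSign, abs_of_nonneg, hu], by simp [octantSign, abs_of_nonneg, hv]⟩
  · exact ⟨k, by simp [octantSign, abs_of_nonneg, hu],
      by simp [octantSign, abs_of_nonpos, hv, h3, h6.symm]⟩
  · exact ⟨j, by simp [octantSign, abs_of_nonpos, hu, h2, h6],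
      by simp [octantSign, abs_of_nonneg, hv]⟩
  · exact ⟨i, by simp [octantSign, abs_of_nonpos, hu, h1, h5],
      by simp [octantSign, abs_of_nonpos, hv, h1, h4]⟩

/-- The colour `0` of the jacket `J_i`. -/
def color₀ (h : IsColorTriple i j k) : {c : Fin 4 // c ≠ i} := ⟨0, h.ne₁.symm⟩

/-- The colour `j` of the jacket `J_i`. -/
def color₁ (h : IsColorTriple i j k) : {c : Fin 4 // c ≠ i} := ⟨j, h.2.2.2.1.symm⟩

/-- The colour `k` of the jacket `J_i`. -/
def color₂ (h : IsColorTriple i j k) : {c : Fin 4 // c ≠ i} := ⟨k, h.2.2.2.2.1.symm⟩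

theorem jacket_color_cases (h : IsColorTriple i j k) (c : {c : Fin 4 // c ≠ i}) :
    c = h.color₀ ∨ c = h.color₁ ∨ c = h.color₂ := by
  obtain ⟨c, hc⟩ := c
  rcases h.color_cases c with rfl | rfl | rfl | rfl
  · exact Or.inl rfl
  · exact absurd rfl hc
  · exact Or.inr (Or.inl rfl)
  · exact Or.inr (Or.inr rfl)

theorem jacket_color_sum (h : IsColorTriple i j k) (f : {c : Fin 4 // c ≠ i} → ℝ) :
    ∑ c, f c = f h.color₀ + f h.color₁ + f h.color₂ := by
  have hu : (Finset.univ : Finset {c : Fin 4 // c ≠ i}) = {h.color₀, h.color₁, h.color₂} := by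
    ext c
    simpa using h.jacket_color_cases c
  have h1 : h.color₀ ∉ ({h.color₁, h.color₂} : Finset {c : Fin 4 // c ≠ i}) := by
    simp [color₀, color₁, color₂, h.ne₂.symm, h.ne₃.symm]
  have h2 : h.color₁ ∉ ({h.color₂} : Finset {c : Fin 4 // c ≠ i}) := by
    simp [color₁, color₂, h.2.2.2.2.2]
  rw [hu, Finset.sum_insert h1, Finset.sum_insert h2, Finset.sum_singleton, add_assoc]

theorem simplex_sum (h : IsColorTriple i j k) (p : stdSimplex ℝ {c : Fin 4 // c ≠ i}) :
    p.1 h.color₀ + p.1 h.color₁ + p.1 h.color₂ = 1 := by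
  rw [← h.jacket_color_sum]
  exact p.2.2

/-- The point of the surface of `J_i` with barycentric coordinates `p` in a cell. -/
def surfacePoint (_ : IsColorTriple i j k) (p : stdSimplex ℝ {c : Fin 4 // c ≠ i})
    (t : OctantCell) (s : Fin 4) : (fiveBubbleGraph.jacket i).Surface :=
  Quot.mk _ ⟨t.vertex i j k s, p⟩

variable {p : stdSimplex ℝ {c : Fin 4 // c ≠ i}}

theorem surfacePoint_eq (h : IsColorTriple i j k) {t t' : OctantCell} {s s' : Fin 4}
    (c : {c : Fin 4 // c ≠ i}) (hp : p.1 c = 0)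
    (hn : t'.vertex i j k s' = fiveBubbleGraph.graph.nbr c.1 (t.vertex i j k s)) :
    h.surfacePoint p t s = h.surfacePoint p t' s' :=
  Quot.sound ⟨c, hn, rfl, hp⟩

/-- The side opposite to the corner `0` separates `center` from `inner`; for `right`, `left` and
`outer` it lies on the coordinate planes `y = 0`, `x = 0` and `z = 0`. On the last one the gluing
changes both signs of the octant and is antipodal. -/
theorem nbr_zero_vertex (h : IsColorTriple i j k) :
    (∀ s, fiveBubbleGraph.graph.nbr 0 (OctantCell.vertex i j k .center s) =
      OctantCell.vertex i j k .inner s) ∧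
    (∀ s, fiveBubbleGraph.graph.nbr 0 (OctantCell.vertex i j k .inner s) =
      OctantCell.vertex i j k .center s) ∧
    (∀ s, fiveBubbleGraph.graph.nbr 0 (OctantCell.vertex i j k .right s) =
      OctantCell.vertex i j k .right (tetrahedron k s)) ∧
    (∀ s, fiveBubbleGraph.graph.nbr 0 (OctantCell.vertex i j k .left s) =
      OctantCell.vertex i j k .left (tetrahedron j s)) ∧
    (∀ s, fiveBubbleGraph.graph.nbr 0 (OctantCell.vertex i j k .outer s) =
      OctantCell.vertex i j k .outer (tetrahedron i s)) := by
  have h1 := h.ne₁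
  have h2 := h.ne₂
  have h3 := h.ne₃
  refine ⟨?_, ?_, ?_, ?_, ?_⟩ <;> intro s <;>
    simp [ONGraph.graph, OctantCell.vertex, fiveBubbleGraph, fiveBubblePropagator, h1, h2, h3]

theorem nbr_snd_vertex (h : IsColorTriple i j k) :
    (∀ s, fiveBubbleGraph.graph.nbr j (OctantCell.vertex i j k .center s) =
      OctantCell.vertex i j k .center (tetrahedron j s)) ∧
    (∀ s, fiveBubbleGraph.graph.nbr j (OctantCell.vertex i j k .inner s) =
      OctantCell.vertex i j k .left s) ∧
    (∀ s, fiveBubbleGraph.graph.nbr j (OctantCell.vertex i j k .right s) =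
      OctantCell.vertex i j k .outer s) ∧
    (∀ s, fiveBubbleGraph.graph.nbr j (OctantCell.vertex i j k .left s) =
      OctantCell.vertex i j k .inner s) ∧
    (∀ s, fiveBubbleGraph.graph.nbr j (OctantCell.vertex i j k .outer s) =
      OctantCell.vertex i j k .right s) := by
  have h2 := h.ne₂
  have key : ∀ {i j k : Fin 4}, IsColorTriple i j k →
    tetrahedron j k = i ∧ tetrahedron j j = 0 ∧ tetrahedron j i = k := by decide
  obtain ⟨k1, k2, k3⟩ := key h
  refine ⟨?_, ?_, ?_, ?_, ?_⟩ <;> intro s <;>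
    simp [ONGraph.graph, OctantCell.vertex, h2, k1, k2, k3, tetrahedron_zero]

theorem nbr_trd_vertex (h : IsColorTriple i j k) :
    (∀ s, fiveBubbleGraph.graph.nbr k (OctantCell.vertex i j k .center s) =
      OctantCell.vertex i j k .center (tetrahedron k s)) ∧
    (∀ s, fiveBubbleGraph.graph.nbr k (OctantCell.vertex i j k .inner s) =
      OctantCell.vertex i j k .right s) ∧
    (∀ s, fiveBubbleGraph.graph.nbr k (OctantCell.vertex i j k .right s) =
      OctantCell.vertex i j k .inner s) ∧
    (∀ s, fiveBubbleGraph.graph.nbr k (OctantCell.vertex i j k .left s) =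
      OctantCell.vertex i j k .outer s) ∧
    (∀ s, fiveBubbleGraph.graph.nbr k (OctantCell.vertex i j k .outer s) =
      OctantCell.vertex i j k .left s) := by
  have h3 := h.ne₃
  have key : ∀ {i j k : Fin 4}, IsColorTriple i j k →
    tetrahedron k j = i ∧ tetrahedron k k = 0 ∧ tetrahedron k i = j := by decide
  obtain ⟨k1, k2, k3⟩ := key h
  refine ⟨?_, ?_, ?_, ?_, ?_⟩ <;> intro s <;>
    simp [ONGraph.graph, OctantCell.vertex, h3, k1, k2, k3, tetrahedron_zero]

theorem surfacePoint_zero (h : IsColorTriple i j k) (hp : p.1 h.color₀ = 0) (s : Fin 4) :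
    h.surfacePoint p .center s = h.surfacePoint p .inner s ∧
    h.surfacePoint p .right s = h.surfacePoint p .right (tetrahedron k s) ∧
    h.surfacePoint p .left s = h.surfacePoint p .left (tetrahedron j s) ∧
    h.surfacePoint p .outer s = h.surfacePoint p .outer (tetrahedron i s) := by
  obtain ⟨h1, h2, h3, h4, h5⟩ := h.nbr_zero_vertex
  exact ⟨h.surfacePoint_eq _ hp (h1 s).symm, h.surfacePoint_eq _ hp (h3 s).symm,
    h.surfacePoint_eq _ hp (h4 s).symm, h.surfacePoint_eq _ hp (h5 s).symm⟩

theorem surfacePoint_snd (h : IsColorTriple i j k) (hp : p.1 h.color₁ = 0) (s : Fin 4) :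
    h.surfacePoint p .center s = h.surfacePoint p .center (tetrahedron j s) ∧
    h.surfacePoint p .inner s = h.surfacePoint p .left s ∧
    h.surfacePoint p .right s = h.surfacePoint p .outer s := by
  obtain ⟨h1, h2, h3, h4, h5⟩ := h.nbr_snd_vertex
  exact ⟨h.surfacePoint_eq _ hp (h1 s).symm, h.surfacePoint_eq _ hp (h2 s).symm,
    h.surfacePoint_eq _ hp (h3 s).symm⟩

theorem surfacePoint_trd (h : IsColorTriple i j k) (hp : p.1 h.color₂ = 0) (s : Fin 4) :
    h.surfacePoint p .center s = h.surfacePoint p .center (tetrahedron k s) ∧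
    h.surfacePoint p .inner s = h.surfacePoint p .right s ∧
    h.surfacePoint p .left s = h.surfacePoint p .outer s := by
  obtain ⟨h1, h2, h3, h4, h5⟩ := h.nbr_trd_vertex
  exact ⟨h.surfacePoint_eq _ hp (h1 s).symm, h.surfacePoint_eq _ hp (h2 s).symm,
    h.surfacePoint_eq _ hp (h4 s).symm⟩

end IsColorTriple

/-! ### The homeomorphism with the projective plane -/

namespace IsColorTriple

variable {i j k : Fin 4} {p : stdSimplex ℝ {c : Fin 4 // c ≠ i}}

/-- Cells of the same octant that share a point of the octant are glued there. -/
theorem surfacePoint_congr_cell (h : IsColorTriple i j k) (t t' : OctantCell) (s : Fin 4)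
    (hx : t.x (p.1 h.color₀) (p.1 h.color₁) (p.1 h.color₂) =
      t'.x (p.1 h.color₀) (p.1 h.color₁) (p.1 h.color₂))
    (hy : t.y (p.1 h.color₀) (p.1 h.color₁) (p.1 h.color₂) =
      t'.y (p.1 h.color₀) (p.1 h.color₁) (p.1 h.color₂))
    (hz : t.z (p.1 h.color₀) (p.1 h.color₁) (p.1 h.color₂) =
      t'.z (p.1 h.color₀) (p.1 h.color₁) (p.1 h.color₂)) :
    h.surfacePoint p t s = h.surfacePoint p t' s := by
  have e0 := h.surfacePoint_zero (p := p)
  have e1 := h.surfacePoint_snd (p := p)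
  have e2 := h.surfacePoint_trd (p := p)
  have hs := h.simplex_sum p
  have p0 := p.2.1 h.color₀
  have p1 := p.2.1 h.color₁
  have p2 := p.2.1 h.color₂
  generalize p.1 h.color₀ = a at *
  generalize p.1 h.color₁ = b at *
  generalize p.1 h.color₂ = c at *
  cases t <;> cases t' <;> simp only [OctantCell.x, OctantCell.y, OctantCell.z] at hx hy hz
  case center.center | inner.inner | right.right | left.left | outer.outer => rfl
  case center.inner => exact (e0 (by linarith) s).1
  case inner.center => exact (e0 (by linarith) s).1.symm
  case center.right => exact (e0 (by linarith) s).1.trans (e2 (by linarith) s).2.1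
  case right.center => exact ((e0 (by linarith) s).1.trans (e2 (by linarith) s).2.1).symm
  case center.left => exact (e0 (by linarith) s).1.trans (e1 (by linarith) s).2.1
  case left.center => exact ((e0 (by linarith) s).1.trans (e1 (by linarith) s).2.1).symm
  case center.outer | outer.center => exact absurd hs (by linarith)
  case inner.right => exact (e2 (by linarith) s).2.1
  case right.inner => exact (e2 (by linarith) s).2.1.symm
  case inner.left => exact (e1 (by linarith) s).2.1
  case left.inner => exact (e1 (by linarith) s).2.1.symm
  case inner.outer => exact (e2 (by linarith) s).2.1.trans (e1 (by linarith) s).2.2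
  case outer.inner => exact ((e2 (by linarith) s).2.1.trans (e1 (by linarith) s).2.2).symm
  case right.left => exact (e2 (by linarith) s).2.1.symm.trans (e1 (by linarith) s).2.1
  case left.right => exact ((e2 (by linarith) s).2.1.symm.trans (e1 (by linarith) s).2.1).symm
  case right.outer => exact (e1 (by linarith) s).2.2
  case outer.right => exact (e1 (by linarith) s).2.2.symm
  case left.outer => exact (e2 (by linarith) s).2.2
  case outer.left => exact (e2 (by linarith) s).2.2.symm

/-- `center` and `left` have a whole side on this plane. `inner` and `outer` touch it in one corner
only, which they share with `center` and `left` respectively, and `right` does not meet it. -/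
theorem surfacePoint_of_x_eq_zero (h : IsColorTriple i j k) (t : OctantCell) (s : Fin 4)
    (hx : t.x (p.1 h.color₀) (p.1 h.color₁) (p.1 h.color₂) = 0) :
    h.surfacePoint p t s = h.surfacePoint p t (tetrahedron j s) := by
  have e0 := h.surfacePoint_zero (p := p)
  have e1 := h.surfacePoint_snd (p := p)
  have e2 := h.surfacePoint_trd (p := p)
  have hs := h.simplex_sum p
  have p0 := p.2.1 h.color₀
  have p1 := p.2.1 h.color₁
  have p2 := p.2.1 h.color₂
  generalize p.1 h.color₀ = a at *
  generalize p.1 h.color₁ = b at *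
  generalize p.1 h.color₂ = c at *
  cases t <;> simp only [OctantCell.x] at hx
  case center => exact (e1 hx s).1
  case inner =>
    have ha := e0 (by linarith)
    exact (ha s).1.symm.trans ((e1 (by linarith) s).1.trans (ha _).1)
  case right => exact absurd hs (by linarith)
  case left => exact (e0 hx s).2.2.1
  case outer =>
    have hc := e2 (by linarith)
    exact (hc s).2.2.symm.trans ((e0 (by linarith) s).2.2.1.trans (hc _).2.2)

theorem surfacePoint_of_y_eq_zero (h : IsColorTriple i j k) (t : OctantCell) (s : Fin 4)
    (hy : t.y (p.1 h.color₀) (p.1 h.color₁) (p.1 h.color₂) = 0) :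
    h.surfacePoint p t s = h.surfacePoint p t (tetrahedron k s) := by
  have e0 := h.surfacePoint_zero (p := p)
  have e1 := h.surfacePoint_snd (p := p)
  have e2 := h.surfacePoint_trd (p := p)
  have hs := h.simplex_sum p
  have p0 := p.2.1 h.color₀
  have p1 := p.2.1 h.color₁
  have p2 := p.2.1 h.color₂
  generalize p.1 h.color₀ = a at *
  generalize p.1 h.color₁ = b at *
  generalize p.1 h.color₂ = c at *
  cases t <;> simp only [OctantCell.y] at hy
  case center => exact (e2 hy s).1
  case inner =>
    have ha := e0 (by linarith)
    exact (ha s).1.symm.trans ((e2 (by linarith) s).1.trans (ha _).1)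
  case right => exact (e0 hy s).2.1
  case left => exact absurd hs (by linarith)
  case outer =>
    have hb := e1 (by linarith)
    exact (hb s).2.2.symm.trans ((e0 (by linarith) s).2.1.trans (hb _).2.2)

theorem surfacePoint_of_z_eq_zero (h : IsColorTriple i j k) (t : OctantCell) (s : Fin 4)
    (hz : t.z (p.1 h.color₀) (p.1 h.color₁) (p.1 h.color₂) = 0) :
    h.surfacePoint p t s = h.surfacePoint p t (tetrahedron i s) := by
  have e0 := h.surfacePoint_zero (p := p)
  have e1 := h.surfacePoint_snd (p := p)
  have e2 := h.surfacePoint_trd (p := p)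
  have hs := h.simplex_sum p
  have p0 := p.2.1 h.color₀
  have p1 := p.2.1 h.color₁
  have p2 := p.2.1 h.color₂
  generalize p.1 h.color₀ = a at *
  generalize p.1 h.color₁ = b at *
  generalize p.1 h.color₂ = c at *
  cases t <;> simp only [OctantCell.z] at hz
  case center => exact absurd hs (by linarith)
  case inner => exact absurd hs (by linarith)
  case right =>
    have hb := e1 (by linarith)
    exact (hb s).2.2.trans ((e0 (by linarith) s).2.2.2.trans (hb _).2.2.symm)
  case left =>
    have hc := e2 (by linarith)
    exact (hc s).2.2.trans ((e0 (by linarith) s).2.2.2.trans (hc _).2.2.symm)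
  case outer => exact (e0 hz s).2.2.2

/-- The vector of the octant `s` represented by a point of a cell. -/
noncomputable def cellVec (h : IsColorTriple i j k) (p : stdSimplex ℝ {c : Fin 4 // c ≠ i})
    (t : OctantCell) (s : Fin 4) : EuclideanSpace ℝ (Fin 3) :=
  !₂[octantSign k s * t.x (p.1 h.color₀) (p.1 h.color₁) (p.1 h.color₂),
    octantSign j s * t.y (p.1 h.color₀) (p.1 h.color₁) (p.1 h.color₂),
    t.z (p.1 h.color₀) (p.1 h.color₁) (p.1 h.color₂)]

theorem cellVec_ne_zero (h : IsColorTriple i j k) (p : stdSimplex ℝ {c : Fin 4 // c ≠ i})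
    (t : OctantCell) (s : Fin 4) : h.cellVec p t s ≠ 0 := by
  intro h0
  have key := t.le_coord_add (p.2.1 h.color₀) (p.2.1 h.color₁) (p.2.1 h.color₂)
  rw [h.simplex_sum] at key
  have h1 : octantSign k s * t.x (p.1 h.color₀) (p.1 h.color₁) (p.1 h.color₂) = 0 :=
    congrArg (fun u : EuclideanSpace ℝ (Fin 3) => u 0) h0
  have h2 : octantSign j s * t.y (p.1 h.color₀) (p.1 h.color₁) (p.1 h.color₂) = 0 :=
    congrArg (fun u : EuclideanSpace ℝ (Fin 3) => u 1) h0
  have h3 : t.z (p.1 h.color₀) (p.1 h.color₁) (p.1 h.color₂) = 0 :=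
    congrArg (fun u : EuclideanSpace ℝ (Fin 3) => u 2) h0
  have hk : octantSign k s ≠ 0 := by rcases octantSign_eq_or k s with e | e <;> simp [e]
  have hj : octantSign j s ≠ 0 := by rcases octantSign_eq_or j s with e | e <;> simp [e]
  have h1' := (mul_eq_zero.1 h1).resolve_left hk
  have h2' := (mul_eq_zero.1 h2).resolve_left hj
  linarith

theorem octantSign_snd (h : IsColorTriple i j k) (s : Fin 4) :
    octantSign k (tetrahedron j s) = -octantSign k s :=
  octantSign_tetrahedron h.ne₂ h.ne₃ h.2.2.2.2.2 s

theorem octantSign_fst (h : IsColorTriple i j k) (s : Fin 4) :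
    octantSign k (tetrahedron i s) = -octantSign k s :=
  octantSign_tetrahedron h.ne₁ h.ne₃ h.2.2.2.2.1 s

theorem cellVec_eq {h : IsColorTriple i j k} {p q : stdSimplex ℝ {c : Fin 4 // c ≠ i}}
    {t t' : OctantCell} {s s' : Fin 4} {r : ℝ} (he : h.cellVec p t s = r • h.cellVec q t' s') :
    octantSign k s * t.x (p.1 h.color₀) (p.1 h.color₁) (p.1 h.color₂) =
      r * (octantSign k s' * t'.x (q.1 h.color₀) (q.1 h.color₁) (q.1 h.color₂)) ∧
    octantSign j s * t.y (p.1 h.color₀) (p.1 h.color₁) (p.1 h.color₂) =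
      r * (octantSign j s' * t'.y (q.1 h.color₀) (q.1 h.color₁) (q.1 h.color₂)) ∧
    t.z (p.1 h.color₀) (p.1 h.color₁) (p.1 h.color₂) =
      r * t'.z (q.1 h.color₀) (q.1 h.color₁) (q.1 h.color₂) :=
  ⟨congrArg (fun u : EuclideanSpace ℝ (Fin 3) => u 0) he,
    congrArg (fun u : EuclideanSpace ℝ (Fin 3) => u 1) he,
    congrArg (fun u : EuclideanSpace ℝ (Fin 3) => u 2) he⟩

/-- Proportional vectors come from points that are glued. -/
theorem surfacePoint_eq_of_cellVec (h : IsColorTriple i j k)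
    {p q : stdSimplex ℝ {c : Fin 4 // c ≠ i}} {t t' : OctantCell} {s s' : Fin 4} {r : ℝ}
    (he : h.cellVec p t s = r • h.cellVec q t' s') :
    h.surfacePoint p t s = h.surfacePoint q t' s' := by
  obtain ⟨hx, hy, hz⟩ := cellVec_eq he
  obtain ⟨n1, n2, n3⟩ := t.coord_nonneg (p.2.1 h.color₀) (p.2.1 h.color₁) (p.2.1 h.color₂)
  obtain ⟨m1, m2, m3⟩ := t'.coord_nonneg (q.2.1 h.color₀) (q.2.1 h.color₁) (q.2.1 h.color₂)
  obtain ⟨c1, c2, c3⟩ := t'.coord_smul |r| (q.1 h.color₀) (q.1 h.color₁) (q.1 h.color₂)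
  -- Absolute values remove the octant signs: `p` and `|r| • q` have the same octant coordinates,
  -- hence are equal, and the coordinate sums give `|r| = 1`.
  have ax := congrArg abs hx
  have ay := congrArg abs hy
  have az := congrArg abs hz
  simp only [abs_mul, abs_octantSign, one_mul, abs_of_nonneg n1, abs_of_nonneg m1,
    abs_of_nonneg n2, abs_of_nonneg m2, abs_of_nonneg n3, abs_of_nonneg m3] at ax ay az
  obtain ⟨e0, e1, e2⟩ := OctantCell.coord_injective t t' (p.2.1 h.color₀) (p.2.1 h.color₁)
    (p.2.1 h.color₂) (mul_nonneg (abs_nonneg r) (q.2.1 h.color₀))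
    (mul_nonneg (abs_nonneg r) (q.2.1 h.color₁)) (mul_nonneg (abs_nonneg r) (q.2.1 h.color₂))
    (ax.trans c1.symm) (ay.trans c2.symm) (az.trans c3.symm)
  have hr : |r| = 1 := by
    have h1 := h.simplex_sum p
    rw [e0, e1, e2, ← mul_add, ← mul_add, h.simplex_sum q, mul_one] at h1
    exact h1
  simp only [hr, one_mul] at e0 e1 e2 ax ay az
  obtain rfl : p = q := by
    refine Subtype.ext (funext fun c => ?_)
    rcases h.jacket_color_cases c with rfl | rfl | rfl
    exacts [e0, e1, e2]
  rw [← h.surfacePoint_congr_cell t t' s' ax ay az]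
  rw [← ax] at hx
  rw [← ay] at hy
  rw [← az] at hz
  have hr' : r = 1 ∨ r = -1 := by
    rcases abs_cases r with ⟨h1, -⟩ | ⟨h1, -⟩ <;> rw [hr] at h1
    · exact Or.inl h1.symm
    · exact Or.inr (by linarith)
  have x0 := h.surfacePoint_of_x_eq_zero (p := p) t
  have y0 := h.surfacePoint_of_y_eq_zero (p := p) t
  have z0 := h.surfacePoint_of_z_eq_zero (p := p) t
  have sk := octantSign_eq_or k s
  have sj := octantSign_eq_or j s
  -- For `r = 1` a sign that differs belongs to a vanishing coordinate, so a plane between octants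
  -- can be crossed. For `r = -1` the third coordinate vanishes and the antipodal gluing,
  -- translation by `i`, is available; a sign that agrees belongs to a vanishing coordinate.
  rcases h.eq_cases s s' with rfl | rfl | rfl | rfl
  · rfl
  · rw [h.octantSign_fst] at hx
    rw [h.swap.octantSign_fst] at hy
    rcases hr' with rfl | rfl
    · have hx0 := x0 s (by rcases sk with e | e <;> rw [e] at hx <;> linarith)
      have hy0 := y0 (tetrahedron j s) (by rcases sj with e | e <;> rw [e] at hy <;> linarith)
      rw [hx0, hy0, h.rotate.rotate.swap.tetrahedron_comp]
    · exact z0 s (by linarith)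
  · rw [h.octantSign_snd] at hx
    rw [octantSign_tetrahedron_self] at hy
    rcases hr' with rfl | rfl
    · exact x0 s (by rcases sk with e | e <;> rw [e] at hx <;> linarith)
    · have hy0 := y0 s (by rcases sj with e | e <;> rw [e] at hy <;> linarith)
      have hz0 := z0 (tetrahedron k s) (by linarith)
      rw [hy0, hz0, h.swap.tetrahedron_comp]
  · rw [octantSign_tetrahedron_self] at hx
    rw [h.swap.octantSign_snd] at hy
    rcases hr' with rfl | rfl
    · exact y0 s (by rcases sj with e | e <;> rw [e] at hy <;> linarith)
    · have hx0 := x0 s (by rcases sk with e | e <;> rw [e] at hx <;> linarith)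
      have hz0 := z0 (tetrahedron j s) (by linarith)
      rw [hx0, hz0, h.tetrahedron_comp]

/-- Points that are glued have equal or opposite vectors. -/
theorem cellVec_nbr (h : IsColorTriple i j k) (c : {c : Fin 4 // c ≠ i}) (hp : p.1 c = 0)
    {t t' : OctantCell} {s s' : Fin 4}
    (hn : t'.vertex i j k s' = fiveBubbleGraph.graph.nbr c.1 (t.vertex i j k s)) :
    h.cellVec p t' s' = h.cellVec p t s ∨ h.cellVec p t' s' = -h.cellVec p t s := by
  have inj : ∀ {t₁ s₁}, t'.vertex i j k s' = OctantCell.vertex i j k t₁ s₁ → t' = t₁ ∧ s' = s₁ :=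
    fun {t₁ s₁} e => ⟨by rw [← h.ofVertex_vertex t' s', e, h.ofVertex_vertex],
      by rw [← OctantCell.octant_vertex i j k t' s', e, OctantCell.octant_vertex]⟩
  have ext3 : ∀ {u v : EuclideanSpace ℝ (Fin 3)}, u 0 = v 0 → u 1 = v 1 → u 2 = v 2 → u = v := by
    intro u v h0 h1 h2
    ext a
    fin_cases a
    exacts [h0, h1, h2]
  obtain ⟨a1, a2, a3, a4, a5⟩ := h.nbr_zero_vertex
  obtain ⟨b1, b2, b3, b4, b5⟩ := h.nbr_snd_vertex
  obtain ⟨d1, d2, d3, d4, d5⟩ := h.nbr_trd_vertex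
  have s1 := h.octantSign_fst
  have s2 := h.octantSign_snd
  have s3 := h.swap.octantSign_fst
  have s4 := h.swap.octantSign_snd
  have s5 := octantSign_tetrahedron_self j
  have s6 := octantSign_tetrahedron_self k
  rcases h.jacket_color_cases c with rfl | rfl | rfl
  · have hn' : _ = fiveBubbleGraph.graph.nbr 0 _ := hn
    cases t <;> simp only [a1, a2, a3, a4, a5] at hn' <;> obtain ⟨rfl, rfl⟩ := inj hn'
    -- Only the gluing of two outer cells along `z = 0` reverses the vector.
    case outer =>
      right
      apply ext3 <;> simp [cellVec, hp, OctantCell.x, OctantCell.y, OctantCell.z,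
        s1, s3]
    all_goals
      left
      apply ext3 <;> simp [cellVec, hp, OctantCell.x, OctantCell.y, OctantCell.z,
        s2, s4, s5, s6]
  · have hn' : _ = fiveBubbleGraph.graph.nbr j _ := hn
    cases t <;> simp only [b1, b2, b3, b4, b5] at hn' <;> obtain ⟨rfl, rfl⟩ := inj hn'
    all_goals
      left
      apply ext3 <;> simp [cellVec, hp, OctantCell.x, OctantCell.y, OctantCell.z,
        s2, s5]
  · have hn' : _ = fiveBubbleGraph.graph.nbr k _ := hn
    cases t <;> simp only [d1, d2, d3, d4, d5] at hn' <;> obtain ⟨rfl, rfl⟩ := inj hn'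
    all_goals
      left
      apply ext3 <;> simp [cellVec, hp, OctantCell.x, OctantCell.y, OctantCell.z,
        s4, s6]

/-- The map of the surface of `J_i` to the projective plane. -/
noncomputable def toProjectivePlane (h : IsColorTriple i j k) :
    (fiveBubbleGraph.jacket i).Surface → RealProjectivePlane :=
  Quot.lift (fun x => .ofVec _ (h.cellVec_ne_zero x.2 (.ofVertex j k x.1) (OctantCell.octant x.1)))
    (by
      rintro ⟨v, p⟩ ⟨w, _⟩ ⟨c, hn, rfl, hp⟩
      obtain ⟨t, s, rfl⟩ := h.exists_vertex v
      obtain ⟨t', s', rfl⟩ := h.exists_vertex w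
      have key := h.cellVec_nbr c hp hn
      simp only [h.ofVertex_vertex, OctantCell.octant_vertex]
      rcases key with e | e
      · congr 1
        exact e.symm
      · exact RealProjectivePlane.ofVec_neg _ _ e)

theorem toProjectivePlane_surfacePoint (h : IsColorTriple i j k) (t : OctantCell) (s : Fin 4) :
    h.toProjectivePlane (h.surfacePoint p t s) = .ofVec _ (h.cellVec_ne_zero p t s) := by
  simp only [toProjectivePlane, surfacePoint, h.ofVertex_vertex, OctantCell.octant_vertex]

theorem exists_surfacePoint (h : IsColorTriple i j k) (x : (fiveBubbleGraph.jacket i).Surface) :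
    ∃ p t s, x = h.surfacePoint p t s := by
  obtain ⟨⟨v, p⟩, rfl⟩ := Quot.exists_rep x
  obtain ⟨t, s, rfl⟩ := h.exists_vertex v
  exact ⟨p, t, s, rfl⟩

theorem toProjectivePlane_injective (h : IsColorTriple i j k) :
    Function.Injective h.toProjectivePlane := by
  intro x y hxy
  obtain ⟨p, t, s, rfl⟩ := h.exists_surfacePoint x
  obtain ⟨q, t', s', rfl⟩ := h.exists_surfacePoint y
  rw [h.toProjectivePlane_surfacePoint, h.toProjectivePlane_surfacePoint] at hxy
  obtain ⟨r, -, he⟩ := RealProjectivePlane.ofVec_eq hxy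
  exact h.surfacePoint_eq_of_cellVec he

theorem toProjectivePlane_surjective (h : IsColorTriple i j k) :
    Function.Surjective h.toProjectivePlane := by
  intro x
  obtain ⟨u, hu, hu2, rfl⟩ := RealProjectivePlane.exists_eq_ofVec x
  obtain ⟨t, a, b, c, ha, hb, hc, hx, hy, hz⟩ :=
    OctantCell.exists_coord (abs_nonneg (u 0)) (abs_nonneg (u 1)) hu2
  obtain ⟨s, hs, hs'⟩ := h.exists_octantSign (u 0) (u 1)
  have hS : 0 < a + b + c := by
    refine lt_of_le_of_ne (by positivity) fun h0 => hu ?_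
    obtain ⟨rfl, rfl, rfl⟩ : a = 0 ∧ b = 0 ∧ c = 0 := ⟨by linarith, by linarith, by linarith⟩
    have hx' : |u 0| = 0 := by rw [← hx]; cases t <;> simp [OctantCell.x]
    have hy' : |u 1| = 0 := by rw [← hy]; cases t <;> simp [OctantCell.y]
    have hz' : u 2 = 0 := by rw [← hz]; cases t <;> simp [OctantCell.z]
    ext l
    fin_cases l
    exacts [abs_eq_zero.1 hx', abs_eq_zero.1 hy', hz']
  -- Normalizing the cone coordinates to sum one gives a point of the simplex and does not change
  -- the line.
  set r := (a + b + c)⁻¹ with hr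
  have hr0 : 0 < r := inv_pos.2 hS
  let f : {c : Fin 4 // c ≠ i} → ℝ := fun l =>
    if l.1 = 0 then r * a else if l.1 = j then r * b else r * c
  have f0 : f h.color₀ = r * a := if_pos rfl
  have f1 : f h.color₁ = r * b := (if_neg h.ne₂).trans (if_pos rfl)
  have f2 : f h.color₂ = r * c := (if_neg h.ne₃).trans (if_neg h.2.2.2.2.2.symm)
  have hf : f ∈ stdSimplex ℝ {c : Fin 4 // c ≠ i} := by
    refine ⟨fun l => ?_, ?_⟩
    · rcases h.jacket_color_cases l with rfl | rfl | rfl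
      · rw [f0]; positivity
      · rw [f1]; positivity
      · rw [f2]; positivity
    · rw [h.jacket_color_sum, f0, f1, f2, ← mul_add, ← mul_add, hr, inv_mul_cancel₀ hS.ne']
  refine ⟨h.surfacePoint ⟨f, hf⟩ t s, ?_⟩
  rw [h.toProjectivePlane_surfacePoint]
  refine RealProjectivePlane.ofVec_smul _ _ hr0 ?_
  obtain ⟨c1, c2, c3⟩ := t.coord_smul r a b c
  ext l
  fin_cases l
  · change octantSign k s * t.x (f h.color₀) (f h.color₁) (f h.color₂) = r * u 0
    rw [f0, f1, f2, c1, hx, mul_left_comm, hs]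
  · change octantSign j s * t.y (f h.color₀) (f h.color₁) (f h.color₂) = r * u 1
    rw [f0, f1, f2, c2, hy, mul_left_comm, hs']
  · change t.z (f h.color₀) (f h.color₁) (f h.color₂) = r * u 2
    rw [f0, f1, f2, c3, hz]

theorem continuous_toProjectivePlane (h : IsColorTriple i j k) :
    Continuous h.toProjectivePlane := by
  refine continuous_quot_lift _ (continuous_sigma fun v => ?_)
  refine RealProjectivePlane.continuous_ofVec
    (f := fun p => h.cellVec p (.ofVertex j k v) (OctantCell.octant v)) ?_ _
  have hc : ∀ c, Continuous fun p : stdSimplex ℝ {c : Fin 4 // c ≠ i} => p.1 c := fun c =>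
    (continuous_apply c).comp continuous_subtype_val
  have h0 := hc h.color₀
  have h1 := hc h.color₁
  have h2 := hc h.color₂
  refine (PiLp.continuous_toLp 2 _).comp (continuous_pi fun l => ?_)
  generalize OctantCell.ofVertex j k v = t
  fin_cases l
  · refine continuous_const.mul ?_
    exact t.continuous_x h0 h1 h2
  · refine continuous_const.mul ?_
    exact t.continuous_y h0 h1 h2
  · exact t.continuous_z h0 h1 h2

/-- A continuous bijection from a compact space, a quotient of finitely many triangles, onto a
Hausdorff space is a homeomorphism. -/
theorem nonempty_surface_homeomorph (h : IsColorTriple i j k) :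
    Nonempty ((fiveBubbleGraph.jacket i).Surface ≃ₜ RealProjectivePlane) :=
  ⟨Continuous.homeoOfEquivCompactToT2
    (f := Equiv.ofBijective _ ⟨h.toProjectivePlane_injective, h.toProjectivePlane_surjective⟩)
    h.continuous_toProjectivePlane⟩

end IsColorTriple

/-! ### Existence, uniqueness and properties combined -/

theorem theorem7p1 :
    fiveBubbleGraph.IsTwoPIDipoleFreeOfDegreeThreeHalves ∧
    (∀ (B : Type*) [Finite B] (G : ONGraph B),
      G.IsTwoPIDipoleFreeOfDegreeThreeHalves → G.graph.IsIsomorphic fiveBubbleGraph.graph) ∧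
    (∀ i : Fin 4, i ≠ 0 →
      (fiveBubbleGraph.jacket i).genus = 1 / 2 ∧
      Nonempty ((fiveBubbleGraph.jacket i).Surface ≃ₜ RealProjectivePlane) ∧
      {f : fiveBubbleGraph.Face i | fiveBubbleGraph.faceLength f = 3}.ncard = 2 ∧
      {f : fiveBubbleGraph.Face i | fiveBubbleGraph.faceLength f = 4}.ncard = 1 ∧
      ∀ f : fiveBubbleGraph.Face i,
        fiveBubbleGraph.faceLength f = 3 ∨ fiveBubbleGraph.faceLength f = 4) := by
  refine ⟨ONGraph.fiveBubble_isTwoPIDipoleFreeOfDegreeThreeHalves, fun B _ G hG => ?_,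
    fun i hi => ⟨ONGraph.fiveBubble_genus hi, ?_, ONGraph.fiveBubble_faces hi⟩⟩
  · obtain ⟨hs, b, hb⟩ := hG.exists_center
    exact ONGraph.isIsomorphic_of_center hG.1 hs hb
  · obtain ⟨j, k, h⟩ := exists_isColorTriple i hi
    exact h.nonempty_surface_homeomorph
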